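/- **Notation.** Identify the weight lattice of type $A_3$ with $\mathbb{Z}^3$ via the fundamental weights; its root lattice $Q$ is the weight lattice of $PU(4)$, and $\zeta_3(\cdot,\mathbf 0;PU(4))$ is the sum over $\lambda\in (Q\cap P_+)+\rho$ of $\prod_{\alpha>0}\langle\alpha^\vee,\lambda\rangle^{-s_\alpha}$, that is, $$\zeta_3((s_1,\dots,s_6),\mathbf 0;PU(4))=\sum_{\substack{m_1,m_2,m_3\ge1\\ m_1+2m_2+3m_3\equiv 2\,(4)}}\frac{1}{m_1^{s_1}m_2^{s_2}m_3^{s_3}(m_1+m_2)^{s_4}(m_2+m_3)^{s_5}(m_1+m_2+m_3)^{s_6}} .$$ For positive integers $p,q$ put $$\mathfrak T(p,s,q;x,y)=\sum_{\substack{l\in\mathbb Z,\ m\ge1\\ l\ne0,\ l+m\ne0}}\frac{x^ly^m}{l^pm^s(l+m)^q}.$$ These series are continued meromorphically in the single complex variable $s$, all other arguments being positive integers. A point $s$ is *regular* for such a function if the function has a meromorphic continuation to a right half-plane containing $s$ that is analytic at $s$; the value at $s$ is the value of this continuation. Let $\phi(s)=(2^{1-s}-1)\zeta(s)$, let $L(s,\chi_4)$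 be the Dirichlet $L$-function of the primitive character $\chi_4$ of conductor $4$, and for integers $n\ge 0$ let $$\varLambda(n;\pm i)=2^{-n}(1+e^{-\pi i n})(2^{1-n}-1)\zeta(n)\pm i(1-e^{-\pi i n})L(n,\chi_4)$$ (the first summand being $0$ for $n=1$). For a function $f$ and parameters $x_1,y_1,x_2,y_2,x_3,y_3$ let $$\begin{aligned} E_f={}&2(-1)^p\sum_{j=0}^{[p/2]}f(2j)\sum_{\omega=0}^{p-2j}\tbinom{\omega+a-1}{\omega}\tbinom{p+c-2j-\omega-1}{c-1}\mathfrak T(q+a+\omega,s,p+b+c-2j-\omega;x_1,y_1)\\ &+2(-1)^{p+a}\sum_{j=0}^{[c/2]}f(2j)\sum_{\omega=0}^{c-2j}\tbinom{\omega+a-1}{\omega}\tbinom{p+c-2j-\omega-1}{p-1}\mathfrak T(q,s+a+\omega,p+b+c-2j-\omega;x_2,y_2)\\ &+2(-1)^p\sum_{j=0}^{[a/2]}f(2j)\sum_{\omega=0}^{p-1}\tbinom{\omega+a-2j}{\omega}\tbinom{p+c-2-\omega}{c-1}\mathfrak T(q+a-2j+\omega+1,s,p+b+c-1-\omega;x_3,y_3)\\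 &+2(-1)^{p+a}\sum_{j=0}^{[a/2]}f(2j)\sum_{\omega=0}^{c-1}\tbinom{\omega+a-2j}{\omega}\tbinom{p+c-2-\omega}{p-1}\mathfrak T(q,s+a-2j+\omega+1,p+b+c-1-\omega;x_3,y_3) \end{aligned}$$ and $$\begin{aligned} F_f={}&(-1)^p\sum_{j=0}^{p}f(j)(-1)^j\sum_{\omega=0}^{p-j}\tbinom{\omega+a-1}{\omega}\tbinom{p+c-j-\omega-1}{c-1}\mathfrak T(q+a+\omega,s,p+b+c-j-\omega;x_1,y_1)\\ &+(-1)^{p+a}\sum_{j=0}^{c}f(j)\sum_{\omega=0}^{c-j}\tbinom{\omega+a-1}{\omega}\tbinom{p+c-j-\omega-1}{p-1}\mathfrak T(q,s+a+\omega,p+b+c-j-\omega;x_2,y_2)\\ &+(-1)^p\sum_{j=0}^{a}f(j)\sum_{\omega=0}^{p-1}\tbinom{\omega+a-j}{\omega}\tbinom{p+c-2-\omega}{c-1}\mathfrak T(q+a-j+\omega+1,s,p+b+c-1-\omega;x_3,y_3)\\ &+(-1)^{p+a}\sum_{j=0}^{a}f(j)(-1)^j\sum_{\omega=0}^{c-1}\tbinom{\omega+a-j}{\omega}\tbinom{p+c-2-\omega}{p-1}\mathfrak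 T(q,s+a-j+\omega+1,p+b+c-1-\omega;x_3,y_3). \end{aligned}$$ Define, with the parameters $(x_1,y_1),(x_2,y_2),(x_3,y_3)$ in this order, - $J_0=E_{\zeta}$ with $(1,1),(1,1),(1,1)$; - $J_1=F_{\varLambda(\cdot;-i)}$ with $(-1,i),(-i,-1),(-i,i)$; - $J_2=E_{\phi}$ with $(1,-1),(-1,1),(-1,-1)$; - $J_3=F_{\varLambda(\cdot;i)}$ with $(-1,-i),(i,-1),(i,-i)$. **Theorem.** Let $p,q,a,b,c$ be positive integers, and write $Z(\cdot)=\zeta_3(\cdot,\mathbf 0;PU(4))$. Every $s$ with $\Re s>1$ is a regular point of all the functions $Z$ and $\mathfrak T$ occurring below. For every $s\in\mathbb C$ at which all these functions are regular, $$\begin{aligned} &Z(p,q,s,a,b,c)+(-1)^pZ(p,a,s,q,c,b)+(-1)^{p+a}Z(q,a,c,p,s,b)+(-1)^{p+a+c}Z(q,s,c,b,a,p)\\ &+(-1)^{q}Z(a,q,b,p,s,c)+(-1)^{q+b}Z(a,s,b,c,q,p)+(-1)^{q+a}Z(a,p,b,q,c,s)+(-1)^{q+a+b}Z(a,c,b,s,p,q)\\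 &+(-1)^{q+a+b+c}Z(s,c,p,a,b,q)+(-1)^{p+q+a}Z(q,p,c,a,b,s)+(-1)^{p+q+a+c}Z(q,b,c,s,p,a)\\ &+(-1)^{p+q+a+b+c}Z(s,b,p,q,c,a)\;=\;\tfrac14\,(J_0-J_1+J_2-J_3). \end{aligned}$$ Moreover this is a functional relation among $\zeta_3(\cdot,\mathbf 0;PU(4))$, $\zeta(s)$ and $L(s,\chi_4)$: there are constants $A_k,B_k,C_k,D_k$ (depending on $p,q,a,b,c,k$ but not on $s$) in the ring $\mathbb Q[\,i,\ \zeta(2j)\ (j\ge1),\ L(2j+1,\chi_4)\ (j\ge0)]$ such that the left-hand side equals $$\sum_{k=2}^{p+q+a+b+c}\Big((A_k+B_k2^{-s}+C_k4^{-s})\,\zeta(s+k)+D_k\,L(s+k,\chi_4)\Big)$$ for every $s\in\mathbb C$ at which the twelve functions on the left are regular and with $s+k\neq1$ for $2\le k\le p+q+a+b+c$. -/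

import Mathlib

/-! ### Meromorphic continuation of a Dirichlet-type series in one complex variable -/

/-- `F` continues the series `∑ᵢ tᵢ(z)` to the half-plane `re z > σ`: it is meromorphic there and,
in some right half-plane, the series converges absolutely with sum `F z`. -/
def IsSeriesContinuation {ι : Type*} (t : ι → ℂ → ℂ) (σ : ℝ) (F : ℂ → ℂ) : Prop :=
  MeromorphicOn F {z | σ < z.re} ∧
    ∃ σ₁ : ℝ, ∀ z : ℂ, σ₁ < z.re → Summable (fun i => t i z) ∧ F z = ∑' i, t i z

/-- `s` is a regular point (not a singularity) of the meromorphic continuation of `∑ᵢ tᵢ(z)`: the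
series has a continuation to a right half-plane containing `s` which is analytic at `s`. -/
def IsRegularPoint {ι : Type*} (t : ι → ℂ → ℂ) (s : ℂ) : Prop :=
  ∃ (σ : ℝ) (F : ℂ → ℂ), σ < s.re ∧ IsSeriesContinuation t σ F ∧ AnalyticAt ℂ F s

open Classical in
/-- The value at `s` of the meromorphic continuation of `∑ᵢ tᵢ(z)`; by `continued_eq` it does not
depend on the choice of the continuation (at a point that is not regular it is set to `0`). -/
noncomputable def continued {ι : Type*} (t : ι → ℂ → ℂ) (s : ℂ) : ℂ :=
  if h : IsRegularPoint t s then h.choose_spec.choose s else 0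

/-- Any two continuations that are analytic at `s` agree at `s`. -/
theorem IsSeriesContinuation.unique {ι : Type*} {t : ι → ℂ → ℂ} {s : ℂ} {σ τ : ℝ} {F G : ℂ → ℂ}
    (hσ : σ < s.re) (hF : IsSeriesContinuation t σ F) (hFs : AnalyticAt ℂ F s)
    (hτ : τ < s.re) (hG : IsSeriesContinuation t τ G) (hGs : AnalyticAt ℂ G s) : F s = G s := by
  obtain ⟨hF, σ₁, hF₁⟩ := hF
  obtain ⟨hG, τ₁, hG₁⟩ := hG
  have hpre : IsPreconnected {z : ℂ | max σ τ < z.re} :=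
    (convex_halfSpace_re_gt (max σ τ)).isPreconnected
  have hM : MeromorphicOn (F - G) {z : ℂ | max σ τ < z.re} :=
    (hF.mono_set fun z (hz : max σ τ < z.re) => (le_max_left σ τ).trans_lt hz).sub
      (hG.mono_set fun z (hz : max σ τ < z.re) => (le_max_right σ τ).trans_lt hz)
  obtain ⟨r, hr⟩ := exists_gt (max (max σ τ) (max σ₁ τ₁))
  have hr0 : max σ τ < r := (le_max_left _ _).trans_lt hr
  have hr1 : σ₁ < r := ((le_max_left _ _).trans (le_max_right _ _)).trans_lt hr
  have hr2 : τ₁ < r := ((le_max_right _ _).trans (le_max_right _ _)).trans_lt hr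
  have hsU : s ∈ {z : ℂ | max σ τ < z.re} := max_lt hσ hτ
  have hrU : (r : ℂ) ∈ {z : ℂ | max σ τ < z.re} := by simpa using hr0
  have htop : meromorphicOrderAt (F - G) (r : ℂ) = ⊤ := by
    rw [meromorphicOrderAt_eq_top_iff]
    have hopen : IsOpen {z : ℂ | σ₁ < z.re ∧ τ₁ < z.re} :=
      (isOpen_lt continuous_const Complex.continuous_re).inter
        (isOpen_lt continuous_const Complex.continuous_re)
    have hmem : {z : ℂ | σ₁ < z.re ∧ τ₁ < z.re} ∈ nhds (r : ℂ) :=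
      hopen.mem_nhds (by simpa using ⟨hr1, hr2⟩)
    refine Filter.Eventually.filter_mono nhdsWithin_le_nhds ?_
    filter_upwards [hmem] with z hz
    simp [(hF₁ z hz.1).2, (hG₁ z hz.2).2]
  have hordS : meromorphicOrderAt (F - G) s = ⊤ := by
    by_contra hne
    exact hM.meromorphicOrderAt_ne_top_of_isPreconnected hpre hsU hrU hne htop
  rw [meromorphicOrderAt_eq_top_iff] at hordS
  have hc : ContinuousAt (F - G) s := hFs.continuousAt.sub hGs.continuousAt
  have h1 : Filter.Tendsto (F - G) (nhdsWithin s {s}ᶜ) (nhds ((F - G) s)) :=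
    hc.tendsto.mono_left nhdsWithin_le_nhds
  have h2 : Filter.Tendsto (F - G) (nhdsWithin s {s}ᶜ) (nhds 0) :=
    tendsto_const_nhds.congr' (hordS.mono fun z hz => hz.symm)
  exact sub_eq_zero.mp (tendsto_nhds_unique h1 h2)

theorem continued_eq {ι : Type*} {t : ι → ℂ → ℂ} {s : ℂ} {σ : ℝ} {F : ℂ → ℂ}
    (hσ : σ < s.re) (hF : IsSeriesContinuation t σ F) (hFs : AnalyticAt ℂ F s) :
    continued t s = F s := by
  have h : IsRegularPoint t s := ⟨σ, F, hσ, hF, hFs⟩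
  have hs := h.choose_spec.choose_spec
  rw [continued, dif_pos h]
  exact IsSeriesContinuation.unique hs.1 hs.2.1 hs.2.2 hσ hF hFs

/-! ### Zeta-functions of weight lattices of type `A₃`

The weight lattice `P` is identified with `ℤ³` through the fundamental weights `λ₁, λ₂, λ₃`;
a vector `y` is given by its coordinates with respect to the simple coroots
`α₁^∨, α₂^∨, α₃^∨`, so that `⟨y, λ⟩ = ∑ yᵢ λᵢ`. -/

/-- The root lattice `Q`, spanned by `αⱼ = ∑ᵢ ⟨αᵢ^∨, αⱼ⟩ λᵢ`. It is the weight lattice of `PU(4)`. -/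
def rootLatticeA3 : AddSubgroup (Fin 3 → ℤ) :=
  AddSubgroup.closure (Set.range fun j : Fin 3 => fun i : Fin 3 => CartanMatrix.A 3 i j)

/-- The set `L₊ + ρ`, where `L₊ = L ∩ P₊` and `ρ = λ₁ + λ₂ + λ₃`. -/
def shiftedDominant (L : AddSubgroup (Fin 3 → ℤ)) : Set (Fin 3 → ℤ) :=
  {w | ∃ μ ∈ L, (∀ i, 0 ≤ μ i) ∧ w = μ + 1}

/-- The positive coroots, in the order
`α₁^∨, α₂^∨, α₃^∨, (α₁+α₂)^∨, (α₂+α₃)^∨, (α₁+α₂+α₃)^∨`. -/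
def posCorootA3 : Fin 6 → Fin 3 → ℤ :=
  ![![1, 0, 0], ![0, 1, 0], ![0, 0, 1], ![1, 1, 0], ![0, 1, 1], ![1, 1, 1]]

/-- The summand `e^{2πi⟨y,λ⟩} ∏_{α>0} ⟨α^∨,λ⟩^{-s_α}` of `ζ₃(s, y; L; A₃)`. -/
noncomputable def zetaA3Term (y : Fin 3 → ℝ) (w : Fin 3 → ℤ) (s : Fin 6 → ℂ) : ℂ :=
  Complex.exp (2 * Real.pi * Complex.I * ∑ i, (y i : ℂ) * (w i : ℂ)) *
    ∏ k, ((posCorootA3 k ⬝ᵥ w : ℤ) : ℂ) ^ (-s k)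

/-- The summands of `ζ₃(v(z), 0; PU(4))` as functions of one complex variable `z`, where
`z ↦ v(z) ∈ ℂ⁶` is a family of arguments. -/
noncomputable def zetaPU4Terms (v : ℂ → Fin 6 → ℂ) (w : shiftedDominant rootLatticeA3) (z : ℂ) :
    ℂ :=
  zetaA3Term 0 w.1 (v z)

/-- The twelve families of arguments of `ζ₃(·, 0; PU(4))`, as functions of `s`. -/
def permutedArgs (p q a b c : ℕ) : Fin 12 → ℂ → Fin 6 → ℂ :=
  ![fun s => ![p, q, s, a, b, c], fun s => ![p, a, s, q, c, b],
    fun s => ![q, a, c, p, s, b], fun s => ![q, s, c, b, a, p],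
    fun s => ![a, q, b, p, s, c], fun s => ![a, s, b, c, q, p],
    fun s => ![a, p, b, q, c, s], fun s => ![a, c, b, s, p, q],
    fun s => ![s, c, p, a, b, q], fun s => ![q, p, c, a, b, s],
    fun s => ![q, b, c, s, p, a], fun s => ![s, b, p, q, c, a]]

/-- The exponents of `-1` in the twelve signs. -/
def signExponent (p q a b c : ℕ) : Fin 12 → ℕ :=
  ![0, p, p + a, p + a + c, q, q + b, q + a, q + a + b, q + a + b + c, p + q + a,
    p + q + a + c, p + q + a + b + c]

/-- `s` is a singularity of none of the twelve functions `ζ₃(·, 0; PU(4))`. -/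
def PU4Regular (p q a b c : ℕ) (s : ℂ) : Prop :=
  ∀ i, IsRegularPoint (zetaPU4Terms (permutedArgs p q a b c i)) s

/-- The twelve-term signed sum of (continued) values of `ζ₃(·, 0; PU(4))`. -/
noncomputable def PU4SignedSum (p q a b c : ℕ) (s : ℂ) : ℂ :=
  ∑ i, (-1) ^ signExponent p q a b c i * continued (zetaPU4Terms (permutedArgs p q a b c i)) s

/-! ### The double series `𝔗(p, s, q; x, y)` -/

/-- The summands of `𝔗(p, s, q; x, y) = ∑ xˡ yᵐ / (lᵖ mˢ (l + m)^q)` over integers `l ≠ 0`, `m ≥ 1`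
with `l + m ≠ 0`, as functions of `s`. -/
noncomputable def doubleTerms (p q : ℕ) (x y : ℂ)
    (i : {i : ℤ × ℕ // i.1 ≠ 0 ∧ 1 ≤ i.2 ∧ i.1 + i.2 ≠ 0}) (s : ℂ) : ℂ :=
  x ^ i.1.1 * y ^ i.1.2 /
    ((i.1.1 : ℂ) ^ p * (i.1.2 : ℂ) ^ s * ((i.1.1 + i.1.2 : ℤ) : ℂ) ^ q)

/-- The continued value `𝔗(p, s, q; x, y)`. -/
noncomputable def doubleT (p : ℕ) (s : ℂ) (q : ℕ) (x y : ℂ) : ℂ :=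
  continued (doubleTerms p q x y) s

/-- `s` is not a singularity of `𝔗(p, ·, q; x, y)`. -/
def DoubleTRegular (p : ℕ) (s : ℂ) (q : ℕ) (x y : ℂ) : Prop :=
  IsRegularPoint (doubleTerms p q x y) s

/-! ### The right-hand sides `J₀, J₁, J₂, J₃` -/

/-- `φ(s) = (2^{1-s} - 1) ζ(s)`, the continuation of `∑ (-1)ⁿ n^{-s}`, at natural numbers
`s ≠ 1`. -/
noncomputable def phi (n : ℕ) : ℂ := (2 ^ (1 - n : ℤ) - 1) * riemannZeta n

/-- `L(s, χ₄)`, with `χ₄` the primitive Dirichlet character of conductor `4`. -/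
noncomputable def Lchi4 (s : ℂ) : ℂ :=
  DirichletCharacter.LFunction (ZMod.χ₄.ringHomComp (Int.castRingHom ℂ)) s

/-- `Λ(n; εi)` for `ε = ±1`, i.e.
`2^{-n} (1 + e^{-πin}) (2^{1-n} - 1) ζ(n) + ε i (1 - e^{-πin}) L(n, χ₄)`. -/
noncomputable def bigLambda (ε : ℂ) (n : ℕ) : ℂ :=
  2 ^ (-n : ℤ) * (1 + Complex.exp (-Real.pi * Complex.I * n)) * (2 ^ (1 - n : ℤ) - 1) *
      riemannZeta n +
    ε * Complex.I * (1 - Complex.exp (-Real.pi * Complex.I * n)) * Lchi4 n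

/-- The common shape of `J₀` and `J₂`: `f` is `ζ` or `φ`, and `(xᵢ, yᵢ)` are the arguments of `𝔗` in
the first sum, in the second sum, and in the last two sums. -/
noncomputable def evenRHS (f : ℕ → ℂ) (x₁ y₁ x₂ y₂ x₃ y₃ : ℂ) (p q a b c : ℕ) (s : ℂ) : ℂ :=
  2 * (-1) ^ p * ∑ j ∈ Finset.range (p / 2 + 1), f (2 * j) *
      ∑ ω ∈ Finset.range (p - 2 * j + 1),
        ((ω + a - 1).choose ω : ℂ) * ((p + c - 2 * j - ω - 1).choose (c - 1) : ℂ) *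
          doubleT (q + a + ω) s (p + b + c - 2 * j - ω) x₁ y₁ +
  2 * (-1) ^ (p + a) * ∑ j ∈ Finset.range (c / 2 + 1), f (2 * j) *
      ∑ ω ∈ Finset.range (c - 2 * j + 1),
        ((ω + a - 1).choose ω : ℂ) * ((p + c - 2 * j - ω - 1).choose (p - 1) : ℂ) *
          doubleT q (s + a + ω) (p + b + c - 2 * j - ω) x₂ y₂ +
  2 * (-1) ^ p * ∑ j ∈ Finset.range (a / 2 + 1), f (2 * j) *
      ∑ ω ∈ Finset.range p,
        ((ω + (a - 2 * j)).choose ω : ℂ) * ((p + c - 2 - ω).choose (c - 1) : ℂ) *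
          doubleT (q + (a - 2 * j) + ω + 1) s (p + b + c - 1 - ω) x₃ y₃ +
  2 * (-1) ^ (p + a) * ∑ j ∈ Finset.range (a / 2 + 1), f (2 * j) *
      ∑ ω ∈ Finset.range c,
        ((ω + (a - 2 * j)).choose ω : ℂ) * ((p + c - 2 - ω).choose (p - 1) : ℂ) *
          doubleT q (s + (a - 2 * j : ℕ) + ω + 1) (p + b + c - 1 - ω) x₃ y₃

/-- `s` is a singularity of none of the functions `𝔗` occurring in `evenRHS`. -/
def EvenRHSRegular (x₁ y₁ x₂ y₂ x₃ y₃ : ℂ) (p q a b c : ℕ) (s : ℂ) : Prop :=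
  (∀ j ≤ p / 2, ∀ ω ≤ p - 2 * j,
    DoubleTRegular (q + a + ω) s (p + b + c - 2 * j - ω) x₁ y₁) ∧
  (∀ j ≤ c / 2, ∀ ω ≤ c - 2 * j,
    DoubleTRegular q (s + a + ω) (p + b + c - 2 * j - ω) x₂ y₂) ∧
  (∀ j ≤ a / 2, ∀ ω < p,
    DoubleTRegular (q + (a - 2 * j) + ω + 1) s (p + b + c - 1 - ω) x₃ y₃) ∧
  (∀ j ≤ a / 2, ∀ ω < c,
    DoubleTRegular q (s + (a - 2 * j : ℕ) + ω + 1) (p + b + c - 1 - ω) x₃ y₃)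

/-- The common shape of `J₁` and `J₃`: `f j` is `Λ(j; -i)` or `Λ(j; i)`, and `(xᵢ, yᵢ)` are the
arguments of `𝔗` in the first sum, in the second sum, and in the last two sums. -/
noncomputable def fullRHS (f : ℕ → ℂ) (x₁ y₁ x₂ y₂ x₃ y₃ : ℂ) (p q a b c : ℕ) (s : ℂ) : ℂ :=
  (-1) ^ p * ∑ j ∈ Finset.range (p + 1), f j * (-1) ^ j *
      ∑ ω ∈ Finset.range (p - j + 1),
        ((ω + a - 1).choose ω : ℂ) * ((p + c - j - ω - 1).choose (c - 1) : ℂ) *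
          doubleT (q + a + ω) s (p + b + c - j - ω) x₁ y₁ +
  (-1) ^ (p + a) * ∑ j ∈ Finset.range (c + 1), f j *
      ∑ ω ∈ Finset.range (c - j + 1),
        ((ω + a - 1).choose ω : ℂ) * ((p + c - j - ω - 1).choose (p - 1) : ℂ) *
          doubleT q (s + a + ω) (p + b + c - j - ω) x₂ y₂ +
  (-1) ^ p * ∑ j ∈ Finset.range (a + 1), f j *
      ∑ ω ∈ Finset.range p,
        ((ω + (a - j)).choose ω : ℂ) * ((p + c - 2 - ω).choose (c - 1) : ℂ) *
          doubleT (q + (a - j) + ω + 1) s (p + b + c - 1 - ω) x₃ y₃ +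
  (-1) ^ (p + a) * ∑ j ∈ Finset.range (a + 1), f j * (-1) ^ j *
      ∑ ω ∈ Finset.range c,
        ((ω + (a - j)).choose ω : ℂ) * ((p + c - 2 - ω).choose (p - 1) : ℂ) *
          doubleT q (s + (a - j : ℕ) + ω + 1) (p + b + c - 1 - ω) x₃ y₃

/-- `s` is a singularity of none of the functions `𝔗` occurring in `fullRHS`. -/
def FullRHSRegular (x₁ y₁ x₂ y₂ x₃ y₃ : ℂ) (p q a b c : ℕ) (s : ℂ) : Prop :=
  (∀ j ≤ p, ∀ ω ≤ p - j,
    DoubleTRegular (q + a + ω) s (p + b + c - j - ω) x₁ y₁) ∧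
  (∀ j ≤ c, ∀ ω ≤ c - j,
    DoubleTRegular q (s + a + ω) (p + b + c - j - ω) x₂ y₂) ∧
  (∀ j ≤ a, ∀ ω < p,
    DoubleTRegular (q + (a - j) + ω + 1) s (p + b + c - 1 - ω) x₃ y₃) ∧
  (∀ j ≤ a, ∀ ω < c,
    DoubleTRegular q (s + (a - j : ℕ) + ω + 1) (p + b + c - 1 - ω) x₃ y₃)

/-- The right-hand side of the relation for `ζ₃(·; A₃)`. -/
noncomputable def J0 (p q a b c : ℕ) (s : ℂ) : ℂ :=
  evenRHS (fun n => riemannZeta n) 1 1 1 1 1 1 p q a b c s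

/-- The right-hand side of the relation for `ζ₃(·, λ₁^∨; SU(4))`. -/
noncomputable def J1 (p q a b c : ℕ) (s : ℂ) : ℂ :=
  fullRHS (bigLambda (-1)) (-1) Complex.I (-Complex.I) (-1) (-Complex.I) Complex.I p q a b c s

/-- The right-hand side of the relation for `ζ₃(·, λ₂^∨; SU(4))`. -/
noncomputable def J2 (p q a b c : ℕ) (s : ℂ) : ℂ :=
  evenRHS phi 1 (-1) (-1) 1 (-1) (-1) p q a b c s

/-- The right-hand side of the relation for `ζ₃(·, λ₃^∨; SU(4))`. -/
noncomputable def J3 (p q a b c : ℕ) (s : ℂ) : ℂ :=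
  fullRHS (bigLambda 1) (-1) (-Complex.I) Complex.I (-1) Complex.I (-Complex.I) p q a b c s

/-- `s` is a singularity of none of the functions `𝔗` occurring in `J₀, J₁, J₂, J₃`. -/
def JRegular (p q a b c : ℕ) (s : ℂ) : Prop :=
  EvenRHSRegular 1 1 1 1 1 1 p q a b c s ∧
  FullRHSRegular (-1) Complex.I (-Complex.I) (-1) (-Complex.I) Complex.I p q a b c s ∧
  EvenRHSRegular 1 (-1) (-1) 1 (-1) (-1) p q a b c s ∧
  FullRHSRegular (-1) (-Complex.I) Complex.I (-1) Complex.I (-Complex.I) p q a b c s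

/-- The ring `ℚ[i, ζ(2k) (k ≥ 1), L(2k+1, χ₄) (k ≥ 0)]`. -/
noncomputable def coefficientRing : Subalgebra ℚ ℂ :=
  Algebra.adjoin ℚ ({Complex.I} ∪ {z | ∃ k : ℕ, 1 ≤ k ∧ z = riemannZeta (2 * k)} ∪
    {z | ∃ k : ℕ, z = Lchi4 (2 * k + 1)})

/-!
Put `(n, l, m) = (x₁ - x₂, x₂ - x₃, x₃ - x₄)` and consider `∏ ⟨α^∨, (n, l, m)⟩^{-s_α}`, with the
exponents `p, q, s, a, b, c`, at all lattice points with `m > 0` outside the reflection hyperplanes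
(`latticeTerm`). These points fall into twelve chambers, one for each ordering of `x₁, …, x₄` with
`x₃ > x₄`. In the coordinates of its own chamber the sum over one chamber is, up to a sign, a value
of the zeta-function of `PU(4)` at permuted arguments, provided only the points in one coset of the
root lattice are kept; so the signed sum is one sum over this coset (`PU4SignedSum_eq_tsum`). By
orthogonality of the characters of weight lattice modulo root lattice, it is a quarter of an
alternating sum of four lattice sums twisted by `x ^ (n + 2 l + 3 m)` with `x ^ 4 = 1`
(`PU4SignedSum_eq_twistedSum`).

For fixed `(l, m)` the sum over `n` is a sum of `xⁿ` times a rational function of `n` with poles at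
`0`, `-l`, `-(l + m)`, the poles being left out. Decompose it into partial fractions and sum each
`xⁿ / (n - P)ʲ` symmetrically over `n ≠ P`, which gives `x ^ P * g j`. Here `g j` is `0` for odd `j`
and `2 ζ(j)` or `2 φ(j)` for even `j` if `x = 1` or `x = -1`, and `Λ(j; ±i)` if `x = ±i`. The poles
left out are accounted for by the convention `g 0 = -1`, so that the whole sum is given by the
Laurent coefficients of non-positive index at the poles (`hasSum_symmetricIcc_prod_inv_pow`); these
are products of binomial series. The summation over `(l, m)` then yields the double series `𝔗`, and
the four twisted sums for `x = 1, i, -1, -i` are `J₀, J₃, J₂, J₁`. Symmetric summation is needed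
because the partial fractions with `j = 1` are not absolutely summable; the value `Λ(1; ±i) = ±2 i
L(1, χ₄)` comes from Leibniz's series.

All this takes place for `re s > 1`. It extends to all regular points because two meromorphic
continuations that agree far to the right agree where both are analytic
(`IsContinuedAt.eq_of_eq_right`).

In the same way, the sum over `l` in `𝔗(p, s, q; x, y)` with `x ^ 4 = y ^ 4 = 1` can be evaluated
(`doubleT_eq_sum_rootSum`), which leaves single series `∑ zᵐ / m ^ (s + k)` with `z ^ 4 = 1`. These
are combinations of `ζ(s + k)`, `2^{-s} ζ(s + k)`, `4^{-s} ζ(s + k)` and `L(s + k, χ₄)`, and the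
coefficients are rational polynomials in `i` and the values `g j`, whence the last assertion.
-/

/-! ### Transfer of identities along continuations -/

/-- `Φ` agrees at `s`, and far to the right, with one function which is meromorphic on a right
half-plane containing `s` and analytic at `s`. -/
def IsContinuedAt (Φ : ℂ → ℂ) (s : ℂ) : Prop :=
  ∃ (σ : ℝ) (F : ℂ → ℂ), σ < s.re ∧ IsSeriesContinuation (fun _ : Unit => Φ) σ F ∧
    AnalyticAt ℂ F s ∧ F s = Φ s

theorem isSeriesContinuation_unit_iff {Φ F : ℂ → ℂ} {σ : ℝ} :
    IsSeriesContinuation (fun _ : Unit => Φ) σ F ↔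
      MeromorphicOn F {z | σ < z.re} ∧ ∃ σ₁ : ℝ, ∀ z : ℂ, σ₁ < z.re → F z = Φ z := by
  simp [IsSeriesContinuation, Summable.of_finite]

/-- An identity between two functions far to the right persists at every point at which both are
continued. -/
theorem IsContinuedAt.eq_of_eq_right {Φ Ψ : ℂ → ℂ} {s : ℂ} (hΦ : IsContinuedAt Φ s)
    (hΨ : IsContinuedAt Ψ s) (h : ∀ z : ℂ, 1 < z.re → Φ z = Ψ z) : Φ s = Ψ s := by
  obtain ⟨σ, F, hσ, hF, hFs, hFe⟩ := hΦ
  obtain ⟨τ, G, hτ, hG, hGs, hGe⟩ := hΨ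
  rw [← hFe, ← hGe]
  refine IsSeriesContinuation.unique hσ hF hFs hτ ?_ hGs
  rw [isSeriesContinuation_unit_iff] at hG ⊢
  obtain ⟨hGm, σ₁, h₁⟩ := hG
  refine ⟨hGm, max σ₁ 1, fun z hz => ?_⟩
  rw [h₁ z ((le_max_left _ _).trans_lt hz), h z ((le_max_right _ _).trans_lt hz)]

theorem IsContinuedAt.of_meromorphic {Φ : ℂ → ℂ} {s : ℂ} (h : ∀ z, MeromorphicAt Φ z)
    (hs : AnalyticAt ℂ Φ s) : IsContinuedAt Φ s :=
  ⟨s.re - 1, Φ, by linarith, isSeriesContinuation_unit_iff.2 ⟨fun z _ => h z, 0, fun _ _ => rfl⟩,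
    hs, rfl⟩

theorem IsContinuedAt.of_differentiable {Φ : ℂ → ℂ} {s : ℂ} (h : Differentiable ℂ Φ) :
    IsContinuedAt Φ s :=
  .of_meromorphic (fun z => (h.analyticAt z).meromorphicAt) (h.analyticAt s)

theorem IsContinuedAt.add {Φ Ψ : ℂ → ℂ} {s : ℂ} (hΦ : IsContinuedAt Φ s)
    (hΨ : IsContinuedAt Ψ s) : IsContinuedAt (fun z => Φ z + Ψ z) s := by
  obtain ⟨σ, F, hσ, hF, hFs, hFe⟩ := hΦ
  obtain ⟨τ, G, hτ, hG, hGs, hGe⟩ := hΨ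
  rw [isSeriesContinuation_unit_iff] at hF hG
  obtain ⟨hFm, σ₁, h₁⟩ := hF
  obtain ⟨hGm, τ₁, h₂⟩ := hG
  refine ⟨max σ τ, F + G, max_lt hσ hτ, isSeriesContinuation_unit_iff.2 ⟨?_, max σ₁ τ₁, ?_⟩,
    hFs.add hGs, by simp [hFe, hGe]⟩
  · exact (hFm.mono_set fun z (hz : max σ τ < z.re) => (le_max_left σ τ).trans_lt hz).add
      (hGm.mono_set fun z (hz : max σ τ < z.re) => (le_max_right σ τ).trans_lt hz)
  · intro z hz
    rw [Pi.add_apply, h₁ z ((le_max_left _ _).trans_lt hz), h₂ z ((le_max_right _ _).trans_lt hz)]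

theorem IsContinuedAt.mul {Φ Ψ : ℂ → ℂ} {s : ℂ} (hΦ : IsContinuedAt Φ s)
    (hΨ : IsContinuedAt Ψ s) : IsContinuedAt (fun z => Φ z * Ψ z) s := by
  obtain ⟨σ, F, hσ, hF, hFs, hFe⟩ := hΦ
  obtain ⟨τ, G, hτ, hG, hGs, hGe⟩ := hΨ
  rw [isSeriesContinuation_unit_iff] at hF hG
  obtain ⟨hFm, σ₁, h₁⟩ := hF
  obtain ⟨hGm, τ₁, h₂⟩ := hG
  refine ⟨max σ τ, F * G, max_lt hσ hτ, isSeriesContinuation_unit_iff.2 ⟨?_, max σ₁ τ₁, ?_⟩,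
    hFs.mul hGs, by simp [hFe, hGe]⟩
  · exact (hFm.mono_set fun z (hz : max σ τ < z.re) => (le_max_left σ τ).trans_lt hz).mul
      (hGm.mono_set fun z (hz : max σ τ < z.re) => (le_max_right σ τ).trans_lt hz)
  · intro z hz
    rw [Pi.mul_apply, h₁ z ((le_max_left _ _).trans_lt hz), h₂ z ((le_max_right _ _).trans_lt hz)]

theorem IsContinuedAt.const_mul {Φ : ℂ → ℂ} {s : ℂ} (k : ℂ) (hΦ : IsContinuedAt Φ s) :
    IsContinuedAt (fun z => k * Φ z) s :=
  (IsContinuedAt.of_differentiable (Φ := fun _ => k) (differentiable_const k)).mul hΦ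

theorem IsContinuedAt.sub {Φ Ψ : ℂ → ℂ} {s : ℂ} (hΦ : IsContinuedAt Φ s)
    (hΨ : IsContinuedAt Ψ s) : IsContinuedAt (fun z => Φ z - Ψ z) s := by
  simpa [sub_eq_add_neg] using hΦ.add (hΨ.const_mul (-1))

theorem IsContinuedAt.sum {ι : Type*} {u : Finset ι} {Φ : ι → ℂ → ℂ} {s : ℂ}
    (h : ∀ i ∈ u, IsContinuedAt (Φ i) s) : IsContinuedAt (fun z => ∑ i ∈ u, Φ i z) s := by
  classical
  induction u using Finset.induction_on with
  | empty => simpa using IsContinuedAt.of_differentiable (differentiable_const (0 : ℂ))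
  | insert i u hi ih =>
    simp only [Finset.sum_insert hi]
    exact (h i (Finset.mem_insert_self i u)).add
      (ih fun j hj => h j (Finset.mem_insert_of_mem hj))

theorem IsContinuedAt.comp_add_const {Φ : ℂ → ℂ} {s : ℂ} (d : ℂ) (h : IsContinuedAt Φ (s + d)) :
    IsContinuedAt (fun z => Φ (z + d)) s := by
  obtain ⟨σ, F, hσ, hF, hFs, hFe⟩ := h
  rw [isSeriesContinuation_unit_iff] at hF
  obtain ⟨hFm, σ₁, h₁⟩ := hF
  rw [Complex.add_re] at hσ
  have ha : ∀ z, AnalyticAt ℂ (fun w : ℂ => w + d) z := fun z => analyticAt_id.add analyticAt_const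
  refine ⟨σ - d.re, fun z => F (z + d), by linarith,
    isSeriesContinuation_unit_iff.2 ⟨fun z hz => ?_, σ₁ - d.re, fun z hz => ?_⟩,
    AnalyticAt.fun_comp hFs (ha s), hFe⟩
  · refine MeromorphicAt.comp_analyticAt (f := F) (g := fun w => w + d) (hFm _ ?_) (ha z)
    simp only [Set.mem_ofPred_eq, Complex.add_re] at hz ⊢
    linarith
  · exact h₁ _ (by simp only [Complex.add_re]; linarith)

/-! ### Families that converge absolutely for `re z > 1` -/

/-- A family of entire terms whose moduli decrease with `re z`, summable for `re z > 1`; this is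
what is used of a Dirichlet series. -/
structure IsDirichletFamily {ι : Type*} (t : ι → ℂ → ℂ) : Prop where
  differentiable : ∀ i, Differentiable ℂ (t i)
  antitone : ∀ i z w, z.re ≤ w.re → ‖t i w‖ ≤ ‖t i z‖
  summable : ∀ z : ℂ, 1 < z.re → Summable fun i => t i z

namespace IsDirichletFamily

variable {ι : Type*} {t : ι → ℂ → ℂ}

theorem analyticAt_tsum (h : IsDirichletFamily t) {s : ℂ} (hs : 1 < s.re) :
    AnalyticAt ℂ (fun z => ∑' i, t i z) s := by
  obtain ⟨σ, h1, h2⟩ := exists_between hs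
  have hopen : IsOpen {z : ℂ | σ < z.re} := isOpen_lt continuous_const Complex.continuous_re
  have hd : DifferentiableOn ℂ (fun z => ∑' i, t i z) {z : ℂ | σ < z.re} := by
    refine Complex.differentiableOn_tsum_of_summable_norm (u := fun i => ‖t i (σ : ℂ)‖)
      (h.summable σ (by simpa using h1)).norm (fun i => (h.differentiable i).differentiableOn)
      hopen fun i w hw => h.antitone i _ _ ?_
    simpa using le_of_lt hw
  exact hd.analyticAt (hopen.mem_nhds h2)

theorem isSeriesContinuation (h : IsDirichletFamily t) :
    IsSeriesContinuation t 1 fun z => ∑' i, t i z :=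
  ⟨fun _ hz => (h.analyticAt_tsum hz).meromorphicAt, 1, fun z hz => ⟨h.summable z hz, rfl⟩⟩

theorem isRegularPoint (h : IsDirichletFamily t) {s : ℂ} (hs : 1 < s.re) : IsRegularPoint t s :=
  ⟨1, _, hs, h.isSeriesContinuation, h.analyticAt_tsum hs⟩

theorem continued_eq_tsum (h : IsDirichletFamily t) {s : ℂ} (hs : 1 < s.re) :
    continued t s = ∑' i, t i s :=
  continued_eq hs h.isSeriesContinuation (h.analyticAt_tsum hs)

theorem hasSum_continued (h : IsDirichletFamily t) {s : ℂ} (hs : 1 < s.re) :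
    HasSum (fun i => t i s) (continued t s) := by
  rw [h.continued_eq_tsum hs]
  exact (h.summable s hs).hasSum

theorem isContinuedAt (h : IsDirichletFamily t) {s : ℂ} (hs : IsRegularPoint t s) :
    IsContinuedAt (continued t) s := by
  obtain ⟨σ, F, hσ, hF, hFs⟩ := hs
  refine ⟨σ, F, hσ, isSeriesContinuation_unit_iff.2 ⟨hF.1, ?_⟩, hFs,
    (continued_eq hσ hF hFs).symm⟩
  obtain ⟨σ₁, h₁⟩ := hF.2
  refine ⟨max σ₁ 1, fun z hz => ?_⟩
  rw [(h₁ z ((le_max_left _ _).trans_lt hz)).2,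
    h.continued_eq_tsum ((le_max_right _ _).trans_lt hz)]

end IsDirichletFamily

/-! ### Partial fractions and symmetric summation over `ℤ` -/

open SummationFilter in
theorem hasSum_symmetricIcc_comp_add_one {f : ℤ → ℂ} {a : ℂ}
    (hf : Filter.Tendsto f Filter.cofinite (nhds 0)) (h : HasSum f a (symmetricIcc ℤ)) :
    HasSum (fun n => f (n + 1)) a (symmetricIcc ℤ) ∧
      HasSum (fun n => f (n - 1)) a (symmetricIcc ℤ) := by
  rw [hasSum_symmetricIcc_iff] at h
  simp only [hasSum_symmetricIcc_iff]
  have t1 : Filter.Tendsto (fun N : ℕ => f ((N : ℤ) + 1)) Filter.atTop (nhds 0) := by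
    refine hf.comp ?_
    rw [← Nat.cofinite_eq_atTop]
    exact Function.Injective.tendsto_cofinite fun a b hab => by simpa using hab
  have t2 : Filter.Tendsto (fun N : ℕ => f (-(N : ℤ))) Filter.atTop (nhds 0) := by
    refine hf.comp ?_
    rw [← Nat.cofinite_eq_atTop]
    exact Function.Injective.tendsto_cofinite fun a b hab => by simpa using hab
  have t3 : Filter.Tendsto (fun N : ℕ => f (-(N : ℤ) - 1)) Filter.atTop (nhds 0) := by
    refine hf.comp ?_
    rw [← Nat.cofinite_eq_atTop]
    exact Function.Injective.tendsto_cofinite fun a b hab => by simpa using hab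
  have t4 : Filter.Tendsto (fun N : ℕ => f (N : ℤ)) Filter.atTop (nhds 0) := by
    refine hf.comp ?_
    rw [← Nat.cofinite_eq_atTop]
    exact Function.Injective.tendsto_cofinite fun a b hab => by simpa using hab
  have e1 : ∀ N : ℕ, ∑ n ∈ Finset.Icc (-(N : ℤ)) N, f (n + 1)
      = ∑ n ∈ Finset.Icc (-(N : ℤ)) N, f n + f ((N : ℤ) + 1) - f (-(N : ℤ)) := by
    intro N
    have h1 : ∑ n ∈ Finset.Icc (-(N : ℤ)) N, f (n + 1)
        = ∑ n ∈ Finset.Icc (-(N : ℤ) + 1) (N + 1), f n := by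
      rw [← Finset.image_add_right_Icc, Finset.sum_image (by simp)]
    have h2 : Finset.Icc (-(N : ℤ)) (N + 1) =
        insert (-(N : ℤ)) (Finset.Icc (-(N : ℤ) + 1) (N + 1)) := by
      ext; simp only [Finset.mem_Icc, Finset.mem_insert]; omega
    have h3 : Finset.Icc (-(N : ℤ)) (N + 1) = insert ((N : ℤ) + 1) (Finset.Icc (-(N : ℤ)) N) := by
      ext; simp only [Finset.mem_Icc, Finset.mem_insert]; omega
    have h4 : ∑ n ∈ Finset.Icc (-(N : ℤ)) (N + 1), f n
        = f (-(N : ℤ)) + ∑ n ∈ Finset.Icc (-(N : ℤ) + 1) (N + 1), f n := by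
      rw [h2, Finset.sum_insert (by simp)]
    rw [h3, Finset.sum_insert (by simp)] at h4
    rw [h1]; linear_combination -h4
  have e2 : ∀ N : ℕ, ∑ n ∈ Finset.Icc (-(N : ℤ)) N, f (n - 1)
      = ∑ n ∈ Finset.Icc (-(N : ℤ)) N, f n + f (-(N : ℤ) - 1) - f N := by
    intro N
    have h1 : ∑ n ∈ Finset.Icc (-(N : ℤ)) N, f (n - 1)
        = ∑ n ∈ Finset.Icc (-(N : ℤ) - 1) (N - 1), f n := by
      simp only [sub_eq_add_neg]
      rw [← Finset.image_add_right_Icc, Finset.sum_image (by simp)]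
    have h2 : Finset.Icc (-(N : ℤ) - 1) N = insert (N : ℤ) (Finset.Icc (-(N : ℤ) - 1) (N - 1)) := by
      ext; simp only [Finset.mem_Icc, Finset.mem_insert]; omega
    have h3 : Finset.Icc (-(N : ℤ) - 1) N = insert (-(N : ℤ) - 1) (Finset.Icc (-(N : ℤ)) N) := by
      ext; simp only [Finset.mem_Icc, Finset.mem_insert]; omega
    have h4 : ∑ n ∈ Finset.Icc (-(N : ℤ) - 1) N, f n
        = f N + ∑ n ∈ Finset.Icc (-(N : ℤ) - 1) (N - 1), f n := by
      rw [h2, Finset.sum_insert (by simp)]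
    rw [h3, Finset.sum_insert (by simp)] at h4
    rw [h1]; linear_combination -h4
  constructor
  · simpa [e1] using (h.add t1).sub t2
  · simpa [e2] using (h.add t3).sub t4

open SummationFilter in
/-- Symmetric sums of a sequence tending to `0` are invariant under translation. -/
theorem hasSum_symmetricIcc_comp_add {f : ℤ → ℂ} {a : ℂ}
    (hf : Filter.Tendsto f Filter.cofinite (nhds 0)) (h : HasSum f a (symmetricIcc ℤ)) (k : ℤ) :
    HasSum (fun n => f (n + k)) a (symmetricIcc ℤ) := by
  have hk : ∀ k : ℤ, Filter.Tendsto (fun n => f (n + k)) Filter.cofinite (nhds 0) := fun k =>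
    hf.comp (Function.Injective.tendsto_cofinite (add_left_injective k))
  induction k using Int.induction_on with
  | zero => simpa using h
  | succ k ih =>
    refine (hasSum_symmetricIcc_comp_add_one (hk k) ih).1.congr_fun fun n => ?_
    rw [add_right_comm, add_assoc n]
  | pred k ih =>
    refine (hasSum_symmetricIcc_comp_add_one (hk _) ih).2.congr_fun fun n => ?_
    congr 1; ring

theorem prod_inv_pow_sub_one {K ι : Type*} [Field K] [DecidableEq ι] {S : Finset ι} {u : ι → K}
    {e : ι → ℕ} {i : ι} (hi : i ∈ S) (he : e i ≠ 0) (hu : u i ≠ 0) :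
    ∏ j ∈ S, (u j ^ Function.update e i (e i - 1) j)⁻¹ = (∏ j ∈ S, (u j ^ e j)⁻¹) * u i := by
  rw [← Finset.mul_prod_erase S _ hi, ← Finset.mul_prod_erase S (fun j => (u j ^ e j)⁻¹) hi]
  have h1 : ∏ j ∈ S.erase i, (u j ^ Function.update e i (e i - 1) j)⁻¹
      = ∏ j ∈ S.erase i, (u j ^ e j)⁻¹ :=
    Finset.prod_congr rfl fun j hj => by rw [Function.update_of_ne (Finset.ne_of_mem_erase hj)]
  rw [h1, Function.update_self]
  obtain ⟨m, hm⟩ := Nat.exists_eq_succ_of_ne_zero he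
  rw [hm, Nat.succ_sub_one, pow_succ]
  field_simp

/-- One step of the partial fraction decomposition. -/
theorem prod_inv_pow_eq_sub {K ι : Type*} [Field K] [DecidableEq ι] {S : Finset ι} {u : ι → K}
    {e : ι → ℕ} {i j : ι} (hi : i ∈ S) (hj : j ∈ S) (hei : e i ≠ 0) (hej : e j ≠ 0)
    (hui : u i ≠ 0) (huj : u j ≠ 0) (hij : u j ≠ u i) :
    ∏ k ∈ S, (u k ^ e k)⁻¹ = (u j - u i)⁻¹ *
      (∏ k ∈ S, (u k ^ Function.update e j (e j - 1) k)⁻¹ -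
        ∏ k ∈ S, (u k ^ Function.update e i (e i - 1) k)⁻¹) := by
  rw [prod_inv_pow_sub_one hi hei hui, prod_inv_pow_sub_one hj hej huj]
  have := sub_ne_zero.2 hij
  field_simp

/-- The Laurent series `t + k` in the variable `t`. -/
noncomputable def laurentLinear (k : ℂ) : LaurentSeries ℂ :=
  HahnSeries.single 1 1 + HahnSeries.C k

theorem laurentLinear_eq_coe (k : ℂ) :
    laurentLinear k = ((PowerSeries.X + PowerSeries.C k : PowerSeries ℂ) : LaurentSeries ℂ) := by
  rw [laurentLinear, PowerSeries.coe_add, PowerSeries.coe_X, PowerSeries.coe_C]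

theorem laurentLinear_ne_zero (k : ℂ) : laurentLinear k ≠ 0 := by
  intro h
  have := congrArg (fun f => HahnSeries.coeff f 1) h
  simp [laurentLinear] at this

theorem laurentLinear_sub (k k' : ℂ) :
    laurentLinear k - laurentLinear k' = HahnSeries.C (k - k') := by
  simp [laurentLinear]

theorem laurentLinear_zero_pow_inv (k : ℕ) :
    (laurentLinear 0 ^ k)⁻¹ = HahnSeries.single (-k : ℤ) (1 : ℂ) := by
  rw [laurentLinear]
  simp [HahnSeries.inv_single]

/-- The power series of `(t + k)^{-a}`. -/
noncomputable def invLinearPow (k : ℂ) (a : ℕ) : PowerSeries ℂ :=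
  PowerSeries.mk fun n => ((a + n - 1).choose n : ℂ) * (-k⁻¹) ^ n * (k ^ a)⁻¹

theorem invLinearPow_mul_pow {k : ℂ} (hk : k ≠ 0) (a : ℕ) :
    invLinearPow k a * (PowerSeries.X + PowerSeries.C k) ^ a = 1 := by
  rcases a with _ | d
  · rw [pow_zero, mul_one]
    ext n
    rcases n with _ | n <;> simp [invLinearPow]
  · have h1 := congrArg (PowerSeries.rescale (-k⁻¹))
      (PowerSeries.mk_add_choose_mul_one_sub_pow_eq_one ℂ d)
    have h2 : PowerSeries.rescale (-k⁻¹) (1 - PowerSeries.X : PowerSeries ℂ)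
        = PowerSeries.C k⁻¹ * (PowerSeries.X + PowerSeries.C k) := by
      rw [map_sub, map_one, PowerSeries.rescale_X, mul_add, ← map_mul, inv_mul_cancel₀ hk]
      simp [add_comm]
    rw [map_mul, map_pow, h2, map_one, mul_pow, ← map_pow, ← mul_assoc] at h1
    rw [← h1]
    congr 1
    ext n
    rw [invLinearPow, PowerSeries.coeff_mk, PowerSeries.coeff_mul_C,
      PowerSeries.coeff_rescale, PowerSeries.coeff_mk, show d + 1 + n - 1 = d + n by omega,
      Nat.choose_symm_add, inv_pow]
    ring

theorem laurentLinear_pow_inv {k : ℂ} (hk : k ≠ 0) (a : ℕ) :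
    (laurentLinear k ^ a)⁻¹ = (invLinearPow k a : LaurentSeries ℂ) := by
  refine (eq_inv_of_mul_eq_one_left ?_).symm
  rw [laurentLinear_eq_coe, ← map_pow, ← PowerSeries.coe_mul, invLinearPow_mul_pow hk,
    PowerSeries.coe_one]

theorem coeff_laurentLinear_pow_inv {k : ℂ} (hk : k ≠ 0) (a j : ℕ) :
    HahnSeries.coeff (laurentLinear k ^ a)⁻¹ (-j : ℤ) = if j = 0 then (k ^ a)⁻¹ else 0 := by
  rw [laurentLinear_pow_inv hk, PowerSeries.coeff_coe]
  rcases j with _ | j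
  · simp [invLinearPow]
  · rw [if_pos (by push_cast; omega), if_neg (by omega)]

open SummationFilter in
theorem hasSum_symmetricIcc_piecewise_zero {f : ℤ → ℂ} {a : ℂ} (S : Finset ℤ)
    (h : HasSum f a (symmetricIcc ℤ)) :
    HasSum (fun n => if n ∈ S then 0 else f n) (a - ∑ n ∈ S, f n) (symmetricIcc ℤ) := by
  have h1 : HasSum (fun n => if n ∈ S then f n else 0) (∑ n ∈ S, if n ∈ S then f n else 0) :=
    hasSum_sum_of_ne_finset_zero fun n hn => if_neg hn
  have h2 : HasSum (fun n => if n ∈ S then f n else 0) (∑ n ∈ S, f n) (symmetricIcc ℤ) := by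
    rw [Finset.sum_congr rfl fun n hn => if_pos hn] at h1
    exact h1.mono_left (LeAtTop.le_atTop)
  refine (HasSum.sub h h2).congr_fun fun n => ?_
  split_ifs <;> simp

open SummationFilter in
/-- The symmetric sum over `n ∈ ℤ ∖ S` of `x ^ n` times a rational function vanishing at infinity
with poles in `S` only. The value is obtained by applying to the Laurent expansion at each pole `P`
the functional `(t - P) ^ (-j) ↦ x ^ P * g j`. With `g 0 = -1` this functional also accounts for the
removal of the terms `n ∈ S`: the term omitted at `P` is the constant coefficient there. Both sides
being linear in the rational function, it suffices to treat its partial fractions. -/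
theorem hasSum_symmetricIcc_prod_inv_pow {x : ℂ} (hx : ‖x‖ = 1) {g : ℕ → ℂ} (hg0 : g 0 = -1)
    (hg : ∀ j, 1 ≤ j → HasSum (fun n : ℤ => x ^ n * ((n : ℂ) ^ j)⁻¹) (g j) (symmetricIcc ℤ))
    (S : Finset ℤ) (M : ℕ) (e : ℤ → ℕ) (hM : ∀ P ∈ S, e P ≤ M) (he : ∃ P ∈ S, e P ≠ 0) :
    HasSum (fun n : ℤ => if n ∈ S then 0 else x ^ n * ∏ Q ∈ S, (((n : ℂ) - Q) ^ e Q)⁻¹)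
      (∑ P ∈ S, x ^ P * ∑ j ∈ Finset.range (M + 1), g j *
        HahnSeries.coeff (∏ Q ∈ S, (laurentLinear ((P : ℂ) - Q) ^ e Q)⁻¹) (-j : ℤ))
      (symmetricIcc ℤ) := by
  have hx0 : x ≠ 0 := by rintro rfl; simp at hx
  induction hN : ∑ P ∈ S, e P using Nat.strong_induction_on generalizing e with
  | _ N ih =>
  obtain ⟨P, hP, heP⟩ := he
  by_cases hQ : ∃ Q ∈ S, Q ≠ P ∧ e Q ≠ 0
  · -- two poles: one step of the partial fraction decomposition lowers the total order
    obtain ⟨Q, hQ, hQP, heQ⟩ := hQ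
    have hd : (P : ℂ) - Q ≠ 0 := sub_ne_zero.2 (by exact_mod_cast hQP.symm)
    have hstep : ∀ R T : ℤ, R ∈ S → T ∈ S → T ≠ R → e R ≠ 0 → e T ≠ 0 → _ :=
      fun R T hR hT hTR heR heT =>
      ih (∑ n ∈ S, Function.update e R (e R - 1) n) (by
        rw [← hN]
        refine Finset.sum_lt_sum (fun i _ => ?_) ⟨R, hR, ?_⟩
        · by_cases h : i = R
          · subst h; simp
          · rw [Function.update_of_ne h]
        · rw [Function.update_self]; omega) (Function.update e R (e R - 1)) (fun i hi => by
        by_cases h : i = R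
        · subst h; rw [Function.update_self]; exact (Nat.sub_le _ _).trans (hM i hi)
        · rw [Function.update_of_ne h]; exact hM i hi)
        ⟨T, hT, by rwa [Function.update_of_ne hTR]⟩ rfl
    have h1 := hstep Q P hQ hP hQP.symm heQ heP
    have h2 := hstep P Q hP hQ hQP heP heQ
    have h3 := (HasSum.sub h1 h2).mul_left ((P : ℂ) - Q)⁻¹
    rw [← Finset.sum_sub_distrib, Finset.mul_sum] at h3
    rw [Finset.sum_congr rfl fun R hR => ?_]
    · refine h3.congr_fun fun n => ?_
      by_cases hn : n ∈ S
      · simp [hn]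
      · simp only [if_neg hn]
        have hnz : ∀ R ∈ S, (n : ℂ) - R ≠ 0 := fun R hR =>
          sub_ne_zero.2 (by rintro h; exact hn ((Int.cast_injective h) ▸ hR))
        rw [prod_inv_pow_eq_sub (u := fun R : ℤ => (n : ℂ) - R) hP hQ heP heQ (hnz P hP) (hnz Q hQ)
          (by simpa using hQP)]
        rw [show (n : ℂ) - Q - (n - P) = P - Q by ring]
        ring
    · rw [← mul_sub, ← Finset.sum_sub_distrib, mul_left_comm]
      congr 1
      rw [Finset.mul_sum]
      refine Finset.sum_congr rfl fun j _ => ?_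
      have hne : laurentLinear ((R : ℂ) - Q) - laurentLinear ((R : ℂ) - P)
          = HahnSeries.C ((P : ℂ) - Q) := by
        rw [laurentLinear_sub]; congr 1; ring
      rw [prod_inv_pow_eq_sub (u := fun T : ℤ => laurentLinear ((R : ℂ) - T)) hP hQ heP heQ
          (laurentLinear_ne_zero _) (laurentLinear_ne_zero _)
          (by
            rw [Ne, ← sub_eq_zero, hne, map_eq_zero]
            exact hd), hne, ← map_inv₀, HahnSeries.C_mul_eq_smul, HahnSeries.coeff_smul,
          HahnSeries.coeff_sub, smul_eq_mul]
      ring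
  · -- a single pole: at the other points of `S` only the constant coefficient contributes
    push Not at hQ
    have hprod : ∀ {K : Type} [Field K] (u : ℤ → K), ∏ Q ∈ S, (u Q ^ e Q)⁻¹ = (u P ^ e P)⁻¹ := by
      intro K _ u
      exact Finset.prod_eq_single_of_mem P hP fun Q hQS hQP => by simp [hQ Q hQS hQP]
    have h1 : HasSum (fun n : ℤ => x ^ n * (((n : ℂ) - P) ^ e P)⁻¹) (x ^ P * g (e P))
        (symmetricIcc ℤ) := by
      have h0 : Filter.Tendsto (fun n : ℤ => x ^ n * ((n : ℂ) ^ e P)⁻¹) Filter.cofinite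
          (nhds 0) := by
        have h := (Filter.tendsto_inv₀_cobounded (α := ℝ)).comp
          (Metric.cobounded_eq_cocompact (α := ℝ) ▸ Int.tendsto_coe_cofinite)
        rw [tendsto_zero_iff_norm_tendsto_zero] at h ⊢
        refine squeeze_zero (fun _ => norm_nonneg _) (fun n => ?_) h
        rw [norm_mul, norm_zpow, hx, one_zpow, one_mul, norm_inv, norm_pow, Function.comp_apply,
          norm_inv, Complex.norm_intCast, Real.norm_eq_abs]
        rcases eq_or_ne n 0 with rfl | hn
        · simp [heP]
        · have h1 : (1 : ℝ) ≤ |(n : ℝ)| := by exact_mod_cast Int.one_le_abs hn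
          exact inv_anti₀ (by positivity) (le_self_pow₀ h1 heP)
      have := (hasSum_symmetricIcc_comp_add h0 (hg _ (Nat.one_le_iff_ne_zero.2 heP)) (-P)).mul_left
        (x ^ P)
      refine this.congr_fun fun n => ?_
      rw [← mul_assoc, ← zpow_add₀ hx0]
      push_cast
      rw [← sub_eq_add_neg, ← sub_eq_add_neg, add_sub_cancel]
    have h2 := hasSum_symmetricIcc_piecewise_zero S h1
    simp only [hprod]
    convert h2 using 1
    rw [← Finset.add_sum_erase S _ hP, ← Finset.add_sum_erase S _ hP, sub_self (P : ℂ),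
      zero_pow heP, inv_zero, mul_zero, zero_add, sub_eq_add_neg, ← Finset.sum_neg_distrib]
    congr 1
    · rw [laurentLinear_zero_pow_inv, Finset.sum_eq_single_of_mem (e P)]
      · simp
      · exact Finset.mem_range.2 (Nat.lt_succ_of_le (hM P hP))
      · intro j _ hj
        rw [HahnSeries.coeff_single_of_ne (by simpa using hj), mul_zero]
    · refine Finset.sum_congr rfl fun R hR => ?_
      have hRP : (R : ℂ) - P ≠ 0 := sub_ne_zero.2 (by exact_mod_cast Finset.ne_of_mem_erase hR)
      rw [Finset.sum_eq_single_of_mem 0 (by simp)]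
      · rw [coeff_laurentLinear_pow_inv hRP, if_pos rfl, hg0]; ring
      · intro j _ hj
        rw [coeff_laurentLinear_pow_inv hRP, if_neg hj, mul_zero]

/-! ### Explicit partial fraction coefficients -/

theorem coeff_laurentLinear_zero_pow_inv_mul (k j : ℕ) (F : PowerSeries ℂ) :
    HahnSeries.coeff ((laurentLinear 0 ^ k)⁻¹ * (F : LaurentSeries ℂ)) (-j : ℤ) =
      if j ≤ k then PowerSeries.coeff (k - j) F else 0 := by
  have h : (-j : ℤ) = ((k : ℤ) - j) + -k := by ring
  rw [laurentLinear_zero_pow_inv, h, HahnSeries.coeff_single_mul_add, one_mul,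
    PowerSeries.coeff_coe]
  split_ifs with h1 h2 h2
  · omega
  · rfl
  · congr 2; omega
  · omega

/-- The functional of `hasSum_symmetricIcc_prod_inv_pow` at a pole of order `k`. -/
theorem sum_mul_coeff_pole {k M : ℕ} (hk : k ≤ M) (g : ℕ → ℂ) (F : PowerSeries ℂ) :
    ∑ j ∈ Finset.range (M + 1), g j *
        HahnSeries.coeff ((laurentLinear 0 ^ k)⁻¹ * (F : LaurentSeries ℂ)) (-j : ℤ) =
      ∑ j ∈ Finset.range (k + 1), g j * PowerSeries.coeff (k - j) F := by
  have hsub : Finset.range (k + 1) ⊆ Finset.range (M + 1) :=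
    Finset.range_subset_range.2 (by omega)
  rw [← Finset.sum_subset hsub]
  · refine Finset.sum_congr rfl fun j hj => ?_
    rw [coeff_laurentLinear_zero_pow_inv_mul, if_pos (Nat.lt_succ_iff.1 (Finset.mem_range.1 hj))]
  · intro j _ hj
    rw [coeff_laurentLinear_zero_pow_inv_mul,
      if_neg (by rw [Finset.mem_range] at hj; omega), mul_zero]

theorem coeff_invLinearPow (k : ℂ) (a n : ℕ) :
    PowerSeries.coeff n (invLinearPow k a) =
      (-1) ^ n * ((a + n - 1).choose n : ℂ) * (k ^ (a + n))⁻¹ := by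
  rw [invLinearPow, PowerSeries.coeff_mk, neg_pow, pow_add, inv_pow, mul_inv]
  ring

theorem coeff_invLinearPow_mul (k k' : ℂ) (a n : ℕ) {c : ℕ} (hc : 0 < c) :
    PowerSeries.coeff n (invLinearPow k a * invLinearPow k' c) =
      (-1) ^ n * ∑ ω ∈ Finset.range (n + 1), ((ω + a - 1).choose ω : ℂ) *
        ((n + c - ω - 1).choose (c - 1) : ℂ) * (k ^ (a + ω) * k' ^ (n + c - ω))⁻¹ := by
  rw [PowerSeries.coeff_mul, Finset.Nat.sum_antidiagonal_eq_sum_range_succ (fun i j =>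
    PowerSeries.coeff i (invLinearPow k a) * PowerSeries.coeff j (invLinearPow k' c)),
    Finset.mul_sum]
  refine Finset.sum_congr rfl fun ω hω => ?_
  obtain ⟨r, rfl⟩ := Nat.exists_eq_add_of_le (Nat.lt_succ_iff.1 (Finset.mem_range.1 hω))
  obtain ⟨d, rfl⟩ := Nat.exists_eq_add_of_le' hc
  rw [coeff_invLinearPow, coeff_invLinearPow, show ω + r - ω = r by omega,
    show d + 1 + r - 1 = d + r by omega, show ω + r + (d + 1) - ω - 1 = d + r by omega,
    show ω + r + (d + 1) - ω = d + 1 + r by omega, show d + 1 - 1 = d by omega, Nat.choose_symm_add,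
    add_comm ω a, pow_add (-1 : ℂ), mul_inv]
  ring

/-- The principal part at one of the two poles of `U ^ (p + 1) * V ^ (c + 1)`, where `U` and `V`
are inverses of linear forms whose difference has the inverse `D`; here `W` is `-U` or `V`. -/
def polarSum {R : Type*} [CommRing R] (D W : R) (p c : ℕ) : R :=
  ∑ ω ∈ Finset.range (p + 1), ((p + c - ω).choose c : R) * W ^ (ω + 1) * D ^ (p + c + 1 - ω)

section

variable {R : Type*} [CommRing R] (D W : R)

theorem polarSum_zero_left (c : ℕ) : polarSum D W 0 c = W * D ^ (c + 1) := by
  simp [polarSum]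

theorem mul_polarSum (p c : ℕ) : D * polarSum D W p c =
    ∑ ω ∈ Finset.range (p + 1), ((p + c - ω).choose c : R) * W ^ (ω + 1) * D ^ (p + c + 2 - ω) := by
  rw [polarSum, Finset.mul_sum]
  refine Finset.sum_congr rfl fun ω hω => ?_
  rw [Finset.mem_range] at hω
  rw [show p + c + 2 - ω = p + c + 1 - ω + 1 by omega, pow_succ]
  ring

theorem polarSum_succ_zero (p : ℕ) :
    polarSum D W (p + 1) 0 = D * polarSum D W p 0 + W ^ (p + 2) * D := by
  rw [mul_polarSum, polarSum, Finset.sum_range_succ]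
  congr 1
  · refine Finset.sum_congr rfl fun ω _ => ?_
    simp [add_assoc]
  · simp

theorem polarSum_succ_succ (p c : ℕ) :
    polarSum D W (p + 1) (c + 1) = D * (polarSum D W (p + 1) c + polarSum D W p (c + 1)) := by
  rw [mul_add, mul_polarSum, mul_polarSum]
  have h : ∑ ω ∈ Finset.range (p + 1), ((p + (c + 1) - ω).choose (c + 1) : R) * W ^ (ω + 1) *
        D ^ (p + (c + 1) + 2 - ω)
      = ∑ ω ∈ Finset.range (p + 1 + 1), ((p + (c + 1) - ω).choose (c + 1) : R) * W ^ (ω + 1) *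
        D ^ (p + (c + 1) + 2 - ω) := by
    rw [Finset.sum_range_succ _ (p + 1), Nat.choose_eq_zero_of_lt (by omega)]
    simp
  rw [h, ← Finset.sum_add_distrib, polarSum]
  refine Finset.sum_congr rfl fun ω hω => ?_
  rw [Finset.mem_range] at hω
  rw [show p + 1 + (c + 1) - ω = p + (c + 1) - ω + 1 by omega, Nat.choose_succ_succ,
    show p + 1 + c - ω = p + (c + 1) - ω by omega,
    show p + 1 + (c + 1) + 1 - ω = p + (c + 1) + 2 - ω by omega,
    show p + 1 + c + 2 - ω = p + (c + 1) + 2 - ω by omega]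
  push_cast
  ring

variable {D}

/-- Partial fractions of a product of powers of two inverses of linear forms with constant
difference. -/
theorem pow_mul_pow_eq_polarSum {U V : R} (h : U * V = D * (U - V)) (p c : ℕ) :
    U ^ (p + 1) * V ^ (c + 1) =
      (-1) ^ (p + 1) * (polarSum D (-U) p c + polarSum D V c p) := by
  induction p generalizing c with
  | zero =>
    induction c with
    | zero => simp only [polarSum_zero_left]; linear_combination h
    | succ c ih =>
      rw [polarSum_zero_left, polarSum_succ_zero]
      rw [polarSum_zero_left] at ih
      linear_combination V ^ (c + 1) * h + D * ih
  | succ p ihp =>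
    induction c with
    | zero =>
      have := ihp 0
      rw [polarSum_zero_left] at this ⊢
      rw [polarSum_succ_zero, neg_pow U (p + 2)]
      have hs : ((-1 : R) ^ (p + 2)) * (-1) ^ (p + 2) = 1 := by
        rw [← pow_add, ← two_mul, pow_mul]; simp
      linear_combination U ^ (p + 1) * h - D * this - D * U ^ (p + 2) * hs
    | succ c ihc =>
      rw [polarSum_succ_succ, polarSum_succ_succ]
      linear_combination U ^ (p + 1) * V ^ (c + 1) * h + D * ihc - D * ihp (c + 1)

end

/-- The coefficients of `(t - l)⁻ᵖ (t + m)⁻ᶜ`, obtained by first decomposing this product into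
partial fractions. -/
theorem coeff_invLinearPow_mul_of_sub {l m : ℂ} (hl : l ≠ 0) (hm : m ≠ 0) (hlm : l + m ≠ 0)
    {p c : ℕ} (hp : 0 < p) (hc : 0 < c) (n : ℕ) :
    PowerSeries.coeff n (invLinearPow (-l) p * invLinearPow m c) =
      (-1) ^ p * ∑ ω ∈ Finset.range p, ((ω + n).choose ω : ℂ) *
          ((p + c - 2 - ω).choose (c - 1) : ℂ) * (l ^ (n + ω + 1) * (l + m) ^ (p + c - 1 - ω))⁻¹ +
      (-1) ^ (p + n) * ∑ ω ∈ Finset.range c, ((ω + n).choose ω : ℂ) *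
          ((p + c - 2 - ω).choose (p - 1) : ℂ) *
          (m ^ (n + ω + 1) * (l + m) ^ (p + c - 1 - ω))⁻¹ := by
  obtain ⟨p, rfl⟩ := Nat.exists_eq_add_of_le' hp
  obtain ⟨c, rfl⟩ := Nat.exists_eq_add_of_le' hc
  have hpow : ∀ {k : ℂ} (_ : k ≠ 0) (a : ℕ), invLinearPow k a = invLinearPow k 1 ^ a := by
    intro k hk a
    have h1 := invLinearPow_mul_pow hk a
    have h2 : invLinearPow k 1 ^ a * (PowerSeries.X + PowerSeries.C k) ^ a = 1 := by
      rw [← mul_pow, ← pow_one (PowerSeries.X + PowerSeries.C k), invLinearPow_mul_pow hk, one_pow]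
    calc invLinearPow k a
        = invLinearPow k a * (invLinearPow k 1 ^ a * (PowerSeries.X + PowerSeries.C k) ^ a) := by
          rw [h2, mul_one]
      _ = _ := by rw [mul_left_comm, h1, mul_one]
  have hUV : invLinearPow (-l) 1 * invLinearPow m 1 = PowerSeries.C (l + m)⁻¹ *
      (invLinearPow (-l) 1 - invLinearPow m 1) := by
    have h1 := invLinearPow_mul_pow (neg_ne_zero.2 hl) 1
    have h2 := invLinearPow_mul_pow hm 1
    have h3 : PowerSeries.C (l + m)⁻¹ * (PowerSeries.C l + PowerSeries.C m) = 1 := by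
      rw [← map_add, ← map_mul, inv_mul_cancel₀ hlm, map_one]
    rw [pow_one] at h1 h2
    rw [map_neg] at h1
    linear_combination -(invLinearPow (-l) 1 * invLinearPow m 1) * h3 +
      PowerSeries.C (l + m)⁻¹ * invLinearPow (-l) 1 * h2 -
      PowerSeries.C (l + m)⁻¹ * invLinearPow m 1 * h1
  rw [hpow (neg_ne_zero.2 hl), hpow hm, pow_mul_pow_eq_polarSum hUV, mul_add, map_add]
  have hsgn : ∀ k : ℕ, (-1 : PowerSeries ℂ) ^ k = PowerSeries.C ((-1) ^ k) := fun k => by simp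
  have hnat : ∀ k : ℕ, (k : PowerSeries ℂ) = PowerSeries.C (k : ℂ) := fun k => by simp
  congr 1
  · rw [hsgn, PowerSeries.coeff_C_mul, polarSum, map_sum]
    congr 1
    refine Finset.sum_congr rfl fun ω hω => ?_
    rw [neg_pow, ← hpow (neg_ne_zero.2 hl), hsgn, hnat, ← map_pow, mul_comm, ← mul_assoc,
      ← mul_assoc, ← map_mul, ← map_mul, PowerSeries.coeff_C_mul, coeff_invLinearPow,
      show ω + 1 + n - 1 = n + ω by omega, show p + 1 + (c + 1) - 2 - ω = p + c - ω by omega,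
      show p + 1 + (c + 1) - 1 - ω = p + c + 1 - ω by omega, Nat.choose_symm_add,
      add_comm ω n, Nat.add_sub_cancel, neg_pow l, mul_inv, mul_inv, inv_pow]
    have h1 : (-1 : ℂ) ^ (ω + 1) * (-1) ^ n * ((-1) ^ (ω + 1 + n))⁻¹ = 1 := by
      rw [← pow_add, mul_inv_cancel₀ (pow_ne_zero _ (by norm_num))]
    rw [show n + ω + 1 = ω + 1 + n by ring]
    linear_combination ((l + m) ^ (p + c + 1 - ω))⁻¹ * ((p + c - ω).choose c : ℂ) *
      ((n + ω).choose ω : ℂ) * (l ^ (ω + 1 + n))⁻¹ * h1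
  · rw [hsgn, PowerSeries.coeff_C_mul, polarSum, map_sum, pow_add (-1 : ℂ) (p + 1) n, mul_assoc]
    congr 1
    rw [Finset.mul_sum]
    refine Finset.sum_congr rfl fun ω hω => ?_
    rw [← hpow hm, hnat, ← map_pow, mul_comm, ← mul_assoc,
      ← map_mul, PowerSeries.coeff_C_mul, coeff_invLinearPow,
      show ω + 1 + n - 1 = n + ω by omega, show p + 1 + (c + 1) - 2 - ω = p + c - ω by omega,
      show p + 1 + (c + 1) - 1 - ω = p + c + 1 - ω by omega, Nat.choose_symm_add,
      add_comm ω n, Nat.add_sub_cancel, mul_inv, inv_pow]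
    rw [show n + ω + 1 = ω + 1 + n by ring, add_comm c p]
    ring

/-- The contribution of the pole at `n = 0` to `∑ xⁿ / (nᵖ (n + l)ᵃ (n + k)ᶜ)`. -/
theorem sum_coeff_pole_zero (g : ℕ → ℂ) (l k : ℂ) (p a : ℕ) {c : ℕ} (hc : 0 < c) :
    ∑ j ∈ Finset.range (p + 1),
        g j * PowerSeries.coeff (p - j) (invLinearPow l a * invLinearPow k c) =
      (-1) ^ p * ∑ j ∈ Finset.range (p + 1), g j * (-1) ^ j *
          ∑ ω ∈ Finset.range (p - j + 1), ((ω + a - 1).choose ω : ℂ) *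
            ((p + c - j - ω - 1).choose (c - 1) : ℂ) *
              (l ^ (a + ω) * k ^ (p + c - j - ω))⁻¹ := by
  rw [Finset.mul_sum]
  refine Finset.sum_congr rfl fun j hj => ?_
  obtain ⟨r, rfl⟩ := Nat.exists_eq_add_of_le (Nat.lt_succ_iff.1 (Finset.mem_range.1 hj))
  rw [coeff_invLinearPow_mul _ _ _ _ hc, Nat.add_sub_cancel_left, pow_add,
    show j + r + c - j = r + c by omega]
  have hs : (-1 : ℂ) ^ j * (-1) ^ j = 1 := by rw [← mul_pow]; simp
  linear_combination (exp := 1) -(-1) ^ r * g j * (∑ ω ∈ Finset.range (r + 1),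
    ((ω + a - 1).choose ω : ℂ) * ((r + c - ω - 1).choose (c - 1) : ℂ) *
      (l ^ (a + ω) * k ^ (r + c - ω))⁻¹) * hs

/-- The contribution of the pole at `n = -k` to `∑ xⁿ / (nᵖ (n + k - m)ᵃ (n + k)ᶜ)`, up to the
factor `x ^ (-k)`. -/
theorem sum_coeff_pole_last (g : ℕ → ℂ) (m k : ℂ) (c a : ℕ) {p : ℕ} (hp : 0 < p) :
    ∑ j ∈ Finset.range (c + 1),
        g j * PowerSeries.coeff (c - j) (invLinearPow (-k) p * invLinearPow (-m) a) =
      (-1) ^ (p + a) * ∑ j ∈ Finset.range (c + 1), g j *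
          ∑ ω ∈ Finset.range (c - j + 1), ((ω + a - 1).choose ω : ℂ) *
            ((p + c - j - ω - 1).choose (p - 1) : ℂ) *
              (m ^ (a + ω) * k ^ (p + c - j - ω))⁻¹ := by
  rw [Finset.mul_sum]
  refine Finset.sum_congr rfl fun j hj => ?_
  obtain ⟨r, rfl⟩ := Nat.exists_eq_add_of_le (Nat.lt_succ_iff.1 (Finset.mem_range.1 hj))
  rw [mul_comm (invLinearPow _ _), coeff_invLinearPow_mul _ _ _ _ hp, Nat.add_sub_cancel_left,
    mul_left_comm ((-1) ^ (p + a))]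
  congr 1
  rw [Finset.mul_sum, Finset.mul_sum]
  refine Finset.sum_congr rfl fun ω hω => ?_
  obtain ⟨k', rfl⟩ := Nat.exists_eq_add_of_le (Nat.lt_succ_iff.1 (Finset.mem_range.1 hω))
  rw [show p + (j + (ω + k')) - j - ω = p + k' by omega, show ω + k' + p - ω = p + k' by omega,
    neg_pow m, neg_pow k, mul_mul_mul_comm ((-1) ^ (a + ω)),
    mul_inv ((-1) ^ (a + ω) * (-1) ^ (p + k'))]
  have hs : (-1 : ℂ) ^ (ω + k') * ((-1) ^ (a + ω) * (-1) ^ (p + k'))⁻¹ = (-1) ^ (p + a) := by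
    rw [← pow_add, ← inv_pow, inv_neg, inv_one, ← pow_add,
      show ω + k' + (a + ω + (p + k')) = p + a + 2 * (ω + k') by ring, pow_add, pow_mul]
    simp
  rw [← hs]
  ring

open SummationFilter in
/-- The symmetric sum `∑ xⁿ / (nᵖ (n + l)ᵃ (n + l + m)ᶜ)`. Terms with a vanishing denominator are
`0` by the convention `0⁻¹ = 0`. -/
theorem hasSum_symmetricIcc_three_poles {x : ℂ} (hx : ‖x‖ = 1) {g : ℕ → ℂ} (hg0 : g 0 = -1)
    (hg : ∀ j, 1 ≤ j → HasSum (fun n : ℤ => x ^ n * ((n : ℂ) ^ j)⁻¹) (g j) (symmetricIcc ℤ))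
    {p a c : ℕ} (hp : 0 < p) (ha : 0 < a) (hc : 0 < c) {l m : ℤ} (hl : l ≠ 0) (hm : m ≠ 0)
    (hlm : l + m ≠ 0) :
    HasSum (fun n : ℤ => x ^ n * ((n : ℂ) ^ p * ((n : ℂ) + l) ^ a * ((n : ℂ) + l + m) ^ c)⁻¹)
      ((-1) ^ p * ∑ j ∈ Finset.range (p + 1), g j * (-1) ^ j *
          ∑ ω ∈ Finset.range (p - j + 1), ((ω + a - 1).choose ω : ℂ) *
            ((p + c - j - ω - 1).choose (c - 1) : ℂ) *
              ((l : ℂ) ^ (a + ω) * ((l : ℂ) + m) ^ (p + c - j - ω))⁻¹ +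
        (-1) ^ (p + a) * ∑ j ∈ Finset.range (c + 1), g j *
          ∑ ω ∈ Finset.range (c - j + 1), ((ω + a - 1).choose ω : ℂ) *
            ((p + c - j - ω - 1).choose (p - 1) : ℂ) *
              (x ^ (-(l + m)) * ((m : ℂ) ^ (a + ω) * ((l : ℂ) + m) ^ (p + c - j - ω))⁻¹) +
        (-1) ^ p * ∑ j ∈ Finset.range (a + 1), g j *
          ∑ ω ∈ Finset.range p, ((ω + (a - j)).choose ω : ℂ) *
            ((p + c - 2 - ω).choose (c - 1) : ℂ) *
              (x ^ (-l) * ((l : ℂ) ^ (a - j + ω + 1) * ((l : ℂ) + m) ^ (p + c - 1 - ω))⁻¹) +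
        (-1) ^ (p + a) * ∑ j ∈ Finset.range (a + 1), g j * (-1) ^ j *
          ∑ ω ∈ Finset.range c, ((ω + (a - j)).choose ω : ℂ) *
            ((p + c - 2 - ω).choose (p - 1) : ℂ) *
              (x ^ (-l) * ((m : ℂ) ^ (a - j + ω + 1) * ((l : ℂ) + m) ^ (p + c - 1 - ω))⁻¹))
      (symmetricIcc ℤ) := by
  have hl' : (l : ℂ) ≠ 0 := by exact_mod_cast hl
  have hm' : (m : ℂ) ≠ 0 := by exact_mod_cast hm
  have hlm' : (l : ℂ) + m ≠ 0 := by exact_mod_cast hlm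
  set e : ℤ → ℕ := fun Q => if Q = 0 then p else if Q = -l then a else c with he
  have e0 : e 0 = p := if_pos rfl
  have e1 : e (-l) = a := by simp [he, hl]
  have e2 : e (-(l + m)) = c := by
    rw [he]; simp only
    rw [if_neg (by omega), if_neg (by omega)]
  have n1 : (0 : ℤ) ∉ ({-l, -(l + m)} : Finset ℤ) := by
    simp only [Finset.mem_insert, Finset.mem_singleton]; omega
  have n2 : (-l : ℤ) ∉ ({-(l + m)} : Finset ℤ) := by
    simp only [Finset.mem_singleton]; omega
  have key := hasSum_symmetricIcc_prod_inv_pow hx hg0 hg {0, -l, -(l + m)} (p + a + c) e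
    (fun P _ => by rw [he]; simp only; split_ifs <;> omega)
    ⟨0, by simp, by rw [e0]; omega⟩
  simp only [Finset.prod_insert n1, Finset.prod_insert n2, Finset.prod_singleton,
    Finset.sum_insert n1, Finset.sum_insert n2, Finset.sum_singleton, e0, e1, e2] at key
  have k1 : ((0 : ℤ) : ℂ) - (0 : ℤ) = 0 := by simp
  have k2 : ((0 : ℤ) : ℂ) - (-l : ℤ) = l := by push_cast; ring
  have k3 : ((0 : ℤ) : ℂ) - (-(l + m) : ℤ) = l + m := by push_cast; ring
  have k4 : ((-l : ℤ) : ℂ) - (0 : ℤ) = -l := by push_cast; ring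
  have k5 : ((-l : ℤ) : ℂ) - (-l : ℤ) = 0 := by ring
  have k6 : ((-l : ℤ) : ℂ) - (-(l + m) : ℤ) = m := by push_cast; ring
  have k7 : ((-(l + m) : ℤ) : ℂ) - (0 : ℤ) = -(l + m) := by push_cast; ring
  have k8 : ((-(l + m) : ℤ) : ℂ) - (-l : ℤ) = -m := by push_cast; ring
  have k9 : ((-(l + m) : ℤ) : ℂ) - (-(l + m) : ℤ) = 0 := by ring
  rw [k1, k2, k3, k4, k5, k6, k7, k8, k9, laurentLinear_pow_inv hl', laurentLinear_pow_inv hlm',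
    laurentLinear_pow_inv (neg_ne_zero.2 hl'), laurentLinear_pow_inv hm',
    laurentLinear_pow_inv (neg_ne_zero.2 hlm'), laurentLinear_pow_inv (neg_ne_zero.2 hm'),
    mul_left_comm (invLinearPow (-(l : ℂ)) p : LaurentSeries ℂ), ← mul_assoc
      (invLinearPow (-((l : ℂ) + m)) p : LaurentSeries ℂ), mul_comm
      ((invLinearPow (-((l : ℂ) + m)) p : LaurentSeries ℂ) * _),
    ← PowerSeries.coe_mul, ← PowerSeries.coe_mul, ← PowerSeries.coe_mul] at key
  rw [sum_mul_coeff_pole (by omega), sum_mul_coeff_pole (by omega),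
    sum_mul_coeff_pole (by omega)] at key
  have hfun : ∀ n : ℤ, x ^ n * ((n : ℂ) ^ p * ((n : ℂ) + l) ^ a * ((n : ℂ) + l + m) ^ c)⁻¹ =
      if n ∈ ({0, -l, -(l + m)} : Finset ℤ) then 0 else
        x ^ n * ((((n : ℂ) - (0 : ℤ)) ^ p)⁻¹ * ((((n : ℂ) - (-l : ℤ)) ^ a)⁻¹ *
          (((n : ℂ) - (-(l + m) : ℤ)) ^ c)⁻¹)) := by
    intro n
    split_ifs with h
    · simp only [Finset.mem_insert, Finset.mem_singleton] at h
      rcases h with rfl | rfl | rfl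
      · simp [hp.ne']
      · simp [ha.ne']
      · simp [hc.ne', add_assoc]
    · rw [mul_inv, mul_inv]
      push_cast
      simp only [sub_zero, sub_neg_eq_add, add_assoc, mul_assoc]
  have hval := key.congr_fun hfun
  convert hval using 1
  rw [zpow_zero, one_mul, sum_coeff_pole_zero _ _ _ _ _ hc, sum_coeff_pole_last _ _ _ _ _ hp]
  simp only [coeff_invLinearPow_mul_of_sub hl' hm' hlm' hp hc,
    mul_left_comm _ (x ^ (-(l + m))), mul_left_comm _ (x ^ (-l)), ← Finset.mul_sum]
  have h4 : ∑ j ∈ Finset.range (a + 1), g j * ((-1) ^ p * ∑ ω ∈ Finset.range p,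
        ((ω + (a - j)).choose ω : ℂ) * ((p + c - 2 - ω).choose (c - 1) : ℂ) *
          ((l : ℂ) ^ (a - j + ω + 1) * ((l : ℂ) + m) ^ (p + c - 1 - ω))⁻¹ +
      (-1) ^ (p + (a - j)) * ∑ ω ∈ Finset.range c, ((ω + (a - j)).choose ω : ℂ) *
          ((p + c - 2 - ω).choose (p - 1) : ℂ) *
          ((m : ℂ) ^ (a - j + ω + 1) * ((l : ℂ) + m) ^ (p + c - 1 - ω))⁻¹) =
      (-1) ^ p * ∑ j ∈ Finset.range (a + 1), g j * ∑ ω ∈ Finset.range p,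
        ((ω + (a - j)).choose ω : ℂ) * ((p + c - 2 - ω).choose (c - 1) : ℂ) *
          ((l : ℂ) ^ (a - j + ω + 1) * ((l : ℂ) + m) ^ (p + c - 1 - ω))⁻¹ +
      (-1) ^ (p + a) * ∑ j ∈ Finset.range (a + 1), g j * (-1) ^ j *
        ∑ ω ∈ Finset.range c, ((ω + (a - j)).choose ω : ℂ) *
          ((p + c - 2 - ω).choose (p - 1) : ℂ) *
          ((m : ℂ) ^ (a - j + ω + 1) * ((l : ℂ) + m) ^ (p + c - 1 - ω))⁻¹ := by
    rw [Finset.mul_sum, Finset.mul_sum, ← Finset.sum_add_distrib]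
    refine Finset.sum_congr rfl fun j hj => ?_
    have hs : (-1 : ℂ) ^ (p + (a - j)) = (-1) ^ (p + a) * (-1) ^ j := by
      obtain ⟨r, rfl⟩ := Nat.exists_eq_add_of_le (Nat.lt_succ_iff.1 (Finset.mem_range.1 hj))
      rw [Nat.add_sub_cancel_left, ← pow_add, show p + (j + r) + j = p + r + (j + j) by ring,
        pow_add _ (p + r), ← two_mul, pow_mul _ 2]
      simp
    rw [hs]
    ring
  rw [h4]
  ring

open SummationFilter in
/-- The symmetric sum `∑ xⁿ / (nᵖ (n + m)^q)`; the terms `n = 0, -m` are `0` since `0⁻¹ = 0`. -/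
theorem hasSum_symmetricIcc_two_poles {x : ℂ} (hx : ‖x‖ = 1) {g : ℕ → ℂ} (hg0 : g 0 = -1)
    (hg : ∀ j, 1 ≤ j → HasSum (fun n : ℤ => x ^ n * ((n : ℂ) ^ j)⁻¹) (g j) (symmetricIcc ℤ))
    {p q : ℕ} (hp : 0 < p) (hq : 0 < q) {m : ℤ} (hm : m ≠ 0) :
    HasSum (fun n : ℤ => x ^ n * ((n : ℂ) ^ p * ((n : ℂ) + m) ^ q)⁻¹)
      (∑ j ∈ Finset.range (p + 1), g j * ((-1) ^ (p - j) *
          ((q + (p - j) - 1).choose (p - j) : ℂ) * ((m : ℂ) ^ (q + (p - j)))⁻¹) +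
        x ^ (-m) * ∑ j ∈ Finset.range (q + 1), g j * ((-1) ^ p *
          ((p + (q - j) - 1).choose (q - j) : ℂ) * ((m : ℂ) ^ (p + (q - j)))⁻¹))
      (symmetricIcc ℤ) := by
  have hm' : (m : ℂ) ≠ 0 := by exact_mod_cast hm
  set e : ℤ → ℕ := fun Q => if Q = 0 then p else q with he
  have e0 : e 0 = p := if_pos rfl
  have e1 : e (-m) = q := by simp [he, hm]
  have n1 : (0 : ℤ) ∉ ({-m} : Finset ℤ) := by
    simp only [Finset.mem_singleton]; omega
  have key := hasSum_symmetricIcc_prod_inv_pow hx hg0 hg {0, -m} (p + q) e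
    (fun P _ => by rw [he]; simp only; split_ifs <;> omega)
    ⟨0, by simp, by rw [e0]; omega⟩
  simp only [Finset.prod_insert n1, Finset.prod_singleton,
    Finset.sum_insert n1, Finset.sum_singleton, e0, e1] at key
  have k1 : ((0 : ℤ) : ℂ) - (0 : ℤ) = 0 := by simp
  have k2 : ((0 : ℤ) : ℂ) - (-m : ℤ) = m := by push_cast; ring
  have k3 : ((-m : ℤ) : ℂ) - (0 : ℤ) = -m := by push_cast; ring
  have k4 : ((-m : ℤ) : ℂ) - (-m : ℤ) = 0 := by ring
  rw [k1, k2, k3, k4, laurentLinear_pow_inv hm', laurentLinear_pow_inv (neg_ne_zero.2 hm'),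
    mul_comm (invLinearPow (-(m : ℂ)) p : LaurentSeries ℂ), sum_mul_coeff_pole (by omega),
    sum_mul_coeff_pole (by omega), zpow_zero, one_mul] at key
  have hs : ∀ k : ℕ,
      (-1 : ℂ) ^ k * ((-(m : ℂ)) ^ (p + k))⁻¹ = (-1) ^ p * ((m : ℂ) ^ (p + k))⁻¹ := by
    intro k
    rw [neg_pow (m : ℂ), mul_inv, ← mul_assoc, ← inv_pow, inv_neg, inv_one, ← pow_add,
      show k + (p + k) = p + 2 * k by ring, pow_add, pow_mul]
    simp
  simp only [coeff_invLinearPow, mul_right_comm _ _ ((-(m : ℂ)) ^ _)⁻¹, hs] at key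
  simp only [mul_right_comm _ _ ((m : ℂ) ^ _)⁻¹]
  simp only [mul_right_comm _ _ ((m : ℂ) ^ _)⁻¹] at key
  refine key.congr_fun fun n => ?_
  split_ifs with h
  · simp only [Finset.mem_insert, Finset.mem_singleton] at h
    rcases h with rfl | rfl
    · simp [hp.ne']
    · simp [hq.ne']
  · rw [mul_inv]
    push_cast
    simp only [sub_zero, sub_neg_eq_add]

/-! ### The series `∑ yⁿ / nˢ` at fourth roots of unity -/

/-- The closed form of `∑ yⁿ / nˢ` when `y ^ 4 = 1`; the third case is meant for `y = ±i`. -/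
noncomputable def rootSum (y s : ℂ) : ℂ :=
  if y = 1 then riemannZeta s else
  if y = -1 then (2 ^ (1 - s) - 1) * riemannZeta s else
  2 ^ (-s) * ((2 ^ (1 - s) - 1) * riemannZeta s) + y * Lchi4 s

theorem rootSum_one (s : ℂ) : rootSum 1 s = riemannZeta s := if_pos rfl

theorem rootSum_neg_one (s : ℂ) : rootSum (-1) s = (2 ^ (1 - s) - 1) * riemannZeta s := by
  rw [rootSum, if_neg (by norm_num), if_pos rfl]

theorem rootSum_I (s : ℂ) : rootSum Complex.I s =
    2 ^ (-s) * ((2 ^ (1 - s) - 1) * riemannZeta s) + Complex.I * Lchi4 s := by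
  rw [rootSum, if_neg, if_neg] <;> · intro h; simpa using congrArg Complex.im h

theorem rootSum_neg_I (s : ℂ) : rootSum (-Complex.I) s =
    2 ^ (-s) * ((2 ^ (1 - s) - 1) * riemannZeta s) + -Complex.I * Lchi4 s := by
  rw [rootSum, if_neg, if_neg] <;> · intro h; simpa using congrArg Complex.im h

theorem hasSum_even_dilate {u : ℕ → ℂ} {A s : ℂ}
    (h : HasSum (fun n : ℕ => u n * ((n : ℂ) ^ s)⁻¹) A) :
    HasSum (fun n : ℕ => (if Even n then u (n / 2) else 0) * ((n : ℂ) ^ s)⁻¹) (2 ^ (-s) * A) := by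
  have hinj : Function.Injective fun n : ℕ => 2 * n := fun a b h => by simpa using h
  rw [← hinj.hasSum_iff]
  · refine (h.mul_left (2 ^ (-s))).congr_fun fun n => ?_
    have h2 : ((2 * n : ℕ) : ℂ) ^ s = 2 ^ s * (n : ℂ) ^ s := by
      rw [Nat.cast_mul, Complex.natCast_mul_natCast_cpow]; norm_num
    simp only [Function.comp_apply, even_two_mul, if_true, Nat.mul_div_cancel_left n two_pos, h2,
      mul_inv, Complex.cpow_neg]
    ring
  · intro n hn
    rw [if_neg, zero_mul]
    rintro ⟨k, rfl⟩
    exact hn ⟨k, by simp [two_mul]⟩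

theorem hasSum_rootSum_one {s : ℂ} (hs : 1 < s.re) :
    HasSum (fun n : ℕ => (1 : ℂ) ^ n * ((n : ℂ) ^ s)⁻¹) (rootSum 1 s) := by
  rw [rootSum_one, zeta_eq_tsum_one_div_nat_cpow hs]
  simpa using (Complex.summable_one_div_nat_cpow.2 hs).hasSum

theorem hasSum_rootSum_neg_one {s : ℂ} (hs : 1 < s.re) :
    HasSum (fun n : ℕ => (-1 : ℂ) ^ n * ((n : ℂ) ^ s)⁻¹) (rootSum (-1) s) := by
  have h1 := hasSum_rootSum_one hs
  have h2 := ((hasSum_even_dilate h1).mul_left 2).sub h1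
  have hval : rootSum (-1) s = 2 * (2 ^ (-s) * rootSum 1 s) - rootSum 1 s := by
    rw [rootSum_one, rootSum_neg_one, sub_eq_add_neg 1 s, Complex.cpow_add _ _ two_ne_zero,
      Complex.cpow_one]
    ring
  rw [hval]
  refine h2.congr_fun fun n => ?_
  · rcases Nat.even_or_odd n with h | h
    · simp only [h, h.neg_one_pow, one_pow, if_true]; ring
    · simp [h.neg_one_pow, Nat.not_even_iff_odd.2 h]

theorem hasSum_Lchi4 {s : ℂ} (hs : 1 < s.re) :
    HasSum (fun n : ℕ => ((ZMod.χ₄ n : ℤ) : ℂ) * ((n : ℂ) ^ s)⁻¹) (Lchi4 s) := by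
  rw [Lchi4, DirichletCharacter.LFunction_eq_LSeries _ hs]
  have h := (DirichletCharacter.LSeriesSummable_of_one_lt_re
    (ZMod.χ₄.ringHomComp (Int.castRingHom ℂ)) hs).hasSum
  refine h.congr_fun fun n => ?_
  rcases eq_or_ne n 0 with rfl | hn
  · simp
  · simp [LSeries.term_of_ne_zero hn, div_eq_mul_inv]

theorem I_pow_eq (n : ℕ) : Complex.I ^ n =
    (if Even n then (-1 : ℂ) ^ (n / 2) else 0) + Complex.I * ((ZMod.χ₄ n : ℤ) : ℂ) := by
  rcases Nat.even_or_odd' n with ⟨k, rfl | rfl⟩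
  · rw [ZMod.χ₄_nat_eq_if_mod_four, if_pos (show 2 * k % 2 = 0 by omega)]
    simp [pow_mul]
  · have : ¬ Even (2 * k + 1) := by simp
    rw [if_neg this, pow_succ, pow_mul, Complex.I_sq, ZMod.χ₄_eq_neg_one_pow (by omega),
      show (2 * k + 1) / 2 = k by omega]
    push_cast
    ring

theorem hasSum_rootSum_I {s : ℂ} (hs : 1 < s.re) :
    HasSum (fun n : ℕ => Complex.I ^ n * ((n : ℂ) ^ s)⁻¹) (rootSum Complex.I s) := by
  have h1 := (hasSum_even_dilate (hasSum_rootSum_neg_one hs)).add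
    ((hasSum_Lchi4 hs).mul_left Complex.I)
  rw [rootSum_neg_one] at h1
  rw [rootSum_I]
  refine h1.congr_fun fun n => ?_
  rw [I_pow_eq]
  ring

theorem neg_I_pow_eq (n : ℕ) : (-Complex.I) ^ n =
    (if Even n then (-1 : ℂ) ^ (n / 2) else 0) + -Complex.I * ((ZMod.χ₄ n : ℤ) : ℂ) := by
  rw [neg_pow, I_pow_eq]
  rcases Nat.even_or_odd n with h | h
  · have : ZMod.χ₄ n = 0 := by
      rw [ZMod.χ₄_nat_eq_if_mod_four, if_pos (Nat.even_iff.1 h)]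
    simp [h, this]
  · simp [h.neg_one_pow, Nat.not_even_iff_odd.2 h]

theorem hasSum_rootSum_neg_I {s : ℂ} (hs : 1 < s.re) :
    HasSum (fun n : ℕ => (-Complex.I) ^ n * ((n : ℂ) ^ s)⁻¹) (rootSum (-Complex.I) s) := by
  have h1 := (hasSum_even_dilate (hasSum_rootSum_neg_one hs)).add
    ((hasSum_Lchi4 hs).mul_left (-Complex.I))
  rw [rootSum_neg_one] at h1
  rw [rootSum_neg_I]
  refine h1.congr_fun fun n => ?_
  rw [neg_I_pow_eq]
  ring

/-- The fourth roots of unity. -/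
def fourthRoots : Set ℂ := {1, -1, Complex.I, -Complex.I}

theorem hasSum_rootSum {y s : ℂ} (hy : y ∈ fourthRoots) (hs : 1 < s.re) :
    HasSum (fun n : ℕ => y ^ n * ((n : ℂ) ^ s)⁻¹) (rootSum y s) := by
  rcases hy with rfl | rfl | rfl | rfl
  · exact hasSum_rootSum_one hs
  · exact hasSum_rootSum_neg_one hs
  · exact hasSum_rootSum_I hs
  · exact hasSum_rootSum_neg_I hs

/-! ### The value `L(1, χ₄)` as a conditionally convergent series -/

theorem Lchi4_differentiable : Differentiable ℂ Lchi4 := by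
  refine DirichletCharacter.differentiable_LFunction fun h => ?_
  have h3 := DFunLike.congr_fun h (3 : ZMod 4)
  rw [MulChar.one_apply (by decide), MulChar.ringHomComp_apply,
    show ZMod.χ₄ (3 : ZMod 4) = -1 by decide] at h3
  norm_num at h3

/-- Grouping terms of opposite sign makes the series for `L(s, χ₄)` dominated near `s = 1`. -/
theorem Lchi4_ofReal_eq_tsum {s : ℝ} (hs : 1 < s) : Lchi4 s =
    ∑' k : ℕ, ((((4 * k + 1 : ℝ) ^ s)⁻¹ - ((4 * k + 3 : ℝ) ^ s)⁻¹ : ℝ) : ℂ) := by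
  have h := hasSum_Lchi4 (s := s) (by simpa using hs)
  set f : ℕ → ℂ := fun n => ((ZMod.χ₄ n : ℤ) : ℂ) * ((n : ℂ) ^ (s : ℂ))⁻¹ with hf
  have hodd : Summable fun k => f (2 * k + 1) :=
    h.summable.comp_injective fun a b hab => by simpa using hab
  have heven : Summable fun k => f (2 * k) :=
    h.summable.comp_injective fun a b hab => by simpa using hab
  have h0 : ∀ k, f (2 * k) = 0 := fun k => by
    rw [hf]; simp only
    rw [ZMod.χ₄_nat_eq_if_mod_four, if_pos (by omega)]; simp
  have s1 : Summable fun k => f (2 * (2 * k) + 1) :=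
    hodd.comp_injective (i := fun k => 2 * k) fun a b hab => by simpa using hab
  have s3 : Summable fun k => f (2 * (2 * k + 1) + 1) :=
    hodd.comp_injective (i := fun k => 2 * k + 1) fun a b hab => by simpa using hab
  rw [← h.tsum_eq, ← tsum_even_add_odd heven hodd]
  simp only [h0, tsum_zero, zero_add]
  rw [← tsum_even_add_odd (f := fun k => f (2 * k + 1)) s1 s3, ← s1.tsum_add s3]
  refine tsum_congr fun k => ?_
  rw [hf]; simp only
  rw [ZMod.χ₄_nat_one_mod_four (by omega), ZMod.χ₄_nat_three_mod_four (by omega)]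
  push_cast [Complex.ofReal_cpow (show (0 : ℝ) ≤ 4 * k + 1 by positivity),
    Complex.ofReal_cpow (show (0 : ℝ) ≤ 4 * k + 3 by positivity)]
  rw [show (2 * (2 * (k : ℂ)) + 1) = 4 * k + 1 by ring,
    show (2 * (2 * (k : ℂ) + 1) + 1) = 4 * k + 3 by ring]
  ring

theorem inv_rpow_sub_inv_rpow_le {a b s : ℝ} (ha : 1 ≤ a) (hab : a ≤ b) (h1 : 1 ≤ s)
    (h2 : s ≤ 2) : ‖(a ^ s)⁻¹ - (b ^ s)⁻¹‖ ≤ a⁻¹ * (1 - (a / b) ^ 2) := by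
  have ha0 : 0 < a := by linarith
  have hb0 : 0 < b := by linarith
  have hq : (a / b) ^ (2 : ℝ) ≤ (a / b) ^ s :=
    Real.rpow_le_rpow_of_exponent_ge (by positivity) ((div_le_one hb0).2 hab) h2
  have hq1 : (a / b) ^ s ≤ 1 :=
    Real.rpow_le_one (by positivity) ((div_le_one hb0).2 hab) (by linarith)
  have ha1 : (a ^ s)⁻¹ ≤ a⁻¹ := by
    refine inv_anti₀ ha0 ?_
    simpa using Real.rpow_le_rpow_of_exponent_le ha h1
  have e : (a ^ s)⁻¹ - (b ^ s)⁻¹ = (a ^ s)⁻¹ * (1 - (a / b) ^ s) := by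
    rw [Real.div_rpow ha0.le hb0.le]
    have := Real.rpow_pos_of_pos ha0 s
    have := Real.rpow_pos_of_pos hb0 s
    field_simp
  rw [Real.rpow_two] at hq
  rw [e, Real.norm_of_nonneg (mul_nonneg (by positivity) (by linarith))]
  exact mul_le_mul ha1 (by linarith) (by linarith) (by positivity)

theorem inv_rpow_sub_inv_rpow_le_quadratic (k : ℕ) {s : ℝ} (h1 : 1 ≤ s) (h2 : s ≤ 2) :
    ‖((4 * k + 1 : ℝ) ^ s)⁻¹ - ((4 * k + 3 : ℝ) ^ s)⁻¹‖ ≤ 4 * (1 / ((k + 1 : ℕ) : ℝ) ^ 2) := by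
  have hk : (0 : ℝ) ≤ k := k.cast_nonneg
  refine (inv_rpow_sub_inv_rpow_le (by linarith) (by linarith) h1 h2).trans ?_
  have e : (4 * k + 1 : ℝ)⁻¹ * (1 - ((4 * k + 1 : ℝ) / (4 * k + 3)) ^ 2)
      = 8 * (2 * k + 1) / ((4 * k + 1) * (4 * k + 3) ^ 2) := by
    field_simp
    ring
  rw [e, mul_one_div, div_le_div_iff₀ (by positivity) (by positivity)]
  push_cast
  nlinarith [mul_nonneg hk hk, mul_nonneg hk (mul_nonneg hk hk)]

theorem summable_four_mul_one_div_succ_sq :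
    Summable fun k : ℕ => 4 * (1 / ((k + 1 : ℕ) : ℝ) ^ 2) :=
  ((summable_nat_add_iff 1).2 (Real.summable_one_div_nat_pow.2 one_lt_two)).mul_left 4

theorem Lchi4_one_eq_tsum : Lchi4 1 =
    ∑' k : ℕ, ((((4 * k + 1 : ℝ))⁻¹ - ((4 * k + 3 : ℝ))⁻¹ : ℝ) : ℂ) := by
  have hlim := tendsto_tsum_of_dominated_convergence (𝓕 := nhdsWithin (1 : ℝ) (Set.Ioi 1))
    (f := fun (s : ℝ) (k : ℕ) => ((((4 * k + 1 : ℝ) ^ s)⁻¹ - ((4 * k + 3 : ℝ) ^ s)⁻¹ : ℝ) : ℂ))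
    (g := fun k : ℕ => ((((4 * k + 1 : ℝ))⁻¹ - ((4 * k + 3 : ℝ))⁻¹ : ℝ) : ℂ))
    summable_four_mul_one_div_succ_sq
    (fun k => by
      have hc : ∀ a : ℝ, 0 < a → Filter.Tendsto (fun s : ℝ => (a ^ s)⁻¹)
          (nhdsWithin (1 : ℝ) (Set.Ioi 1)) (nhds a⁻¹) := by
        intro a ha
        have h1 : ContinuousAt (fun s : ℝ => a ^ s) 1 :=
          Real.continuousAt_const_rpow ha.ne'
        have h2 := (h1.tendsto.mono_left (nhdsWithin_le_nhds (s := Set.Ioi 1))).inv₀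
          (by simpa using ha.ne')
        simpa using h2
      exact (Complex.continuous_ofReal.tendsto _).comp
        ((hc _ (by positivity)).sub (hc _ (by positivity))))
    (by
      filter_upwards [Ioo_mem_nhdsGT (show (1 : ℝ) < 2 by norm_num)] with s hs k
      rw [Complex.norm_real]
      exact inv_rpow_sub_inv_rpow_le_quadratic k hs.1.le hs.2.le)
  have hL : Filter.Tendsto (fun s : ℝ => Lchi4 s) (nhdsWithin (1 : ℝ) (Set.Ioi 1))
      (nhds (Lchi4 1)) := by
    have h1 : Continuous fun s : ℝ => Lchi4 s :=
      Lchi4_differentiable.continuous.comp Complex.continuous_ofReal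
    simpa using (h1.tendsto 1).mono_left nhdsWithin_le_nhds
  refine tendsto_nhds_unique hL (hlim.congr' ?_)
  filter_upwards [self_mem_nhdsWithin] with s hs
  exact (Lchi4_ofReal_eq_tsum hs).symm

theorem sum_range_chi4_div (N : ℕ) :
    ∑ n ∈ Finset.range N, ((ZMod.χ₄ n : ℤ) : ℝ) * (n : ℝ)⁻¹ =
      ∑ i ∈ Finset.range (N / 2), (-1 : ℝ) ^ i / (2 * i + 1) := by
  have heven : ∀ K, ∑ n ∈ Finset.range (2 * K), ((ZMod.χ₄ n : ℤ) : ℝ) * (n : ℝ)⁻¹ =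
      ∑ i ∈ Finset.range K, (-1 : ℝ) ^ i / (2 * i + 1) := by
    intro K
    induction K with
    | zero => simp
    | succ K ih =>
      rw [show 2 * (K + 1) = 2 * K + 1 + 1 by ring, Finset.sum_range_succ, Finset.sum_range_succ,
        ih, Finset.sum_range_succ, ZMod.χ₄_nat_eq_if_mod_four (2 * K), if_pos (by omega),
        ZMod.χ₄_eq_neg_one_pow (by omega), show (2 * K + 1) / 2 = K by omega]
      push_cast
      ring
  rcases Nat.even_or_odd' N with ⟨K, rfl | rfl⟩
  · rw [heven]; simp
  · rw [Finset.sum_range_succ, heven, ZMod.χ₄_nat_eq_if_mod_four (2 * K), if_pos (by omega),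
      show (2 * K + 1) / 2 = K by omega]
    simp

/-- The series for `L(1, χ₄)` converges in its natural order, although not absolutely. -/
theorem tendsto_sum_chi4_div : Filter.Tendsto (fun N : ℕ => ∑ n ∈ Finset.range N,
    ((ZMod.χ₄ n : ℤ) : ℂ) * (n : ℂ)⁻¹) Filter.atTop (nhds (Lchi4 1)) := by
  have hsum : Summable fun k : ℕ => ((4 * k + 1 : ℝ))⁻¹ - ((4 * k + 3 : ℝ))⁻¹ :=
    .of_norm_bounded summable_four_mul_one_div_succ_sq fun k => by
      simpa using inv_rpow_sub_inv_rpow_le_quadratic k le_rfl one_le_two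
  have hpair : ∀ K, ∑ k ∈ Finset.range K, ((4 * k + 1 : ℝ)⁻¹ - (4 * k + 3 : ℝ)⁻¹) =
      ∑ i ∈ Finset.range (2 * K), (-1 : ℝ) ^ i / (2 * i + 1) := by
    intro K
    induction K with
    | zero => simp
    | succ K ih =>
      rw [Finset.sum_range_succ, ih, show 2 * (K + 1) = 2 * K + 1 + 1 by ring,
        Finset.sum_range_succ, Finset.sum_range_succ, pow_succ, pow_mul]
      push_cast
      rw [show 2 * (2 * (K : ℝ)) + 1 = 4 * K + 1 by ring,
        show 2 * (2 * (K : ℝ) + 1) + 1 = 4 * K + 3 by ring]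
      ring
  -- by Leibniz's series both limits are `π / 4`
  have hL : Lchi4 1 = ((Real.pi / 4 : ℝ) : ℂ) := by
    rw [Lchi4_one_eq_tsum, ← Complex.ofReal_tsum]
    congr 1
    refine tendsto_nhds_unique hsum.hasSum.tendsto_sum_nat ?_
    simp only [hpair]
    exact Real.tendsto_sum_pi_div_four.comp
      (Filter.tendsto_id.const_mul_atTop' two_pos)
  have h1 := Real.tendsto_sum_pi_div_four.comp
    (Nat.tendsto_div_const_atTop (two_ne_zero))
  rw [hL]
  refine ((Complex.continuous_ofReal.tendsto _).comp h1).congr fun N => ?_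
  simp only [Function.comp_apply, ← sum_range_chi4_div]
  push_cast
  rfl

/-! ### Symmetric sums `∑ xⁿ / nʲ` over `n ≠ 0` -/

open SummationFilter in
theorem hasSum_symmetricIcc_of_tendsto {f : ℤ → ℂ} {A : ℂ} (h0 : f 0 = 0)
    (h : Filter.Tendsto (fun N : ℕ => ∑ n ∈ Finset.range N, (f n + f (-n))) Filter.atTop
      (nhds A)) : HasSum f A (symmetricIcc ℤ) := by
  rw [hasSum_symmetricIcc_iff]
  refine (h.comp (Filter.tendsto_add_atTop_nat 1)).congr fun N => ?_
  simp only [Function.comp_apply]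
  induction N with
  | zero => simp [h0]
  | succ N ih =>
    have e : Finset.Icc (-((N + 1 : ℕ) : ℤ)) ((N + 1 : ℕ) : ℤ) =
        insert ((N + 1 : ℕ) : ℤ) (insert (-((N + 1 : ℕ) : ℤ)) (Finset.Icc (-(N : ℤ)) N)) := by
      ext k
      simp only [Finset.mem_Icc, Finset.mem_insert]
      omega
    rw [Finset.sum_range_succ, ih, e, Finset.sum_insert, Finset.sum_insert]
    · ring
    · simp
    · simp only [Finset.mem_Icc, Finset.mem_insert]
      omega

open SummationFilter in
theorem hasSum_symmetricIcc_of_two_le {x : ℂ} (hx : x ∈ fourthRoots) (hx' : x⁻¹ ∈ fourthRoots)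
    {j : ℕ} (hj : 2 ≤ j) : HasSum (fun n : ℤ => x ^ n * ((n : ℂ) ^ j)⁻¹)
      (rootSum x j + (-1) ^ j * rootSum x⁻¹ j) (symmetricIcc ℤ) := by
  have hj' : 1 < ((j : ℂ)).re := by rw [Complex.natCast_re]; exact_mod_cast hj
  have h1 : HasSum (fun n : ℕ => x ^ (n : ℤ) * (((n : ℤ) : ℂ) ^ j)⁻¹) (rootSum x j) := by
    refine (hasSum_rootSum hx hj').congr_fun fun n => ?_
    simp
  have h2 : HasSum (fun n : ℕ => x ^ (-(n : ℤ)) * (((-(n : ℤ) : ℤ) : ℂ) ^ j)⁻¹)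
      ((-1) ^ j * rootSum x⁻¹ j) := by
    refine ((hasSum_rootSum hx' hj').mul_left ((-1) ^ j)).congr_fun fun n => ?_
    rw [Complex.cpow_natCast, zpow_neg, zpow_natCast, inv_pow]
    push_cast
    rw [neg_pow, mul_inv, ← inv_pow (-1 : ℂ), inv_neg, inv_one]
    ring
  have h3 := HasSum.of_nat_of_neg (f := fun n : ℤ => x ^ n * ((n : ℂ) ^ j)⁻¹) h1 h2
  have h0 : j ≠ 0 := by omega
  rw [Int.cast_zero, zero_pow h0, inv_zero, mul_zero, sub_zero] at h3
  exact h3.mono_left LeAtTop.le_atTop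

/-- `g j` is the symmetric sum of `xⁿ / nʲ` over `n ≠ 0`. The value `g 0 = -1` is the
one which makes partial fractions summable term by term after removal of the poles. -/
structure IsSymmetricWeight (x : ℂ) (g : ℕ → ℂ) : Prop where
  zero : g 0 = -1
  hasSum : ∀ j, 1 ≤ j → HasSum (fun n : ℤ => x ^ n * ((n : ℂ) ^ j)⁻¹) (g j)
    (SummationFilter.symmetricIcc ℤ)

/-- The weights which are `2 f(j)` for even `j` and vanish for odd `j`. -/
noncomputable def evenWeight (f : ℕ → ℂ) (j : ℕ) : ℂ := if Even j then 2 * f j else 0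

theorem isSymmetricWeight_evenWeight {x : ℂ} (hx : x = 1 ∨ x = -1) {f : ℕ → ℂ}
    (h0 : f 0 = -1 / 2) (hf : ∀ j : ℕ, rootSum x j = f j) :
    IsSymmetricWeight x (evenWeight f) := by
  have hmem : x ∈ fourthRoots := by rcases hx with rfl | rfl <;> simp [fourthRoots]
  have hinv : x⁻¹ = x := by rcases hx with rfl | rfl <;> norm_num
  refine ⟨by simp [evenWeight, h0]; norm_num, fun j hj => ?_⟩
  rcases hj.eq_or_lt with rfl | hj
  · refine hasSum_symmetricIcc_of_tendsto (by simp) ?_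
    -- the terms at `n` and `-n` cancel
    simp only [evenWeight, Nat.not_even_one, if_false]
    refine tendsto_const_nhds.congr fun N => (Finset.sum_eq_zero fun n _ => ?_).symm
    rw [zpow_neg, ← inv_zpow, hinv]
    push_cast
    rw [pow_one, pow_one, inv_neg]
    ring
  · have h := hasSum_symmetricIcc_of_two_le hmem (hinv.symm ▸ hmem) hj
    convert h using 1
    rw [hinv, hf]
    rcases Nat.even_or_odd j with h | h
    · simp [evenWeight, h, two_mul]
    · simp [evenWeight, h.neg_one_pow, Nat.not_even_iff_odd.2 h]

theorem rootSum_neg_one_natCast (j : ℕ) : rootSum (-1) j = phi j := by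
  rw [rootSum_neg_one, phi, ← Complex.cpow_intCast]
  push_cast
  rfl

theorem isSymmetricWeight_one : IsSymmetricWeight 1 (evenWeight fun n => riemannZeta n) :=
  isSymmetricWeight_evenWeight (.inl rfl) (by simp [riemannZeta_zero])
    fun j => rootSum_one j

theorem isSymmetricWeight_neg_one : IsSymmetricWeight (-1) (evenWeight phi) :=
  isSymmetricWeight_evenWeight (.inr rfl) (by simp [phi, riemannZeta_zero]; norm_num)
    rootSum_neg_one_natCast

theorem bigLambda_eq (ε : ℂ) (n : ℕ) : bigLambda ε n =
    (1 + (-1) ^ n) * (2 ^ (-(n : ℂ)) * ((2 ^ (1 - (n : ℂ)) - 1) * riemannZeta n)) +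
      ε * Complex.I * (1 - (-1) ^ n) * Lchi4 n := by
  have h1 : Complex.exp (-Real.pi * Complex.I * n) = (-1) ^ n := by
    rw [mul_comm, Complex.exp_nat_mul, neg_mul, Complex.exp_neg, Complex.exp_pi_mul_I]
    norm_num
  have h2 : (2 : ℂ) ^ (-(n : ℂ)) = 2 ^ (-n : ℤ) := by
    rw [← Complex.cpow_intCast]; push_cast; rfl
  have h3 : (2 : ℂ) ^ (1 - (n : ℂ)) = 2 ^ (1 - n : ℤ) := by
    rw [← Complex.cpow_intCast]; push_cast; rfl
  rw [bigLambda, h1, h2, h3]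
  ring

theorem isSymmetricWeight_bigLambda {ε x : ℂ} (hε : ε = 1 ∨ ε = -1) (hx : x = ε * Complex.I) :
    IsSymmetricWeight x (bigLambda ε) := by
  have hmem : x ∈ fourthRoots := by rcases hε with rfl | rfl <;> simp [fourthRoots, hx]
  have hmem' : -x ∈ fourthRoots := by rcases hε with rfl | rfl <;> simp [fourthRoots, hx]
  have hinv : x⁻¹ = -x := by
    rcases hε with rfl | rfl <;> simp [hx, Complex.inv_I, inv_neg]
  have hroot : ∀ s, rootSum x s =
      2 ^ (-s) * ((2 ^ (1 - s) - 1) * riemannZeta s) + x * Lchi4 s := by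
    intro s
    rcases hε with rfl | rfl
    · rw [hx, one_mul, rootSum_I]
    · rw [hx, neg_one_mul, rootSum_neg_I]
  have hroot' : ∀ s, rootSum (-x) s =
      2 ^ (-s) * ((2 ^ (1 - s) - 1) * riemannZeta s) - x * Lchi4 s := by
    intro s
    rcases hε with rfl | rfl
    · rw [hx, one_mul, rootSum_neg_I]; ring
    · rw [hx, neg_one_mul, neg_neg, rootSum_I]; ring
  have hpow : ∀ n : ℕ, x ^ n = (if Even n then (-1 : ℂ) ^ (n / 2) else 0) +
      x * ((ZMod.χ₄ n : ℤ) : ℂ) := by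
    intro n
    rcases hε with rfl | rfl
    · rw [hx, one_mul, I_pow_eq]
    · rw [hx, neg_one_mul, neg_I_pow_eq]
  have hpow' : ∀ n : ℕ, (-x) ^ n = (if Even n then (-1 : ℂ) ^ (n / 2) else 0) -
      x * ((ZMod.χ₄ n : ℤ) : ℂ) := by
    intro n
    rcases hε with rfl | rfl
    · rw [hx, one_mul, neg_I_pow_eq]; ring
    · rw [hx, neg_one_mul, neg_neg, I_pow_eq]; ring
  refine ⟨by rw [bigLambda_eq]; simp [riemannZeta_zero]; norm_num, fun j hj => ?_⟩
  rcases hj.eq_or_lt with rfl | hj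
  · refine hasSum_symmetricIcc_of_tendsto (by simp) ?_
    -- the terms at `n` and `-n` add up to `2 x χ₄(n) / n`
    have hval : bigLambda ε 1 = 2 * x * Lchi4 1 := by
      rw [bigLambda_eq, hx]; push_cast; ring
    rw [hval]
    refine (tendsto_sum_chi4_div.const_mul (2 * x)).congr fun N => ?_
    rw [Finset.mul_sum]
    refine Finset.sum_congr rfl fun n _ => ?_
    rw [zpow_neg, ← inv_zpow, hinv, zpow_natCast, zpow_natCast, hpow, hpow']
    push_cast
    rw [pow_one, pow_one, inv_neg]
    ring
  · have h := hasSum_symmetricIcc_of_two_le hmem (hinv.symm ▸ hmem') hj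
    convert h using 1
    rw [hinv, hroot, hroot', bigLambda_eq, hx]
    ring

theorem isSymmetricWeight_I : IsSymmetricWeight Complex.I (bigLambda 1) :=
  isSymmetricWeight_bigLambda (.inl rfl) (one_mul _).symm

theorem isSymmetricWeight_neg_I : IsSymmetricWeight (-Complex.I) (bigLambda (-1)) :=
  isSymmetricWeight_bigLambda (.inr rfl) (neg_one_mul _).symm

/-! ### The full lattice sum and its convergence -/

/-- The reciprocal of the product of the six positive coroots at `(n, l, m)`, with the exponents
`p, q, s, a, b, c`; the argument is written `((l, m), n)`, as the summation over `n` comes first.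
It vanishes when one of the six values does. -/
noncomputable def latticeTerm (p q a b c : ℕ) (s : ℂ) (w : (ℤ × ℕ) × ℤ) : ℂ :=
  ((w.2 : ℂ) ^ p * (w.1.1 : ℂ) ^ q * (w.1.2 : ℂ) ^ s * ((w.2 : ℂ) + w.1.1) ^ a *
    ((w.1.1 : ℂ) + w.1.2) ^ b * ((w.2 : ℂ) + w.1.1 + w.1.2) ^ c)⁻¹

theorem norm_intCast_pow_inv_le (n : ℤ) {p : ℕ} (hp : 0 < p) :
    ‖((n : ℂ) ^ p)⁻¹‖ ≤ |(n : ℝ)|⁻¹ := by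
  rw [norm_inv, norm_pow, Complex.norm_intCast]
  rcases eq_or_ne n 0 with rfl | hn
  · simp [hp.ne']
  · have h1 : (1 : ℝ) ≤ |(n : ℝ)| := by exact_mod_cast Int.one_le_abs hn
    exact inv_anti₀ (by positivity) (le_self_pow₀ h1 hp.ne')

theorem norm_intCast_pow_inv_le_one (n : ℤ) {p : ℕ} (hp : 0 < p) : ‖((n : ℂ) ^ p)⁻¹‖ ≤ 1 := by
  refine (norm_intCast_pow_inv_le n hp).trans ?_
  rcases eq_or_ne n 0 with rfl | hn
  · simp
  · exact inv_le_one_of_one_le₀ (by exact_mod_cast Int.one_le_abs hn)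

theorem inv_abs_mul_inv_abs_le (x y : ℝ) : |x|⁻¹ * |y|⁻¹ ≤ (x ^ 2)⁻¹ + (y ^ 2)⁻¹ := by
  rw [← sq_abs x, ← sq_abs y, ← inv_pow, ← inv_pow]
  nlinarith [sq_nonneg (|x|⁻¹ - |y|⁻¹), sq_nonneg (|x|⁻¹), sq_nonneg (|y|⁻¹)]

theorem norm_natCast_cpow_inv (m : ℕ) {s : ℂ} (hs : 1 < s.re) :
    ‖((m : ℂ) ^ s)⁻¹‖ = ((m : ℝ) ^ s.re)⁻¹ := by
  rw [norm_inv, Complex.norm_natCast_cpow_of_re_ne_zero _ (by linarith)]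

theorem summable_int_sq_inv : Summable fun n : ℤ => ((n : ℝ) ^ 2)⁻¹ := by
  simpa using Real.summable_one_div_int_pow.2 one_lt_two

theorem summable_pair_majorant {σ : ℝ} (hσ : 1 < σ) : Summable fun i : ℤ × ℕ =>
    (((i.1 : ℝ) ^ 2)⁻¹ + (((i.1 : ℝ) + i.2) ^ 2)⁻¹) * ((i.2 : ℝ) ^ σ)⁻¹ := by
  have h1 : Summable fun i : ℤ × ℕ => ((i.1 : ℝ) ^ 2)⁻¹ * ((i.2 : ℝ) ^ σ)⁻¹ :=
    summable_int_sq_inv.mul_of_nonneg (Real.summable_nat_rpow_inv.2 hσ)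
      (fun _ => by positivity) (fun _ => by positivity)
  have h2 := h1.comp_injective (i := fun i : ℤ × ℕ => ((i.1 + i.2, i.2) : ℤ × ℕ)) (by
    rintro ⟨a, b⟩ ⟨c, d⟩ h
    simp only [Prod.mk.injEq] at h ⊢
    omega)
  refine (h1.add h2).congr fun i => ?_
  simp only [Function.comp_apply]
  push_cast
  ring

theorem summable_triple_majorant {σ : ℝ} (hσ : 1 < σ) : Summable fun w : (ℤ × ℕ) × ℤ =>
    ((((w.1.1 : ℝ) ^ 2)⁻¹ + (((w.1.1 : ℝ) + w.1.2) ^ 2)⁻¹) * ((w.1.2 : ℝ) ^ σ)⁻¹) *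
      (((w.2 : ℝ) ^ 2)⁻¹ + (((w.2 : ℝ) + w.1.1 + w.1.2) ^ 2)⁻¹) := by
  have h1 := (summable_pair_majorant hσ).mul_of_nonneg summable_int_sq_inv
      (fun _ => by positivity) (fun _ => by positivity)
  have h2 := h1.comp_injective
    (i := fun w : (ℤ × ℕ) × ℤ => ((w.1, w.2 + w.1.1 + w.1.2) : (ℤ × ℕ) × ℤ)) (by
      rintro ⟨⟨a, b⟩, e⟩ ⟨⟨c, d⟩, f⟩ h
      simp only [Prod.mk.injEq] at h ⊢
      omega)
  refine (h1.add h2).congr fun w => ?_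
  simp only [Function.comp_apply]
  push_cast
  ring

theorem norm_latticeTerm_le {p q a b c : ℕ} (hp : 0 < p) (hq : 0 < q) (ha : 0 < a) (hb : 0 < b)
    (hc : 0 < c) {s : ℂ} (hs : 1 < s.re) (w : (ℤ × ℕ) × ℤ) :
    ‖latticeTerm p q a b c s w‖ ≤
      ((((w.1.1 : ℝ) ^ 2)⁻¹ + (((w.1.1 : ℝ) + w.1.2) ^ 2)⁻¹) * ((w.1.2 : ℝ) ^ s.re)⁻¹) *
      (((w.2 : ℝ) ^ 2)⁻¹ + (((w.2 : ℝ) + w.1.1 + w.1.2) ^ 2)⁻¹) := by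
  obtain ⟨⟨l, m⟩, n⟩ := w
  have e : latticeTerm p q a b c s ((l, m), n) =
      ((((l : ℂ) ^ q)⁻¹ * (((l + m : ℤ) : ℂ) ^ b)⁻¹) * ((m : ℂ) ^ s)⁻¹) *
        ((((n : ℂ) ^ p)⁻¹ * (((n + l + m : ℤ) : ℂ) ^ c)⁻¹) * (((n + l : ℤ) : ℂ) ^ a)⁻¹) := by
    simp only [latticeTerm, mul_inv]
    push_cast
    ring
  have h1 := norm_intCast_pow_inv_le l hq
  have h2 := norm_intCast_pow_inv_le (l + m) hb
  have h3 := norm_intCast_pow_inv_le n hp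
  have h4 := norm_intCast_pow_inv_le (n + l + m) hc
  have h5 := norm_intCast_pow_inv_le_one (n + l) ha
  have h6 := inv_abs_mul_inv_abs_le (l : ℝ) ((l + m : ℤ) : ℝ)
  have h7 := inv_abs_mul_inv_abs_le (n : ℝ) ((n + l + m : ℤ) : ℝ)
  push_cast at h6 h7
  rw [e, norm_mul, norm_mul (_ * _), norm_mul (_ * _), norm_mul, norm_mul,
    norm_natCast_cpow_inv m hs]
  push_cast at h2 h4 h5 ⊢
  refine mul_le_mul (mul_le_mul_of_nonneg_right ?_ (by positivity)) ?_ (by positivity)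
    (by positivity)
  · exact (mul_le_mul h1 h2 (norm_nonneg _) (by positivity)).trans h6
  · refine (mul_le_of_le_one_right (by positivity) h5).trans ?_
    exact (mul_le_mul h3 h4 (norm_nonneg _) (by positivity)).trans h7

theorem summable_latticeTerm {p q a b c : ℕ} (hp : 0 < p) (hq : 0 < q) (ha : 0 < a) (hb : 0 < b)
    (hc : 0 < c) {s : ℂ} (hs : 1 < s.re) : Summable (latticeTerm p q a b c s) :=
  .of_norm_bounded (summable_triple_majorant hs) (norm_latticeTerm_le hp hq ha hb hc hs)

theorem natCast_cpow_inv_differentiable {m : ℕ} (hm : m ≠ 0) :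
    Differentiable ℂ fun s : ℂ => ((m : ℂ) ^ s)⁻¹ := by
  have hm' : (m : ℂ) ≠ 0 := by exact_mod_cast hm
  intro s
  have h1 : DifferentiableAt ℂ (fun s : ℂ => (m : ℂ) ^ s) s :=
    (differentiableAt_id).const_cpow (.inl hm')
  exact h1.inv (by simp [Complex.cpow_eq_zero_iff, hm'])

theorem norm_natCast_cpow_inv_anti {m : ℕ} (hm : m ≠ 0) {z w : ℂ} (h : z.re ≤ w.re) :
    ‖((m : ℂ) ^ w)⁻¹‖ ≤ ‖((m : ℂ) ^ z)⁻¹‖ := by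
  have hm1 : (1 : ℝ) ≤ m := by exact_mod_cast Nat.one_le_iff_ne_zero.2 hm
  rw [norm_inv, norm_inv, Complex.norm_natCast_cpow_of_pos (by omega),
    Complex.norm_natCast_cpow_of_pos (by omega)]
  exact inv_anti₀ (by positivity) (Real.rpow_le_rpow_of_exponent_le hm1 h)

theorem latticeTerm_eq_mul (p q a b c : ℕ) (w : (ℤ × ℕ) × ℤ) : ∃ k : ℂ, ∀ s,
    latticeTerm p q a b c s w = k * ((w.1.2 : ℂ) ^ s)⁻¹ :=
  ⟨((w.2 : ℂ) ^ p * (w.1.1 : ℂ) ^ q * ((w.2 : ℂ) + w.1.1) ^ a *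
    ((w.1.1 : ℂ) + w.1.2) ^ b * ((w.2 : ℂ) + w.1.1 + w.1.2) ^ c)⁻¹, fun s => by
    simp only [latticeTerm, mul_inv]; ring⟩

theorem isDirichletFamily_doubleTerms {p q : ℕ} (hp : 0 < p) (hq : 0 < q) {x y : ℂ}
    (hx : ‖x‖ = 1) (hy : ‖y‖ = 1) : IsDirichletFamily (doubleTerms p q x y) := by
  have e : ∀ i s, doubleTerms p q x y i s = (x ^ i.1.1 * y ^ i.1.2 *
      (((i.1.1 : ℂ) ^ p)⁻¹ * (((i.1.1 + i.1.2 : ℤ) : ℂ) ^ q)⁻¹)) * ((i.1.2 : ℂ) ^ s)⁻¹ := by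
    intro i s
    rw [doubleTerms, div_eq_mul_inv, mul_inv, mul_inv]
    ring
  have hm : ∀ i : {i : ℤ × ℕ // i.1 ≠ 0 ∧ 1 ≤ i.2 ∧ i.1 + i.2 ≠ 0}, i.1.2 ≠ 0 := fun i => by
    have := i.2.2.1; omega
  refine ⟨fun i => ?_, fun i z w h => ?_, fun z hz => ?_⟩
  · simp only [funext (e i)]
    exact (natCast_cpow_inv_differentiable (hm i)).const_mul _
  · obtain ⟨k, hk⟩ : ∃ k : ℂ, ∀ s, doubleTerms p q x y i s = k * ((i.1.2 : ℂ) ^ s)⁻¹ := ⟨_, e i⟩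
    rw [hk, hk, norm_mul, norm_mul]
    exact mul_le_mul_of_nonneg_left (norm_natCast_cpow_inv_anti (hm i) h) (norm_nonneg k)
  · refine .of_norm_bounded ((summable_pair_majorant hz).comp_injective Subtype.val_injective)
      fun i => ?_
    have h1 := norm_intCast_pow_inv_le i.1.1 hp
    have h2 := norm_intCast_pow_inv_le (i.1.1 + i.1.2) hq
    have h6 := inv_abs_mul_inv_abs_le (i.1.1 : ℝ) ((i.1.1 + i.1.2 : ℤ) : ℝ)
    rw [e, norm_mul, norm_mul, norm_mul, norm_zpow, norm_pow, hx, hy, one_zpow, one_pow, one_mul,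
      one_mul, norm_mul, norm_natCast_cpow_inv _ hz]
    push_cast at h2 h6 ⊢
    exact mul_le_mul_of_nonneg_right ((mul_le_mul h1 h2 (norm_nonneg _) (by positivity)).trans h6)
      (by positivity)

/-! ### The twelve chambers -/

theorem mem_rootLatticeA3_iff (w : Fin 3 → ℤ) :
    w ∈ rootLatticeA3 ↔ (w 0 + 2 * w 1 + 3 * w 2) % 4 = 0 := by
  have hgen : ∀ j, (fun i : Fin 3 => CartanMatrix.A 3 i j) ∈ rootLatticeA3 := fun j =>
    AddSubgroup.subset_closure ⟨j, rfl⟩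
  constructor
  · intro h
    induction h using AddSubgroup.closure_induction with
    | mem x hx =>
      obtain ⟨j, rfl⟩ := hx
      fin_cases j <;> simp [CartanMatrix.A]
    | zero => simp
    | add x y _ _ hx hy => simp only [Pi.add_apply]; omega
    | neg x _ hx => simp only [Pi.neg_apply]; omega
  · intro h
    set c2 := (w 0 + 2 * w 1 + 3 * w 2) / 4 with hc2
    set c1 := 2 * c2 - w 2 with hc1
    set c0 := 2 * c1 - c2 - w 1 with hc0
    have hw : w = c0 • (fun i : Fin 3 => CartanMatrix.A 3 i 0) +
        c1 • (fun i : Fin 3 => CartanMatrix.A 3 i 1) +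
        c2 • (fun i : Fin 3 => CartanMatrix.A 3 i 2) := by
      funext i
      fin_cases i <;> simp [CartanMatrix.A] <;> omega
    rw [hw]
    exact add_mem (add_mem (zsmul_mem (hgen 0) _) (zsmul_mem (hgen 1) _)) (zsmul_mem (hgen 2) _)

theorem mem_shiftedDominant_iff (w : Fin 3 → ℤ) : w ∈ shiftedDominant rootLatticeA3 ↔
    (0 < w 0 ∧ 0 < w 1 ∧ 0 < w 2) ∧ (w 0 + 2 * w 1 + 3 * w 2) % 4 = 2 := by
  constructor
  · rintro ⟨μ, hμ, h0, rfl⟩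
    rw [mem_rootLatticeA3_iff] at hμ
    have := h0 0
    have := h0 1
    have := h0 2
    simp only [Pi.add_apply, Pi.one_apply]
    omega
  · rintro ⟨h0, h1⟩
    refine ⟨w - 1, (mem_rootLatticeA3_iff _).2 ?_, fun i => ?_, by simp⟩
    · simp only [Pi.sub_apply, Pi.one_apply]; omega
    · fin_cases i <;> simp <;> omega

/-- Writing `(n, l, m) = (x₁ - x₂, x₂ - x₃, x₃ - x₄)`, the twelve orderings of `x₁, …, x₄` with
`x₃ > x₄` each give a chamber; this is its parametrisation `w ↦ ((l, m), n)` by the successive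
differences `w` of the ordered `xᵢ`. -/
def chamberMap : Fin 12 → (Fin 3 → ℤ) → (ℤ × ℕ) × ℤ :=
  ![fun w => ((w 1, (w 2).toNat), w 0),
    fun w => ((w 0 + w 1, (w 2).toNat), -w 0),
    fun w => ((w 0, (w 1 + w 2).toNat), -(w 0 + w 1)),
    fun w => ((w 0, (w 1).toNat), -(w 0 + w 1 + w 2)),
    fun w => ((-w 1, (w 1 + w 2).toNat), w 0 + w 1),
    fun w => ((-(w 1 + w 2), (w 1).toNat), w 0 + w 1 + w 2),
    fun w => ((-(w 0 + w 1), (w 0 + w 1 + w 2).toNat), w 1),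
    fun w => ((-(w 0 + w 1 + w 2), (w 0 + w 1).toNat), w 1 + w 2),
    fun w => ((-(w 0 + w 1 + w 2), (w 0).toNat), w 2),
    fun w => ((-w 0, (w 0 + w 1 + w 2).toNat), -w 1),
    fun w => ((-w 0, (w 0 + w 1).toNat), -(w 1 + w 2)),
    fun w => ((-(w 0 + w 1), (w 0).toNat), -w 2)]

/-- The index of the chamber containing `((l, m), n)`. -/
def chamberIndex (w : (ℤ × ℕ) × ℤ) : Fin 12 :=
  if 0 < w.1.1 then
    if 0 < w.2 then 0 else if 0 < w.2 + w.1.1 then 1 else if 0 < w.2 + w.1.1 + w.1.2 then 2 else 3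
  else if 0 < w.1.1 + w.1.2 then
    if 0 < w.2 + w.1.1 then 4 else if 0 < w.2 then 6 else if 0 < w.2 + w.1.1 + w.1.2 then 9 else 10
  else
    if 0 < w.2 + w.1.1 then 5 else if 0 < w.2 + w.1.1 + w.1.2 then 7 else if 0 < w.2 then 8 else 11

theorem chamberIndex_chamberMap (i : Fin 12) {w : Fin 3 → ℤ} (h : 0 < w 0 ∧ 0 < w 1 ∧ 0 < w 2) :
    chamberIndex (chamberMap i w) = i := by
  fin_cases i <;> simp [chamberIndex, chamberMap] <;> split_ifs <;> first | rfl | (exfalso; omega)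

theorem chamberMap_injective (i : Fin 12) {w w' : Fin 3 → ℤ} (h : 0 < w 0 ∧ 0 < w 1 ∧ 0 < w 2)
    (h' : 0 < w' 0 ∧ 0 < w' 1 ∧ 0 < w' 2) (he : chamberMap i w = chamberMap i w') : w = w' := by
  have : w 0 = w' 0 ∧ w 1 = w' 1 ∧ w 2 = w' 2 := by
    fin_cases i <;> simp [chamberMap] at he <;> omega
  funext k
  fin_cases k
  exacts [this.1, this.2.1, this.2.2]

/-- The chambers exhaust the points with `m > 0` outside the reflection hyperplanes. -/
theorem exists_chamberMap_eq {l n : ℤ} {m : ℕ} (hm : m ≠ 0) (hl : l ≠ 0) (hn : n ≠ 0)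
    (hnl : n + l ≠ 0) (hlm : l + m ≠ 0) (hnlm : n + l + m ≠ 0) :
    ∃ i w, (0 < w 0 ∧ 0 < w 1 ∧ 0 < w 2) ∧ chamberMap i w = ((l, m), n) := by
  by_cases h1 : 0 < l
  · by_cases h2 : 0 < n
    · exact ⟨0, ![n, l, m], by simp; omega, by simp [chamberMap]⟩
    by_cases h3 : 0 < n + l
    · exact ⟨1, ![-n, n + l, m], by simp; omega, by simp [chamberMap]⟩
    by_cases h4 : 0 < n + l + m
    · exact ⟨2, ![l, -(n + l), n + l + m], by simp; omega, by simp [chamberMap]; omega⟩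
    · exact ⟨3, ![l, m, -(n + l + m)], by simp; omega, by simp [chamberMap]⟩
  by_cases h2 : 0 < l + m
  · by_cases h3 : 0 < n + l
    · exact ⟨4, ![n + l, -l, l + m], by simp; omega, by simp [chamberMap]⟩
    by_cases h4 : 0 < n
    · exact ⟨6, ![-(n + l), n, l + m], by simp; omega, by simp [chamberMap]⟩
    by_cases h5 : 0 < n + l + m
    · exact ⟨9, ![-l, -n, n + l + m], by simp; omega, by simp [chamberMap]; omega⟩
    · exact ⟨10, ![-l, l + m, -(n + l + m)], by simp; omega, by simp [chamberMap]⟩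
  · by_cases h3 : 0 < n + l
    · exact ⟨5, ![n + l, m, -(l + m)], by simp; omega, by simp [chamberMap]⟩
    by_cases h4 : 0 < n + l + m
    · exact ⟨7, ![-(n + l), n + l + m, -(l + m)], by simp; omega, by simp [chamberMap]; omega⟩
    by_cases h5 : 0 < n
    · exact ⟨8, ![m, -(n + l + m), n], by simp; omega, by simp [chamberMap]⟩
    · exact ⟨11, ![m, -(l + m), -n], by simp; omega, by simp [chamberMap]⟩

theorem chamberMap_congruence (i : Fin 12) {w : Fin 3 → ℤ} (h : 0 < w 0 ∧ 0 < w 1 ∧ 0 < w 2) :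
    ((chamberMap i w).2 + 2 * (chamberMap i w).1.1 + 3 * (chamberMap i w).1.2) % 4 = 2 ↔
      (w 0 + 2 * w 1 + 3 * w 2) % 4 = 2 := by
  fin_cases i <;> simp [chamberMap] <;> omega

theorem chamberMap_pos (i : Fin 12) {w : Fin 3 → ℤ} (h : 0 < w 0 ∧ 0 < w 1 ∧ 0 < w 2) :
    (chamberMap i w).1.2 ≠ 0 := by
  fin_cases i <;> simp [chamberMap] <;> omega

theorem zetaA3Term_zero (w : Fin 3 → ℤ) (s : Fin 6 → ℂ) : zetaA3Term 0 w s =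
    (w 0 : ℂ) ^ (-s 0) * (w 1 : ℂ) ^ (-s 1) * (w 2 : ℂ) ^ (-s 2) * ((w 0 : ℂ) + w 1) ^ (-s 3) *
      ((w 1 : ℂ) + w 2) ^ (-s 4) * ((w 0 : ℂ) + w 1 + w 2) ^ (-s 5) := by
  simp [zetaA3Term, Fin.prod_univ_six, posCorootA3, dotProduct,
    Fin.sum_univ_three]

/-- The value of `latticeTerm` at a point at which the six coroots take the values `± X₁`, `± X₂`,
`M`, `± X₃`, `± X₄`, `± X₅`. -/
theorem latticeTerm_eq_signed {p q a b c : ℕ} {s : ℂ} (n l : ℤ) (m : ℕ) (X₁ X₂ M X₃ X₄ X₅ : ℂ)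
    (e₁ e₂ e₃ e₄ e₅ : ℕ) (hM : (m : ℂ) = M)
    (h₁ : (n : ℂ) = (-1) ^ e₁ * X₁ := by push_cast; ring)
    (h₂ : (l : ℂ) = (-1) ^ e₂ * X₂ := by push_cast; ring)
    (h₃ : (n : ℂ) + l = (-1) ^ e₃ * X₃ := by push_cast; ring)
    (h₄ : (l : ℂ) + M = (-1) ^ e₄ * X₄ := by push_cast; ring)
    (h₅ : (n : ℂ) + l + M = (-1) ^ e₅ * X₅ := by push_cast; ring) :
    latticeTerm p q a b c s ((l, m), n) = (-1) ^ (e₁ * p + e₂ * q + e₃ * a + e₄ * b + e₅ * c) *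
      ((X₁ ^ p)⁻¹ * (X₂ ^ q)⁻¹ * (M ^ s)⁻¹ * (X₃ ^ a)⁻¹ * (X₄ ^ b)⁻¹ * (X₅ ^ c)⁻¹) := by
  simp only [latticeTerm, hM]
  rw [h₅, h₄, h₃, h₂, h₁]
  have hs : ∀ e k : ℕ, (((-1 : ℂ) ^ e) ^ k)⁻¹ = (-1) ^ (e * k) := fun e k => by
    rw [← pow_mul, ← inv_pow, inv_neg, inv_one]
  simp only [mul_inv, mul_pow, hs, pow_add]
  ring

/-- The twelve signed summands are the values of `latticeTerm` on the twelve chambers. -/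
theorem sign_mul_zetaPU4Terms (p q a b c : ℕ) (i : Fin 12) (s : ℂ)
    (w : shiftedDominant rootLatticeA3) :
    (-1) ^ signExponent p q a b c i * zetaPU4Terms (permutedArgs p q a b c i) w s =
      latticeTerm p q a b c s (chamberMap i w) := by
  obtain ⟨w, hw⟩ := w
  obtain ⟨⟨h0, h1, h2⟩, -⟩ := (mem_shiftedDominant_iff w).1 hw
  have c0 : (((w 0).toNat : ℕ) : ℂ) = w 0 := by exact_mod_cast Int.toNat_of_nonneg h0.le
  have c1 : (((w 1).toNat : ℕ) : ℂ) = w 1 := by exact_mod_cast Int.toNat_of_nonneg h1.le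
  have c2 : (((w 2).toNat : ℕ) : ℂ) = w 2 := by exact_mod_cast Int.toNat_of_nonneg h2.le
  have c01 : (((w 0 + w 1).toNat : ℕ) : ℂ) = w 0 + w 1 := by
    exact_mod_cast Int.toNat_of_nonneg (by omega : 0 ≤ w 0 + w 1)
  have c12 : (((w 1 + w 2).toNat : ℕ) : ℂ) = w 1 + w 2 := by
    exact_mod_cast Int.toNat_of_nonneg (by omega : 0 ≤ w 1 + w 2)
  have c012 : (((w 0 + w 1 + w 2).toNat : ℕ) : ℂ) = w 0 + w 1 + w 2 := by
    exact_mod_cast Int.toNat_of_nonneg (by omega : 0 ≤ w 0 + w 1 + w 2)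
  rw [zetaPU4Terms, zetaA3Term_zero]
  fin_cases i
  · refine Eq.trans ?_ (latticeTerm_eq_signed (w 0) (w 1) (w 2).toNat
      (w 0) (w 1) (w 2) (w 0 + w 1) (w 1 + w 2) (w 0 + w 1 + w 2)
      0 0 0 0 0 c2).symm
    simp [permutedArgs, signExponent, Complex.cpow_neg, -mul_eq_mul_left_iff,
      -mul_eq_mul_right_iff]
  · refine Eq.trans ?_ (latticeTerm_eq_signed (-w 0) (w 0 + w 1) (w 2).toNat
      (w 0) (w 0 + w 1) (w 2) (w 1) (w 0 + w 1 + w 2) (w 1 + w 2)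
      1 0 0 0 0 c2).symm
    simp [permutedArgs, signExponent, Complex.cpow_neg, -mul_eq_mul_left_iff,
      -mul_eq_mul_right_iff]
    ring
  · refine Eq.trans ?_ (latticeTerm_eq_signed (-(w 0 + w 1)) (w 0) (w 1 + w 2).toNat
      (w 0 + w 1) (w 0) (w 1 + w 2) (w 1) (w 0 + w 1 + w 2) (w 2)
      1 0 1 0 0 c12).symm
    simp [permutedArgs, signExponent, Complex.cpow_neg, -mul_eq_mul_left_iff,
      -mul_eq_mul_right_iff]
    ring
  · refine Eq.trans ?_ (latticeTerm_eq_signed (-(w 0 + w 1 + w 2)) (w 0) (w 1).toNat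
      (w 0 + w 1 + w 2) (w 0) (w 1) (w 1 + w 2) (w 0 + w 1) (w 2)
      1 0 1 0 1 c1).symm
    simp [permutedArgs, signExponent, Complex.cpow_neg, -mul_eq_mul_left_iff,
      -mul_eq_mul_right_iff]
    ring
  · refine Eq.trans ?_ (latticeTerm_eq_signed (w 0 + w 1) (-w 1) (w 1 + w 2).toNat
      (w 0 + w 1) (w 1) (w 1 + w 2) (w 0) (w 2) (w 0 + w 1 + w 2)
      0 1 0 0 0 c12).symm
    simp [permutedArgs, signExponent, Complex.cpow_neg, -mul_eq_mul_left_iff,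
      -mul_eq_mul_right_iff]
    ring
  · refine Eq.trans ?_ (latticeTerm_eq_signed (w 0 + w 1 + w 2) (-(w 1 + w 2)) (w 1).toNat
      (w 0 + w 1 + w 2) (w 1 + w 2) (w 1) (w 0) (w 2) (w 0 + w 1)
      0 1 0 1 0 c1).symm
    simp [permutedArgs, signExponent, Complex.cpow_neg, -mul_eq_mul_left_iff,
      -mul_eq_mul_right_iff]
    ring
  · refine Eq.trans ?_ (latticeTerm_eq_signed (w 1) (-(w 0 + w 1)) (w 0 + w 1 + w 2).toNat
      (w 1) (w 0 + w 1) (w 0 + w 1 + w 2) (w 0) (w 2) (w 1 + w 2)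
      0 1 1 0 0 c012).symm
    simp [permutedArgs, signExponent, Complex.cpow_neg, -mul_eq_mul_left_iff,
      -mul_eq_mul_right_iff]
    ring
  · refine Eq.trans ?_ (latticeTerm_eq_signed (w 1 + w 2) (-(w 0 + w 1 + w 2)) (w 0 + w 1).toNat
      (w 1 + w 2) (w 0 + w 1 + w 2) (w 0 + w 1) (w 0) (w 2) (w 1)
      0 1 1 1 0 c01).symm
    simp [permutedArgs, signExponent, Complex.cpow_neg, -mul_eq_mul_left_iff,
      -mul_eq_mul_right_iff]
    ring
  · refine Eq.trans ?_ (latticeTerm_eq_signed (w 2) (-(w 0 + w 1 + w 2)) (w 0).toNat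
      (w 2) (w 0 + w 1 + w 2) (w 0) (w 0 + w 1) (w 1 + w 2) (w 1)
      0 1 1 1 1 c0).symm
    simp [permutedArgs, signExponent, Complex.cpow_neg, -mul_eq_mul_left_iff,
      -mul_eq_mul_right_iff]
    ring
  · refine Eq.trans ?_ (latticeTerm_eq_signed (-w 1) (-w 0) (w 0 + w 1 + w 2).toNat
      (w 1) (w 0) (w 0 + w 1 + w 2) (w 0 + w 1) (w 1 + w 2) (w 2)
      1 1 1 0 0 c012).symm
    simp [permutedArgs, signExponent, Complex.cpow_neg, -mul_eq_mul_left_iff,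
      -mul_eq_mul_right_iff]
    ring
  · refine Eq.trans ?_ (latticeTerm_eq_signed (-(w 1 + w 2)) (-w 0) (w 0 + w 1).toNat
      (w 1 + w 2) (w 0) (w 0 + w 1) (w 0 + w 1 + w 2) (w 1) (w 2)
      1 1 1 0 1 c01).symm
    simp [permutedArgs, signExponent, Complex.cpow_neg, -mul_eq_mul_left_iff,
      -mul_eq_mul_right_iff]
    ring
  · refine Eq.trans ?_ (latticeTerm_eq_signed (-w 2) (-(w 0 + w 1)) (w 0).toNat
      (w 2) (w 0 + w 1) (w 0) (w 0 + w 1 + w 2) (w 1) (w 1 + w 2)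
      1 1 1 1 1 c0).symm
    simp [permutedArgs, signExponent, Complex.cpow_neg, -mul_eq_mul_left_iff,
      -mul_eq_mul_right_iff]
    ring

theorem zetaPU4Terms_eq (p q a b c : ℕ) (i : Fin 12) (s : ℂ)
    (w : shiftedDominant rootLatticeA3) :
    zetaPU4Terms (permutedArgs p q a b c i) w s =
      (-1) ^ signExponent p q a b c i * latticeTerm p q a b c s (chamberMap i w) := by
  rw [← sign_mul_zetaPU4Terms, ← mul_assoc, ← mul_pow]
  simp

theorem isDirichletFamily_zetaPU4Terms {p q a b c : ℕ} (hp : 0 < p) (hq : 0 < q) (ha : 0 < a)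
    (hb : 0 < b) (hc : 0 < c) (i : Fin 12) :
    IsDirichletFamily (zetaPU4Terms (permutedArgs p q a b c i)) := by
  have hpos : ∀ w : shiftedDominant rootLatticeA3, 0 < w.1 0 ∧ 0 < w.1 1 ∧ 0 < w.1 2 := fun w =>
    ((mem_shiftedDominant_iff w.1).1 w.2).1
  have hk : ∀ w : shiftedDominant rootLatticeA3, ∃ k : ℂ, ∀ s,
      zetaPU4Terms (permutedArgs p q a b c i) w s = k * (((chamberMap i w.1).1.2 : ℂ) ^ s)⁻¹ := by
    intro w
    obtain ⟨k, hk⟩ := latticeTerm_eq_mul p q a b c (chamberMap i w.1)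
    exact ⟨(-1) ^ signExponent p q a b c i * k, fun s => by rw [zetaPU4Terms_eq, hk, mul_assoc]⟩
  refine ⟨fun w => ?_, fun w z z' h => ?_, fun z hz => ?_⟩
  · obtain ⟨k, hk⟩ := hk w
    simp only [funext hk]
    exact (natCast_cpow_inv_differentiable (chamberMap_pos i (hpos w))).const_mul _
  · obtain ⟨k, hk⟩ := hk w
    rw [hk, hk, norm_mul, norm_mul]
    exact mul_le_mul_of_nonneg_left
      (norm_natCast_cpow_inv_anti (chamberMap_pos i (hpos w)) h) (norm_nonneg k)
  · simp only [zetaPU4Terms_eq]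
    refine ((summable_latticeTerm hp hq ha hb hc hz).comp_injective
      (i := fun w : shiftedDominant rootLatticeA3 => chamberMap i w.1) fun w w' h => ?_).mul_left _
    exact Subtype.ext (chamberMap_injective i (hpos w) (hpos w') h)

/-- The signed sum is a sum over all lattice points in the coset of the root lattice lying on the
positive side of one hyperplane, cut into twelve chambers. -/
theorem PU4SignedSum_eq_tsum {p q a b c : ℕ} (hp : 0 < p) (hq : 0 < q) (ha : 0 < a)
    (hb : 0 < b) (hc : 0 < c) {s : ℂ} (hs : 1 < s.re) :
    PU4SignedSum p q a b c s = ∑' w : (ℤ × ℕ) × ℤ,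
      if (w.2 + 2 * w.1.1 + 3 * w.1.2) % 4 = 2 then latticeTerm p q a b c s w else 0 := by
  have hpos : ∀ w : shiftedDominant rootLatticeA3, 0 < w.1 0 ∧ 0 < w.1 1 ∧ 0 < w.1 2 := fun w =>
    ((mem_shiftedDominant_iff w.1).1 w.2).1
  set f : (ℤ × ℕ) × ℤ → ℂ := fun w =>
    if (w.2 + 2 * w.1.1 + 3 * w.1.2) % 4 = 2 then latticeTerm p q a b c s w else 0 with hf
  have hinj : Function.Injective fun v : Fin 12 × shiftedDominant rootLatticeA3 =>
      chamberMap v.1 v.2.1 := by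
    rintro ⟨i, w⟩ ⟨j, w'⟩ h
    simp only at h
    have hij : i = j := by
      rw [← chamberIndex_chamberMap i (hpos w), h, chamberIndex_chamberMap j (hpos w')]
    subst hij
    exact congrArg (Prod.mk i) (Subtype.ext (chamberMap_injective i (hpos w) (hpos w') h))
  have hsupp : Function.support f ⊆ Set.range fun v : Fin 12 × shiftedDominant rootLatticeA3 =>
      chamberMap v.1 v.2.1 := by
    rintro ⟨⟨l, m⟩, n⟩ h
    rw [Function.mem_support, hf] at h
    simp only [ne_eq, ite_eq_right_iff, Classical.not_imp] at h
    obtain ⟨h4, h⟩ := h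
    simp only [latticeTerm, inv_eq_zero, mul_eq_zero, not_or] at h
    obtain ⟨⟨⟨⟨⟨hn, hl⟩, hm⟩, hnl⟩, hlm⟩, hnlm⟩ := h
    obtain ⟨i, w, hw, e⟩ := exists_chamberMap_eq (l := l) (m := m) (n := n)
      (by
        rintro rfl
        exact hm (by rw [Nat.cast_zero, Complex.zero_cpow (by rintro rfl; norm_num at hs)]))
      (by rintro rfl; exact hl (by simp [hq.ne'])) (by rintro rfl; exact hn (by simp [hp.ne']))
      (fun e => hnl (by
        have : (n : ℂ) + l = 0 := by exact_mod_cast e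
        rw [this, zero_pow ha.ne']))
      (fun e => hlm (by
        have : (l : ℂ) + m = 0 := by exact_mod_cast e
        rw [this, zero_pow hb.ne']))
      (fun e => hnlm (by
        have : (n : ℂ) + l + m = 0 := by exact_mod_cast e
        rw [this, zero_pow hc.ne']))
    have h4' := chamberMap_congruence i hw
    rw [e] at h4'
    exact ⟨(i, ⟨w, (mem_shiftedDominant_iff w).2 ⟨hw, h4'.1 h4⟩⟩), e⟩
  have hsumm : Summable f := by
    refine .of_norm_bounded (summable_latticeTerm hp hq ha hb hc hs).norm fun w => ?_
    rw [hf]; simp only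
    split_ifs <;> simp
  have hcomp : Summable fun v : Fin 12 × shiftedDominant rootLatticeA3 =>
      f (chamberMap v.1 v.2.1) := hsumm.comp_injective hinj
  rw [← hinj.tsum_eq hsupp, hcomp.tsum_prod' fun i => hcomp.comp_injective (i := Prod.mk i)
    fun _ _ h => (Prod.mk.inj h).2, tsum_fintype, PU4SignedSum]
  refine Finset.sum_congr rfl fun i _ => ?_
  rw [(isDirichletFamily_zetaPU4Terms hp hq ha hb hc i).continued_eq_tsum hs, ← tsum_mul_left]
  refine tsum_congr fun w => ?_
  rw [sign_mul_zetaPU4Terms, hf]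
  simp only
  rw [if_pos ((chamberMap_congruence i (hpos w)).2 ((mem_shiftedDominant_iff w.1).1 w.2).2)]

/-! ### The twisted lattice sums -/

/-- The sum over all lattice points with `m > 0` off the hyperplanes, twisted by the character
`(n, l, m) ↦ x ^ (n + 2 l + 3 m)` of the weight lattice modulo the root lattice. -/
noncomputable def twistedSum (p q a b c : ℕ) (x s : ℂ) : ℂ :=
  ∑' w : (ℤ × ℕ) × ℤ, x ^ (w.2 + 2 * w.1.1 + 3 * w.1.2) * latticeTerm p q a b c s w

theorem summable_twisted {p q a b c : ℕ} (hp : 0 < p) (hq : 0 < q) (ha : 0 < a)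
    (hb : 0 < b) (hc : 0 < c) {s : ℂ} (hs : 1 < s.re) {x : ℂ} (hx : ‖x‖ = 1) :
    Summable fun w : (ℤ × ℕ) × ℤ =>
      x ^ (w.2 + 2 * w.1.1 + 3 * w.1.2) * latticeTerm p q a b c s w :=
  .of_norm_bounded (summable_latticeTerm hp hq ha hb hc hs).norm fun w => by
    rw [norm_mul, norm_zpow, hx, one_zpow, one_mul]

/-- Orthogonality of the characters of `ℤ / 4`. -/
theorem sum_characters_eq (k : ℤ) :
    ((1 : ℂ) ^ k - Complex.I ^ k + (-1) ^ k - (-Complex.I) ^ k) / 4 =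
      if k % 4 = 2 then 1 else 0 := by
  have h4 : ∀ x : ℂ, x ≠ 0 → x ^ 4 = 1 → x ^ k = x ^ (k % 4) := fun x hx h => by
    conv_lhs => rw [← Int.emod_add_mul_ediv k 4, zpow_add₀ hx, zpow_mul]
    rw [show x ^ (4 : ℤ) = 1 by exact_mod_cast h, one_zpow, mul_one]
  rw [h4 Complex.I Complex.I_ne_zero Complex.I_pow_four, h4 (-1) (by norm_num) (by norm_num),
    h4 (-Complex.I) (by simp) (by rw [neg_pow, Complex.I_pow_four]; norm_num)]
  have : k % 4 = 0 ∨ k % 4 = 1 ∨ k % 4 = 2 ∨ k % 4 = 3 := by omega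
  have h2 : ∀ x : ℂ, x ^ (2 : ℤ) = x ^ 2 := fun x => by norm_cast
  have h3 : ∀ x : ℂ, x ^ (3 : ℤ) = x ^ 3 := fun x => by norm_cast
  rcases this with h | h | h | h <;> rw [h]
  · norm_num
  · rw [one_zpow, zpow_one, zpow_one, zpow_one, if_neg (by norm_num)]; ring
  · rw [h2, h2, h2, neg_sq, Complex.I_sq]; norm_num
  · rw [h3, h3, h3]; norm_num [neg_pow]

theorem PU4SignedSum_eq_twistedSum {p q a b c : ℕ} (hp : 0 < p) (hq : 0 < q) (ha : 0 < a)
    (hb : 0 < b) (hc : 0 < c) {s : ℂ} (hs : 1 < s.re) :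
    PU4SignedSum p q a b c s = (twistedSum p q a b c 1 s - twistedSum p q a b c Complex.I s +
      twistedSum p q a b c (-1) s - twistedSum p q a b c (-Complex.I) s) / 4 := by
  have h1 := (summable_twisted hp hq ha hb hc hs (x := 1) (by simp)).hasSum
  have h2 := (summable_twisted hp hq ha hb hc hs (x := Complex.I) (by simp)).hasSum
  have h3 := (summable_twisted hp hq ha hb hc hs (x := -1) (by simp)).hasSum
  have h4 := (summable_twisted hp hq ha hb hc hs (x := -Complex.I) (by simp)).hasSum
  rw [PU4SignedSum_eq_tsum hp hq ha hb hc hs]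
  refine ((((h1.sub h2).add h3).sub h4).div_const 4).tsum_eq ▸ tsum_congr fun w => ?_
  have := sum_characters_eq (w.2 + 2 * w.1.1 + 3 * w.1.2)
  have e : (if (w.2 + 2 * w.1.1 + 3 * (w.1.2 : ℤ)) % 4 = 2 then latticeTerm p q a b c s w else 0) =
      (if (w.2 + 2 * w.1.1 + 3 * (w.1.2 : ℤ)) % 4 = 2 then 1 else 0) *
        latticeTerm p q a b c s w := by
    split_ifs <;> simp
  rw [e, ← this]
  ring

/-! ### Evaluation of the twisted sums by double series -/

/-- `fullRHS` with the double series replaced by an arbitrary function, so that the same expression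
can be formed from the terms of the double series. -/
noncomputable def fullRHSWith (T : ℕ → ℂ → ℕ → ℂ → ℂ → ℂ) (f : ℕ → ℂ) (x₁ y₁ x₂ y₂ x₃ y₃ : ℂ)
    (p q a b c : ℕ) (s : ℂ) : ℂ :=
  (-1) ^ p * ∑ j ∈ Finset.range (p + 1), f j * (-1) ^ j *
      ∑ ω ∈ Finset.range (p - j + 1),
        ((ω + a - 1).choose ω : ℂ) * ((p + c - j - ω - 1).choose (c - 1) : ℂ) *
          T (q + a + ω) s (p + b + c - j - ω) x₁ y₁ +
  (-1) ^ (p + a) * ∑ j ∈ Finset.range (c + 1), f j *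
      ∑ ω ∈ Finset.range (c - j + 1),
        ((ω + a - 1).choose ω : ℂ) * ((p + c - j - ω - 1).choose (p - 1) : ℂ) *
          T q (s + a + ω) (p + b + c - j - ω) x₂ y₂ +
  (-1) ^ p * ∑ j ∈ Finset.range (a + 1), f j *
      ∑ ω ∈ Finset.range p,
        ((ω + (a - j)).choose ω : ℂ) * ((p + c - 2 - ω).choose (c - 1) : ℂ) *
          T (q + (a - j) + ω + 1) s (p + b + c - 1 - ω) x₃ y₃ +
  (-1) ^ (p + a) * ∑ j ∈ Finset.range (a + 1), f j * (-1) ^ j *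
      ∑ ω ∈ Finset.range c,
        ((ω + (a - j)).choose ω : ℂ) * ((p + c - 2 - ω).choose (p - 1) : ℂ) *
          T q (s + (a - j : ℕ) + ω + 1) (p + b + c - 1 - ω) x₃ y₃

theorem fullRHS_eq_fullRHSWith : fullRHS = fullRHSWith doubleT := rfl

theorem hasSum_doubleTerms {p q : ℕ} (hp : 0 < p) (hq : 0 < q) {x y : ℂ} (hx : ‖x‖ = 1)
    (hy : ‖y‖ = 1) {s : ℂ} (hs : 1 < s.re) :
    HasSum (fun i => doubleTerms p q x y i s) (doubleT p s q x y) :=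
  (isDirichletFamily_doubleTerms hp hq hx hy).hasSum_continued hs

theorem one_lt_re_add_natCast {s : ℂ} (hs : 1 < s.re) (n : ℕ) : 1 < (s + n).re := by
  rw [Complex.add_re, Complex.natCast_re]
  have := n.cast_nonneg (α := ℝ)
  linarith

theorem hasSum_fullRHSWith {p q a b c : ℕ} (hp : 0 < p) (hq : 0 < q) (ha : 0 < a) (hb : 0 < b)
    (hc : 0 < c) {s : ℂ} (hs : 1 < s.re) (f : ℕ → ℂ) {x₁ y₁ x₂ y₂ x₃ y₃ : ℂ} (hx₁ : ‖x₁‖ = 1)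
    (hy₁ : ‖y₁‖ = 1) (hx₂ : ‖x₂‖ = 1) (hy₂ : ‖y₂‖ = 1) (hx₃ : ‖x₃‖ = 1) (hy₃ : ‖y₃‖ = 1) :
    HasSum (fun i => fullRHSWith (fun P s Q x y => doubleTerms P Q x y i s)
      f x₁ y₁ x₂ y₂ x₃ y₃ p q a b c s) (fullRHS f x₁ y₁ x₂ y₂ x₃ y₃ p q a b c s) := by
  have h2 : ∀ m n : ℕ, 1 < (s + m + n).re := fun m n =>
    one_lt_re_add_natCast (one_lt_re_add_natCast hs m) n
  have h3 : ∀ m n : ℕ, 1 < (s + m + n + 1).re := fun m n => by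
    simpa using one_lt_re_add_natCast (h2 m n) 1
  rw [fullRHS_eq_fullRHSWith]
  refine (((HasSum.add ?_ ?_).add ?_).add ?_)
  · refine (hasSum_sum fun j hj => (hasSum_sum fun ω hω => (hasSum_doubleTerms ?_ ?_ hx₁ hy₁
      hs).mul_left _).mul_left _).mul_left _
    all_goals rw [Finset.mem_range] at hj hω; omega
  · refine (hasSum_sum fun j hj => (hasSum_sum fun ω hω => (hasSum_doubleTerms ?_ ?_ hx₂ hy₂
      (h2 _ _)).mul_left _).mul_left _).mul_left _
    all_goals rw [Finset.mem_range] at hj hω; omega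
  · refine (hasSum_sum fun j hj => (hasSum_sum fun ω hω => (hasSum_doubleTerms ?_ ?_ hx₃ hy₃
      hs).mul_left _).mul_left _).mul_left _
    all_goals rw [Finset.mem_range] at hj hω
    · simp only; omega
    · omega
  · refine (hasSum_sum fun j hj => (hasSum_sum fun ω hω => (hasSum_doubleTerms ?_ ?_ hx₃ hy₃
      (h3 _ _)).mul_left _).mul_left _).mul_left _
    all_goals rw [Finset.mem_range] at hj hω; omega

open SummationFilter in
/-- The sum over `n` for fixed `(l, m)` is the `(l, m)`-term of the combination of double series. -/
theorem tsum_latticeTerm_fiber {p q a b c : ℕ} (hp : 0 < p) (hq : 0 < q) (ha : 0 < a) (hb : 0 < b)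
    (hc : 0 < c) {s : ℂ} (hs : 1 < s.re) {x : ℂ} (hx : ‖x‖ = 1) {g : ℕ → ℂ}
    (hg : IsSymmetricWeight x g)
    (i : {i : ℤ × ℕ // i.1 ≠ 0 ∧ 1 ≤ i.2 ∧ i.1 + i.2 ≠ 0}) :
    ∑' n : ℤ, x ^ (n + 2 * i.1.1 + 3 * i.1.2) * latticeTerm p q a b c s (i.1, n) =
      fullRHSWith (fun P s Q x y => doubleTerms P Q x y i s) g (x ^ 2) (x ^ 3) x (x ^ 2) x (x ^ 3)
        p q a b c s := by
  have hx0 : x ≠ 0 := by rintro rfl; simp at hx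
  have hsum := (summable_twisted hp hq ha hb hc hs hx).comp_injective
    (i := fun n : ℤ => ((i.1, n) : (ℤ × ℕ) × ℤ)) (fun _ _ h => (Prod.mk.inj h).2)
  obtain ⟨⟨l, m⟩, hl, hm, hlm⟩ := i
  simp only [Function.comp_def] at hl hm hlm hsum ⊢
  have hm0 : (m : ℂ) ≠ 0 := by exact_mod_cast (by omega : m ≠ 0)
  have key := (hasSum_symmetricIcc_three_poles hx hg.zero hg.hasSum hp ha hc hl
    (m := (m : ℤ)) (by omega) hlm).mul_left
      (x ^ (2 * l + 3 * (m : ℤ)) * ((l : ℂ) ^ q * (m : ℂ) ^ s * ((l : ℂ) + m) ^ b)⁻¹)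
  have h1 := key.congr_fun (g := fun n : ℤ =>
      x ^ (n + 2 * l + 3 * m) * latticeTerm p q a b c s ((l, m), n)) fun n => by
    rw [add_assoc n, zpow_add₀ hx0, latticeTerm]
    simp only [mul_inv, Int.cast_natCast]
    ring
  have h2 : HasSum (fun n : ℤ => x ^ (n + 2 * l + 3 * m) * latticeTerm p q a b c s ((l, m), n))
      (∑' n : ℤ, x ^ (n + 2 * l + 3 * m) * latticeTerm p q a b c s ((l, m), n))
      (symmetricIcc ℤ) := hsum.hasSum.mono_left LeAtTop.le_atTop
  rw [h2.unique h1]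
  -- the two ways in which a product of the prefactor and a pole term is a term of a double series
  have d₁ : ∀ (e : ℤ) (A C Q : ℕ) (X Y : ℂ), x ^ (2 * l + 3 * (m : ℤ)) * x ^ e = X ^ l * Y ^ m →
      Q = b + C →
      doubleTerms (q + A) Q X Y ⟨(l, m), hl, hm, hlm⟩ s =
        (x ^ (2 * l + 3 * (m : ℤ)) * ((l : ℂ) ^ q * (m : ℂ) ^ s * ((l : ℂ) + m) ^ b)⁻¹) *
          (x ^ e * ((l : ℂ) ^ A * ((l : ℂ) + (m : ℤ)) ^ C)⁻¹) := by
    rintro e A C _ X Y h rfl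
    simp only [doubleTerms, div_eq_mul_inv, ← h, pow_add, mul_inv]
    push_cast
    ring
  have d₂ : ∀ (e : ℤ) (A C Q : ℕ) (X Y s' : ℂ), x ^ (2 * l + 3 * (m : ℤ)) * x ^ e = X ^ l * Y ^ m →
      Q = b + C → s' = s + A →
      doubleTerms q Q X Y ⟨(l, m), hl, hm, hlm⟩ s' =
        (x ^ (2 * l + 3 * (m : ℤ)) * ((l : ℂ) ^ q * (m : ℂ) ^ s * ((l : ℂ) + m) ^ b)⁻¹) *
          (x ^ e * (((m : ℤ) : ℂ) ^ A * ((l : ℂ) + (m : ℤ)) ^ C)⁻¹) := by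
    rintro e A C _ X Y _ h rfl rfl
    simp only [doubleTerms, div_eq_mul_inv, ← h, pow_add, mul_inv, Complex.cpow_add _ _ hm0,
      Complex.cpow_natCast]
    push_cast
    ring
  have hx2 : x ^ (2 * l + 3 * (m : ℤ)) * x ^ (0 : ℤ) = (x ^ 2) ^ l * (x ^ 3) ^ m := by
    rw [zpow_zero, mul_one, zpow_add₀ hx0, zpow_mul, zpow_mul, zpow_natCast]
    norm_cast
  have hx1 : x ^ (2 * l + 3 * (m : ℤ)) * x ^ (-l) = x ^ l * (x ^ 3) ^ m := by
    rw [← zpow_natCast (x ^ 3), ← zpow_natCast x, ← zpow_mul, ← zpow_add₀ hx0, ← zpow_add₀ hx0]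
    congr 1; push_cast; ring
  have hx12 : x ^ (2 * l + 3 * (m : ℤ)) * x ^ (-(l + m)) = x ^ l * (x ^ 2) ^ m := by
    rw [← zpow_natCast (x ^ 2), ← zpow_natCast x, ← zpow_mul, ← zpow_add₀ hx0, ← zpow_add₀ hx0]
    congr 1; push_cast; ring
  rw [fullRHSWith, mul_add, mul_add, mul_add]
  congr 1
  congr 1
  congr 1
  · rw [mul_left_comm, Finset.mul_sum]
    congr 1
    refine Finset.sum_congr rfl fun j hj => ?_
    rw [mul_left_comm, Finset.mul_sum]
    congr 1
    refine Finset.sum_congr rfl fun ω hω => ?_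
    rw [Finset.mem_range] at hj hω
    rw [mul_left_comm, add_assoc q, d₁ 0 (a + ω) (p + c - j - ω) _ _ _ hx2 (by omega), zpow_zero,
      one_mul]
  · rw [mul_left_comm, Finset.mul_sum]
    congr 1
    refine Finset.sum_congr rfl fun j hj => ?_
    rw [mul_left_comm, Finset.mul_sum]
    congr 1
    refine Finset.sum_congr rfl fun ω hω => ?_
    rw [Finset.mem_range] at hj hω
    rw [mul_left_comm, d₂ (-(l + m)) (a + ω) (p + c - j - ω) _ _ _ _ hx12 (by omega)
      (by push_cast; ring)]
  · rw [mul_left_comm, Finset.mul_sum]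
    congr 1
    refine Finset.sum_congr rfl fun j hj => ?_
    rw [mul_left_comm, Finset.mul_sum]
    congr 1
    refine Finset.sum_congr rfl fun ω hω => ?_
    rw [Finset.mem_range] at hj hω
    rw [mul_left_comm, show q + (a - j) + ω + 1 = q + (a - j + ω + 1) by ring,
      d₁ (-l) (a - j + ω + 1) (p + c - 1 - ω) _ _ _ hx1 (by omega)]
  · rw [mul_left_comm, Finset.mul_sum]
    congr 1
    refine Finset.sum_congr rfl fun j hj => ?_
    rw [mul_left_comm, Finset.mul_sum]
    congr 1
    refine Finset.sum_congr rfl fun ω hω => ?_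
    rw [Finset.mem_range] at hj hω
    rw [mul_left_comm, d₂ (-l) (a - j + ω + 1) (p + c - 1 - ω) _ _ _ _ hx1 (by omega)
      (by push_cast; ring)]

theorem twistedSum_eq_fullRHS {p q a b c : ℕ} (hp : 0 < p) (hq : 0 < q) (ha : 0 < a) (hb : 0 < b)
    (hc : 0 < c) {s : ℂ} (hs : 1 < s.re) {x : ℂ} (hx : ‖x‖ = 1) {g : ℕ → ℂ}
    (hg : IsSymmetricWeight x g) : twistedSum p q a b c x s =
      fullRHS g (x ^ 2) (x ^ 3) x (x ^ 2) x (x ^ 3) p q a b c s := by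
  have hn : ∀ k : ℕ, ‖x ^ k‖ = 1 := fun k => by rw [norm_pow, hx, one_pow]
  have hR := hasSum_fullRHSWith hp hq ha hb hc hs g (hn 2) (hn 3) hx (hn 2) hx (hn 3)
  rw [← hR.tsum_eq, twistedSum]
  have hsum := summable_twisted hp hq ha hb hc hs hx
  rw [hsum.tsum_prod]
  have hinj : Function.Injective
    (Subtype.val : {i : ℤ × ℕ // i.1 ≠ 0 ∧ 1 ≤ i.2 ∧ i.1 + i.2 ≠ 0} → ℤ × ℕ) :=
      Subtype.val_injective
  rw [← hinj.tsum_eq]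
  · exact tsum_congr fun i => tsum_latticeTerm_fiber hp hq ha hb hc hs hx hg i
  · rintro ⟨l, m⟩ h
    -- the remaining `(l, m)` lie on hyperplanes, where `latticeTerm` is `0` because `0⁻¹ = 0`
    by_contra hmem
    refine h ?_
    have hz : ∀ n, latticeTerm p q a b c s ((l, m), n) = 0 := by
      intro n
      have : l = 0 ∨ m = 0 ∨ l + m = 0 := by
        by_contra hcon
        push Not at hcon
        exact hmem ⟨⟨(l, m), hcon.1, Nat.one_le_iff_ne_zero.2 hcon.2.1, hcon.2.2⟩, rfl⟩
      rcases this with rfl | rfl | h0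
      · simp [latticeTerm, hq.ne']
      · have : s ≠ 0 := by rintro rfl; norm_num at hs
        simp [latticeTerm, this]
      · have : (l : ℂ) + m = 0 := by exact_mod_cast h0
        simp [latticeTerm, this, hb.ne']
    simp [hz]

theorem sum_range_succ_of_odd_eq_zero {u : ℕ → ℂ} (hu : ∀ j, ¬ Even j → u j = 0) (p : ℕ) :
    ∑ j ∈ Finset.range (p + 1), u j = ∑ j ∈ Finset.range (p / 2 + 1), u (2 * j) := by
  symm
  refine Finset.sum_of_injOn (fun j => 2 * j) (fun _ _ _ _ h => by simpa using h)
    (fun j hj => ?_) (fun j hj hn => hu j fun he => hn ?_) fun _ _ => rfl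
  · simp only [Finset.coe_range, Set.mem_Iio] at hj ⊢
    omega
  · obtain ⟨r, hr⟩ := he
    refine ⟨r, ?_, ?_⟩
    · simp only [Finset.coe_range, Set.mem_Iio, Finset.mem_range] at hj ⊢
      omega
    · simp only; omega

theorem evenWeight_two_mul (f : ℕ → ℂ) (j : ℕ) : evenWeight f (2 * j) = 2 * f (2 * j) :=
  if_pos (even_two_mul j)

/-- `evenRHS` is the case of `fullRHS` in which the weights vanish at odd arguments. -/
theorem fullRHS_evenWeight (f : ℕ → ℂ) (x₁ y₁ x₂ y₂ x₃ y₃ : ℂ) (p q a b c : ℕ) (s : ℂ) :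
    fullRHS (evenWeight f) x₁ y₁ x₂ y₂ x₃ y₃ p q a b c s =
      evenRHS f x₁ y₁ x₂ y₂ x₃ y₃ p q a b c s := by
  have key : ∀ (e P : ℕ) (u : ℕ → ℂ),
      (-1 : ℂ) ^ e * ∑ j ∈ Finset.range (P + 1), evenWeight f j * u j =
        2 * (-1) ^ e * ∑ j ∈ Finset.range (P / 2 + 1), f (2 * j) * u (2 * j) := by
    intro e P u
    rw [sum_range_succ_of_odd_eq_zero (u := fun j => evenWeight f j * u j)
      fun j hj => by rw [evenWeight, if_neg hj, zero_mul]]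
    simp only [evenWeight_two_mul, mul_assoc (2 : ℂ), ← Finset.mul_sum]
    ring
  simp only [fullRHS, evenRHS, mul_assoc (evenWeight f _), key, (even_two_mul _).neg_one_pow,
    one_mul]

theorem twistedSum_one {p q a b c : ℕ} (hp : 0 < p) (hq : 0 < q) (ha : 0 < a) (hb : 0 < b)
    (hc : 0 < c) {s : ℂ} (hs : 1 < s.re) : twistedSum p q a b c 1 s = J0 p q a b c s := by
  rw [twistedSum_eq_fullRHS hp hq ha hb hc hs (by simp) isSymmetricWeight_one, fullRHS_evenWeight,
    J0, one_pow, one_pow]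

theorem twistedSum_neg_one {p q a b c : ℕ} (hp : 0 < p) (hq : 0 < q) (ha : 0 < a) (hb : 0 < b)
    (hc : 0 < c) {s : ℂ} (hs : 1 < s.re) : twistedSum p q a b c (-1) s = J2 p q a b c s := by
  rw [twistedSum_eq_fullRHS hp hq ha hb hc hs (by simp) isSymmetricWeight_neg_one,
    fullRHS_evenWeight, J2, neg_one_sq, show (-1 : ℂ) ^ 3 = -1 by norm_num]

theorem twistedSum_I {p q a b c : ℕ} (hp : 0 < p) (hq : 0 < q) (ha : 0 < a) (hb : 0 < b)
    (hc : 0 < c) {s : ℂ} (hs : 1 < s.re) : twistedSum p q a b c Complex.I s = J3 p q a b c s := by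
  rw [twistedSum_eq_fullRHS hp hq ha hb hc hs (by simp) isSymmetricWeight_I, J3, Complex.I_sq,
    Complex.I_pow_three]

theorem twistedSum_neg_I {p q a b c : ℕ} (hp : 0 < p) (hq : 0 < q) (ha : 0 < a) (hb : 0 < b)
    (hc : 0 < c) {s : ℂ} (hs : 1 < s.re) :
    twistedSum p q a b c (-Complex.I) s = J1 p q a b c s := by
  rw [twistedSum_eq_fullRHS hp hq ha hb hc hs (by simp) isSymmetricWeight_neg_I, J1, neg_sq,
    Complex.I_sq, Odd.neg_pow (by decide), Complex.I_pow_three, neg_neg]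

theorem PU4SignedSum_eq_of_one_lt_re {p q a b c : ℕ} (hp : 0 < p) (hq : 0 < q) (ha : 0 < a)
    (hb : 0 < b) (hc : 0 < c) {s : ℂ} (hs : 1 < s.re) : PU4SignedSum p q a b c s =
      (J0 p q a b c s - J1 p q a b c s + J2 p q a b c s - J3 p q a b c s) / 4 := by
  rw [PU4SignedSum_eq_twistedSum hp hq ha hb hc hs, twistedSum_one hp hq ha hb hc hs,
    twistedSum_neg_one hp hq ha hb hc hs, twistedSum_I hp hq ha hb hc hs,
    twistedSum_neg_I hp hq ha hb hc hs]
  ring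

/-! ### Regular points -/

theorem doubleTRegular_of_one_lt_re {p q : ℕ} (hp : 0 < p) (hq : 0 < q) {x y : ℂ} (hx : ‖x‖ = 1)
    (hy : ‖y‖ = 1) {s : ℂ} (hs : 1 < s.re) : DoubleTRegular p s q x y :=
  (isDirichletFamily_doubleTerms hp hq hx hy).isRegularPoint hs

theorem fullRHSRegular_of_one_lt_re {p q a b c : ℕ} (hp : 0 < p) (hq : 0 < q) (ha : 0 < a)
    (hb : 0 < b) (hc : 0 < c) {s : ℂ} (hs : 1 < s.re) {x₁ y₁ x₂ y₂ x₃ y₃ : ℂ} (hx₁ : ‖x₁‖ = 1)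
    (hy₁ : ‖y₁‖ = 1) (hx₂ : ‖x₂‖ = 1) (hy₂ : ‖y₂‖ = 1) (hx₃ : ‖x₃‖ = 1) (hy₃ : ‖y₃‖ = 1) :
    FullRHSRegular x₁ y₁ x₂ y₂ x₃ y₃ p q a b c s := by
  have h2 : ∀ m n : ℕ, 1 < (s + m + n).re := fun m n =>
    one_lt_re_add_natCast (one_lt_re_add_natCast hs m) n
  have h3 : ∀ m n : ℕ, 1 < (s + m + n + 1).re := fun m n => by
    simpa using one_lt_re_add_natCast (h2 m n) 1
  exact ⟨fun j hj ω hω => doubleTRegular_of_one_lt_re (by omega) (by omega) hx₁ hy₁ hs,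
    fun j hj ω hω => doubleTRegular_of_one_lt_re (by omega) (by omega) hx₂ hy₂ (h2 _ _),
    fun j hj ω hω => doubleTRegular_of_one_lt_re (by omega) (by omega) hx₃ hy₃ hs,
    fun j hj ω hω => doubleTRegular_of_one_lt_re (by omega) (by omega) hx₃ hy₃ (h3 _ _)⟩

theorem FullRHSRegular.evenRHSRegular {p q a b c : ℕ} {s : ℂ} {x₁ y₁ x₂ y₂ x₃ y₃ : ℂ}
    (h : FullRHSRegular x₁ y₁ x₂ y₂ x₃ y₃ p q a b c s) :
    EvenRHSRegular x₁ y₁ x₂ y₂ x₃ y₃ p q a b c s :=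
  ⟨fun j hj => h.1 (2 * j) (by omega), fun j hj => h.2.1 (2 * j) (by omega),
    fun j hj => h.2.2.1 (2 * j) (by omega), fun j hj => h.2.2.2 (2 * j) (by omega)⟩

theorem jRegular_of_one_lt_re {p q a b c : ℕ} (hp : 0 < p) (hq : 0 < q) (ha : 0 < a)
    (hb : 0 < b) (hc : 0 < c) {s : ℂ} (hs : 1 < s.re) : JRegular p q a b c s :=
  ⟨(fullRHSRegular_of_one_lt_re hp hq ha hb hc hs (by simp) (by simp) (by simp) (by simp) (by simp)
      (by simp)).evenRHSRegular,
    fullRHSRegular_of_one_lt_re hp hq ha hb hc hs (by simp) (by simp) (by simp) (by simp) (by simp)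
      (by simp),
    (fullRHSRegular_of_one_lt_re hp hq ha hb hc hs (by simp) (by simp) (by simp) (by simp) (by simp)
      (by simp)).evenRHSRegular,
    fullRHSRegular_of_one_lt_re hp hq ha hb hc hs (by simp) (by simp) (by simp) (by simp) (by simp)
      (by simp)⟩

theorem pu4Regular_of_one_lt_re {p q a b c : ℕ} (hp : 0 < p) (hq : 0 < q) (ha : 0 < a)
    (hb : 0 < b) (hc : 0 < c) {s : ℂ} (hs : 1 < s.re) : PU4Regular p q a b c s := fun i =>
  (isDirichletFamily_zetaPU4Terms hp hq ha hb hc i).isRegularPoint hs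

/-! ### Continuation of both sides -/

theorem PU4Regular.isContinuedAt {p q a b c : ℕ} (hp : 0 < p) (hq : 0 < q) (ha : 0 < a)
    (hb : 0 < b) (hc : 0 < c) {s : ℂ} (h : PU4Regular p q a b c s) :
    IsContinuedAt (PU4SignedSum p q a b c) s :=
  IsContinuedAt.sum (u := Finset.univ) fun i _ =>
    ((isDirichletFamily_zetaPU4Terms hp hq ha hb hc i).isContinuedAt (h i)).const_mul _

theorem DoubleTRegular.isContinuedAt {p q : ℕ} (hp : 0 < p) (hq : 0 < q) {x y : ℂ} (hx : ‖x‖ = 1)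
    (hy : ‖y‖ = 1) {s d : ℂ} (h : DoubleTRegular p (s + d) q x y) :
    IsContinuedAt (fun z => doubleT p (z + d) q x y) s :=
  IsContinuedAt.comp_add_const d ((isDirichletFamily_doubleTerms hp hq hx hy).isContinuedAt h)

theorem DoubleTRegular.isContinuedAt_zero {p q : ℕ} (hp : 0 < p) (hq : 0 < q) {x y : ℂ}
    (hx : ‖x‖ = 1) (hy : ‖y‖ = 1) {s : ℂ} (h : DoubleTRegular p s q x y) :
    IsContinuedAt (fun z => doubleT p z q x y) s :=
  (isDirichletFamily_doubleTerms hp hq hx hy).isContinuedAt h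

theorem IsContinuedAt.const_mul_sum_sum {k : ℂ} {J : ℕ} {W : ℕ → ℕ} {f : ℕ → ℂ} {e : ℕ → ℕ → ℂ}
    {Φ : ℕ → ℕ → ℂ → ℂ} {s : ℂ} (h : ∀ j < J, ∀ ω < W j, IsContinuedAt (Φ j ω) s) :
    IsContinuedAt (fun z => k * ∑ j ∈ Finset.range J, f j *
      ∑ ω ∈ Finset.range (W j), e j ω * Φ j ω z) s :=
  .const_mul _ <| .sum fun j hj => .const_mul _ <| .sum fun ω hω => .const_mul _ <|
    h j (Finset.mem_range.1 hj) ω (Finset.mem_range.1 hω)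

theorem EvenRHSRegular.isContinuedAt {p q a b c : ℕ} (hq : 0 < q) (ha : 0 < a)
    (hb : 0 < b) (hc : 0 < c) {s : ℂ} {x₁ y₁ x₂ y₂ x₃ y₃ : ℂ} (hx₁ : ‖x₁‖ = 1)
    (hy₁ : ‖y₁‖ = 1) (hx₂ : ‖x₂‖ = 1) (hy₂ : ‖y₂‖ = 1) (hx₃ : ‖x₃‖ = 1) (hy₃ : ‖y₃‖ = 1)
    (h : EvenRHSRegular x₁ y₁ x₂ y₂ x₃ y₃ p q a b c s) (f : ℕ → ℂ) :
    IsContinuedAt (evenRHS f x₁ y₁ x₂ y₂ x₃ y₃ p q a b c) s := by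
  obtain ⟨h₁, h₂, h₃, h₄⟩ := h
  refine IsContinuedAt.add (.add (.add (.const_mul_sum_sum fun j hj ω hω => ?_)
    (.const_mul_sum_sum fun j hj ω hω => ?_)) (.const_mul_sum_sum fun j hj ω hω => ?_))
    (.const_mul_sum_sum fun j hj ω hω => ?_)
  · exact (h₁ j (by omega) ω (by omega)).isContinuedAt_zero (by omega) (by omega) hx₁ hy₁
  · simp only [add_assoc _ (a : ℂ)]
    exact DoubleTRegular.isContinuedAt hq (by omega) hx₂ hy₂
      (by rw [← add_assoc]; exact h₂ j (by omega) ω (by omega))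
  · exact (h₃ j (by omega) ω (by omega)).isContinuedAt_zero (by omega) (by omega) hx₃ hy₃
  · simp only [add_assoc _ ((a - 2 * j : ℕ) : ℂ), add_assoc _ ((a - 2 * j : ℕ) + ω : ℂ)]
    exact DoubleTRegular.isContinuedAt hq (by omega) hx₃ hy₃
      (by rw [← add_assoc, ← add_assoc]; exact h₄ j (by omega) ω (by omega))

theorem FullRHSRegular.isContinuedAt {p q a b c : ℕ} (hq : 0 < q) (ha : 0 < a)
    (hb : 0 < b) (hc : 0 < c) {s : ℂ} {x₁ y₁ x₂ y₂ x₃ y₃ : ℂ} (hx₁ : ‖x₁‖ = 1)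
    (hy₁ : ‖y₁‖ = 1) (hx₂ : ‖x₂‖ = 1) (hy₂ : ‖y₂‖ = 1) (hx₃ : ‖x₃‖ = 1) (hy₃ : ‖y₃‖ = 1)
    (h : FullRHSRegular x₁ y₁ x₂ y₂ x₃ y₃ p q a b c s) (f : ℕ → ℂ) :
    IsContinuedAt (fullRHS f x₁ y₁ x₂ y₂ x₃ y₃ p q a b c) s := by
  obtain ⟨h₁, h₂, h₃, h₄⟩ := h
  refine IsContinuedAt.add (.add (.add (.const_mul_sum_sum fun j hj ω hω => ?_)
    (.const_mul_sum_sum fun j hj ω hω => ?_)) (.const_mul_sum_sum fun j hj ω hω => ?_))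
    (.const_mul_sum_sum fun j hj ω hω => ?_)
  · exact (h₁ j (by omega) ω (by omega)).isContinuedAt_zero (by omega) (by omega) hx₁ hy₁
  · simp only [add_assoc _ (a : ℂ)]
    exact DoubleTRegular.isContinuedAt hq (by omega) hx₂ hy₂
      (by rw [← add_assoc]; exact h₂ j (by omega) ω (by omega))
  · exact (h₃ j (by omega) ω (by omega)).isContinuedAt_zero (by omega) (by omega) hx₃ hy₃
  · simp only [add_assoc _ ((a - j : ℕ) : ℂ), add_assoc _ ((a - j : ℕ) + ω : ℂ)]
    exact DoubleTRegular.isContinuedAt hq (by omega) hx₃ hy₃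
      (by rw [← add_assoc, ← add_assoc]; exact h₄ j (by omega) ω (by omega))

theorem PU4SignedSum_eq {p q a b c : ℕ} (hp : 0 < p) (hq : 0 < q) (ha : 0 < a)
    (hb : 0 < b) (hc : 0 < c) {s : ℂ} (hs : PU4Regular p q a b c s) (hJ : JRegular p q a b c s) :
    PU4SignedSum p q a b c s =
      (J0 p q a b c s - J1 p q a b c s + J2 p q a b c s - J3 p q a b c s) / 4 := by
  have h1 : ‖(1 : ℂ)‖ = 1 := norm_one
  have h2 : ‖(-1 : ℂ)‖ = 1 := by simp
  have h3 : ‖Complex.I‖ = 1 := Complex.norm_I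
  have h4 : ‖-Complex.I‖ = 1 := by simp
  have hR := (((hJ.1.isContinuedAt hq ha hb hc h1 h1 h1 h1 h1 h1 fun n => riemannZeta n).sub
    (hJ.2.1.isContinuedAt hq ha hb hc h2 h3 h4 h2 h4 h3 (bigLambda (-1)))).add
    (hJ.2.2.1.isContinuedAt hq ha hb hc h1 h2 h2 h1 h2 h2 phi)).sub
    (hJ.2.2.2.isContinuedAt hq ha hb hc h2 h4 h3 h2 h3 h4 (bigLambda 1))
  rw [div_eq_inv_mul]
  refine (hs.isContinuedAt hp hq ha hb hc).eq_of_eq_right (hR.const_mul 4⁻¹) fun z hz => ?_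
  rw [PU4SignedSum_eq_of_one_lt_re hp hq ha hb hc hz, div_eq_inv_mul]
  rfl

/-! ### Combinations of shifted values of `ζ` and `L(·, χ₄)` -/

/-- `Φ` is, for `re s > 1`, a combination of `ζ(s + k)`, `2^{-s} ζ(s + k)`, `4^{-s} ζ(s + k)` and
`L(s + k, χ₄)` for `2 ≤ k ≤ N`, with coefficients in `coefficientRing`. -/
def IsZetaCombination (N : ℕ) (Φ : ℂ → ℂ) : Prop :=
  ∃ A B C D : ℕ → coefficientRing, ∀ s : ℂ, 1 < s.re → Φ s =
    ∑ k ∈ Finset.Icc 2 N, (((A k : ℂ) + B k * 2 ^ (-s) + C k * 4 ^ (-s)) * riemannZeta (s + k) +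
      D k * Lchi4 (s + k))

namespace IsZetaCombination

variable {N : ℕ} {Φ Ψ : ℂ → ℂ}

theorem congr (hΦ : IsZetaCombination N Φ) (h : ∀ s : ℂ, 1 < s.re → Ψ s = Φ s) :
    IsZetaCombination N Ψ := by
  obtain ⟨A, B, C, D, hΦ⟩ := hΦ
  exact ⟨A, B, C, D, fun s hs => (h s hs).trans (hΦ s hs)⟩

theorem zero : IsZetaCombination N fun _ => 0 :=
  ⟨0, 0, 0, 0, fun s _ => by simp⟩

theorem add (hΦ : IsZetaCombination N Φ) (hΨ : IsZetaCombination N Ψ) :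
    IsZetaCombination N fun s => Φ s + Ψ s := by
  obtain ⟨A, B, C, D, hΦ⟩ := hΦ
  obtain ⟨A', B', C', D', hΨ⟩ := hΨ
  refine ⟨A + A', B + B', C + C', D + D', fun s hs => ?_⟩
  beta_reduce
  rw [hΦ s hs, hΨ s hs, ← Finset.sum_add_distrib]
  refine Finset.sum_congr rfl fun k _ => ?_
  simp only [Pi.add_apply, Subalgebra.coe_add]
  ring

theorem const_mul {r : ℂ} (hr : r ∈ coefficientRing) (hΦ : IsZetaCombination N Φ) :
    IsZetaCombination N fun s => r * Φ s := by
  obtain ⟨A, B, C, D, hΦ⟩ := hΦ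
  set R : ℕ → coefficientRing := fun _ => ⟨r, hr⟩ with hR
  refine ⟨R * A, R * B, R * C, R * D, fun s hs => ?_⟩
  beta_reduce
  rw [hΦ s hs, Finset.mul_sum]
  refine Finset.sum_congr rfl fun k _ => ?_
  simp only [Pi.mul_apply, Subalgebra.coe_mul, hR]
  ring

theorem sub (hΦ : IsZetaCombination N Φ) (hΨ : IsZetaCombination N Ψ) :
    IsZetaCombination N fun s => Φ s - Ψ s := by
  simpa [sub_eq_add_neg] using hΦ.add (hΨ.const_mul (neg_mem (one_mem coefficientRing)))

theorem sum {ι : Type*} {u : Finset ι} {Φ : ι → ℂ → ℂ} (h : ∀ i ∈ u, IsZetaCombination N (Φ i)) :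
    IsZetaCombination N fun s => ∑ i ∈ u, Φ i s := by
  classical
  induction u using Finset.induction_on with
  | empty => simpa using zero
  | insert i u hi ih =>
    simp only [Finset.sum_insert hi]
    exact (h i (Finset.mem_insert_self i u)).add
      (ih fun j hj => h j (Finset.mem_insert_of_mem hj))

theorem of_single {α β γ δ : ℂ} (hα : α ∈ coefficientRing) (hβ : β ∈ coefficientRing)
    (hγ : γ ∈ coefficientRing) (hδ : δ ∈ coefficientRing) {k : ℕ} (h2 : 2 ≤ k) (hN : k ≤ N) :
    IsZetaCombination N fun s =>
      (α + β * 2 ^ (-s) + γ * 4 ^ (-s)) * riemannZeta (s + k) + δ * Lchi4 (s + k) := by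
  refine ⟨Pi.single k ⟨α, hα⟩, Pi.single k ⟨β, hβ⟩, Pi.single k ⟨γ, hγ⟩, Pi.single k ⟨δ, hδ⟩,
    fun s _ => ?_⟩
  rw [Finset.sum_eq_single_of_mem k (Finset.mem_Icc.2 ⟨h2, hN⟩)]
  · simp only [Pi.single_eq_same]
  · intro l _ hl
    simp [Pi.single_eq_of_ne hl]

end IsZetaCombination

theorem two_zpow_mem_coefficientRing (n : ℤ) : (2 : ℂ) ^ n ∈ coefficientRing := by
  have := coefficientRing.algebraMap_mem ((2 : ℚ) ^ n)
  simpa using this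

theorem I_mem_coefficientRing : Complex.I ∈ coefficientRing :=
  Algebra.subset_adjoin (.inl (.inl rfl))

theorem riemannZeta_even_mem_coefficientRing {n : ℕ} (hn : Even n) :
    2 * riemannZeta n ∈ coefficientRing := by
  obtain ⟨r, rfl⟩ := hn
  rcases Nat.eq_zero_or_pos r with rfl | hr
  · rw [add_zero, Nat.cast_zero, riemannZeta_zero, mul_div_cancel₀ _ two_ne_zero]
    exact neg_mem (one_mem _)
  · refine mul_mem (natCast_mem _ 2) (Algebra.subset_adjoin (.inl (.inr ⟨r, hr, ?_⟩)))
    rw [Nat.cast_add, two_mul]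

theorem Lchi4_odd_mem_coefficientRing {n : ℕ} (hn : Odd n) : Lchi4 n ∈ coefficientRing := by
  obtain ⟨r, rfl⟩ := hn
  refine Algebra.subset_adjoin (.inr ⟨r, ?_⟩)
  push_cast
  rfl

theorem phi_even_mem_coefficientRing {n : ℕ} (hn : Even n) : 2 * phi n ∈ coefficientRing := by
  rw [phi, mul_left_comm]
  exact mul_mem (sub_mem (two_zpow_mem_coefficientRing _) (one_mem _))
    (riemannZeta_even_mem_coefficientRing hn)

theorem evenWeight_mem_coefficientRing {f : ℕ → ℂ}
    (h : ∀ n, Even n → 2 * f n ∈ coefficientRing) (n : ℕ) : evenWeight f n ∈ coefficientRing := by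
  rw [evenWeight]
  split_ifs with hn
  · exact h n hn
  · exact zero_mem _

theorem bigLambda_mem_coefficientRing {ε : ℂ} (hε : ε ∈ coefficientRing) (n : ℕ) :
    bigLambda ε n ∈ coefficientRing := by
  have h2 : (2 : ℂ) ^ (-(n : ℂ)) = 2 ^ (-n : ℤ) := by
    rw [← Complex.cpow_intCast]; push_cast; rfl
  rw [bigLambda_eq, ← rootSum_neg_one, rootSum_neg_one_natCast, h2]
  rcases Nat.even_or_odd n with hn | hn
  · rw [hn.neg_one_pow, sub_self, mul_zero, zero_mul, add_zero, one_add_one_eq_two, mul_left_comm]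
    exact mul_mem (two_zpow_mem_coefficientRing _) (phi_even_mem_coefficientRing hn)
  · rw [hn.neg_one_pow, add_neg_cancel, zero_mul, zero_add, sub_neg_eq_add, one_add_one_eq_two]
    exact mul_mem (mul_mem (mul_mem hε I_mem_coefficientRing) (natCast_mem _ 2))
      (Lchi4_odd_mem_coefficientRing hn)

theorem exists_isSymmetricWeight {x : ℂ} (hx : x ∈ fourthRoots) :
    ∃ g, IsSymmetricWeight x g ∧ ∀ j, g j ∈ coefficientRing := by
  rcases hx with rfl | rfl | rfl | rfl
  · exact ⟨_, isSymmetricWeight_one,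
      evenWeight_mem_coefficientRing fun n => riemannZeta_even_mem_coefficientRing⟩
  · exact ⟨_, isSymmetricWeight_neg_one,
      evenWeight_mem_coefficientRing fun n => phi_even_mem_coefficientRing⟩
  · exact ⟨_, isSymmetricWeight_I, bigLambda_mem_coefficientRing (one_mem _)⟩
  · exact ⟨_, isSymmetricWeight_neg_I, bigLambda_mem_coefficientRing (neg_mem (one_mem _))⟩

theorem IsZetaCombination.rootSum {y : ℂ} (hy : y ∈ fourthRoots) {k N : ℕ} (h2 : 2 ≤ k)
    (hN : k ≤ N) : IsZetaCombination N fun s => rootSum y (s + k) := by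
  have e1 : ∀ s : ℂ, (2 : ℂ) ^ (1 - (s + k)) = 2 ^ (1 - k : ℤ) * 2 ^ (-s) := fun s => by
    rw [← Complex.cpow_intCast, ← Complex.cpow_add _ _ two_ne_zero]
    congr 1; push_cast; ring
  have e2 : ∀ s : ℂ, (2 : ℂ) ^ (-(s + k)) = 2 ^ (-k : ℤ) * 2 ^ (-s) := fun s => by
    rw [← Complex.cpow_intCast, ← Complex.cpow_add _ _ two_ne_zero]
    congr 1; push_cast; ring
  have e4 : ∀ s : ℂ, (4 : ℂ) ^ (-s) = 2 ^ (-s) * 2 ^ (-s) := fun s => by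
    have h := Complex.natCast_mul_natCast_cpow 2 2 (-s)
    norm_num at h
    exact h
  have key : ∀ z ∈ coefficientRing, IsZetaCombination N fun s =>
      2 ^ (-(s + k)) * ((2 ^ (1 - (s + k)) - 1) * riemannZeta (s + k)) + z * Lchi4 (s + k) := by
    intro z hz
    refine (IsZetaCombination.of_single (zero_mem _)
      (neg_mem (two_zpow_mem_coefficientRing (-k : ℤ)))
      (mul_mem (two_zpow_mem_coefficientRing (-k : ℤ)) (two_zpow_mem_coefficientRing (1 - k : ℤ)))
      hz h2 hN).congr fun s _ => ?_
    rw [e1, e2, e4]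
    ring
  rcases hy with rfl | rfl | rfl | rfl
  · refine (IsZetaCombination.of_single (one_mem _) (zero_mem _) (zero_mem _) (zero_mem _)
      h2 hN).congr fun s _ => ?_
    rw [rootSum_one]
    ring
  · refine (IsZetaCombination.of_single (neg_mem (one_mem _))
      (two_zpow_mem_coefficientRing (1 - k : ℤ)) (zero_mem _) (zero_mem _)
      h2 hN).congr fun s _ => ?_
    rw [rootSum_neg_one, e1]
    ring
  · simp only [rootSum_I]
    exact key _ I_mem_coefficientRing
  · simp only [rootSum_neg_I]
    exact key _ (neg_mem I_mem_coefficientRing)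

theorem mem_fourthRoots_iff {y : ℂ} : y ∈ fourthRoots ↔ y ^ 4 = 1 := by
  have : y ^ 4 - 1 = (y - 1) * (y + 1) * (y - Complex.I) * (y + Complex.I) := by
    linear_combination (y ^ 2 - 1) * Complex.I_sq
  rw [← sub_eq_zero, this]
  simp only [fourthRoots, Set.mem_insert_iff, Set.mem_singleton_iff, mul_eq_zero, sub_eq_zero,
    add_eq_zero_iff_eq_neg, or_assoc]

theorem norm_of_mem_fourthRoots {y : ℂ} (hy : y ∈ fourthRoots) : ‖y‖ = 1 :=
  Complex.norm_eq_one_of_pow_eq_one (mem_fourthRoots_iff.1 hy) four_ne_zero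

theorem natCast_cpow_add_natCast_inv (m : ℕ) {s : ℂ} (hs : 1 < s.re) (k : ℕ) :
    ((m : ℂ) ^ (s + k))⁻¹ = ((m : ℂ) ^ s)⁻¹ * ((m : ℂ) ^ k)⁻¹ := by
  rcases Nat.eq_zero_or_pos m with rfl | hm
  · have h0 : s ≠ 0 := by rintro rfl; norm_num at hs
    have h1 : s + k ≠ 0 := fun h => by
      have := one_lt_re_add_natCast hs k
      rw [h] at this
      norm_num at this
    simp [h0, h1]
  · have : (m : ℂ) ≠ 0 := by exact_mod_cast hm.ne'
    rw [Complex.cpow_add _ _ this, Complex.cpow_natCast, mul_inv]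

open SummationFilter in
/-- Evaluating the sum over `l` for each `m` turns the double series into single ones. -/
theorem doubleT_eq_sum_rootSum {p q : ℕ} (hp : 0 < p) (hq : 0 < q) {x y : ℂ}
    (hx : x ∈ fourthRoots) (hy : y ∈ fourthRoots) {g : ℕ → ℂ} (hg : IsSymmetricWeight x g) {s : ℂ}
    (hs : 1 < s.re) : doubleT p s q x y =
      ∑ j ∈ Finset.range (p + 1), g j * ((-1) ^ (p - j) * ((q + (p - j) - 1).choose (p - j) : ℂ) *
          rootSum y (s + (q + (p - j) : ℕ))) +
        ∑ j ∈ Finset.range (q + 1), g j * ((-1) ^ p * ((p + (q - j) - 1).choose (q - j) : ℂ) *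
          rootSum (x⁻¹ * y) (s + (p + (q - j) : ℕ))) := by
  have hx1 := norm_of_mem_fourthRoots hx
  have hx0 : x ≠ 0 := by rintro rfl; simp at hx1
  have hs0 : s ≠ 0 := by rintro rfl; norm_num at hs
  have hxy : x⁻¹ * y ∈ fourthRoots := by
    rw [mem_fourthRoots_iff] at *
    rw [mul_pow, inv_pow, hx, hy, inv_one, one_mul]
  -- the summand, extended by zero to all of `ℤ × ℕ`
  set G : ℤ × ℕ → ℂ := fun i => y ^ i.2 * ((i.2 : ℂ) ^ s)⁻¹ *
    (x ^ i.1 * ((i.1 : ℂ) ^ p * ((i.1 : ℂ) + (i.2 : ℤ)) ^ q)⁻¹) with hG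
  have hinj : Function.Injective
    (Subtype.val : {i : ℤ × ℕ // i.1 ≠ 0 ∧ 1 ≤ i.2 ∧ i.1 + i.2 ≠ 0} → ℤ × ℕ) :=
      Subtype.val_injective
  have h1 : HasSum G (doubleT p s q x y) := by
    rw [← hinj.hasSum_iff]
    · refine (hasSum_doubleTerms hp hq hx1 (norm_of_mem_fourthRoots hy) hs).congr_fun fun i => ?_
      simp only [hG, doubleTerms, Function.comp_apply, div_eq_mul_inv, mul_inv]
      push_cast
      ring
    · rintro ⟨l, m⟩ h
      have : l = 0 ∨ m = 0 ∨ l + m = 0 := by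
        by_contra hcon
        push Not at hcon
        exact h ⟨⟨(l, m), hcon.1, Nat.one_le_iff_ne_zero.2 hcon.2.1, hcon.2.2⟩, rfl⟩
      rcases this with rfl | rfl | h0
      · simp [hG, hp.ne']
      · simp [hG, hs0]
      · have : (l : ℂ) + m = 0 := by exact_mod_cast h0
        simp [hG, this, hq.ne']
  have h2 : HasSum (fun i : ℕ × ℤ => G (i.2, i.1)) (doubleT p s q x y) :=
    (Equiv.prodComm ℕ ℤ).hasSum_iff.2 h1
  have hfib : ∀ m : ℕ, ∑' l : ℤ, G (l, m) = y ^ m * ((m : ℂ) ^ s)⁻¹ *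
      (∑ j ∈ Finset.range (p + 1), g j * ((-1) ^ (p - j) *
          ((q + (p - j) - 1).choose (p - j) : ℂ) * ((m : ℂ) ^ (q + (p - j)))⁻¹) +
        x ^ (-(m : ℤ)) * ∑ j ∈ Finset.range (q + 1), g j * ((-1) ^ p *
          ((p + (q - j) - 1).choose (q - j) : ℂ) * ((m : ℂ) ^ (p + (q - j)))⁻¹)) := by
    intro m
    rcases Nat.eq_zero_or_pos m with rfl | hm
    · simp [hG, hs0]
    · have hsum : Summable fun l : ℤ => G (l, m) :=
        h2.summable.comp_injective (i := fun l : ℤ => (m, l)) fun _ _ h => (Prod.mk.inj h).2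
      have h3 : HasSum (fun l : ℤ => G (l, m)) (∑' l : ℤ, G (l, m)) (symmetricIcc ℤ) :=
        hsum.hasSum.mono_left LeAtTop.le_atTop
      refine h3.unique ?_
      exact (hasSum_symmetricIcc_two_poles hx1 hg.zero hg.hasSum hp hq
        (m := (m : ℤ)) (by omega)).mul_left (y ^ m * ((m : ℂ) ^ s)⁻¹)
  have h4 : HasSum (fun m : ℕ => ∑' l : ℤ, G (l, m)) (doubleT p s q x y) :=
    h2.prod_fiberwise fun m => (h2.summable.comp_injective (i := fun l : ℤ => (m, l))
      fun _ _ h => (Prod.mk.inj h).2).hasSum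
  refine h4.unique ?_
  simp only [hfib]
  have hr : ∀ z ∈ fourthRoots, ∀ k : ℕ,
      HasSum (fun m : ℕ => z ^ m * (((m : ℂ) ^ s)⁻¹ * ((m : ℂ) ^ k)⁻¹)) (rootSum z (s + k)) :=
    fun z hz k => (hasSum_rootSum hz (one_lt_re_add_natCast hs k)).congr_fun fun m => by
      rw [natCast_cpow_add_natCast_inv m hs]
  refine ((hasSum_sum fun j _ => ((hr y hy _).mul_left _).mul_left _).add
    (hasSum_sum fun j _ => ((hr _ hxy _).mul_left _).mul_left _)).congr_fun fun m => ?_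
  rw [mul_add, Finset.mul_sum, Finset.mul_sum, Finset.mul_sum]
  congr 1
  · exact Finset.sum_congr rfl fun j _ => by ring
  · refine Finset.sum_congr rfl fun j _ => ?_
    rw [mul_pow, inv_pow, zpow_neg, zpow_natCast]
    ring

/-- The shifts that occur lie between `min p q + d` and `p + q + d`. -/
theorem IsZetaCombination.doubleT {p q d N : ℕ} (hp : 0 < p) (hq : 0 < q) {x y : ℂ}
    (hx : x ∈ fourthRoots) (hy : y ∈ fourthRoots) (hpd : 2 ≤ p + d) (hqd : 2 ≤ q + d)
    (hN : p + q + d ≤ N) : IsZetaCombination N fun s => doubleT p (s + d) q x y := by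
  obtain ⟨g, hg, hgR⟩ := exists_isSymmetricWeight hx
  have hxy : x⁻¹ * y ∈ fourthRoots := by
    rw [mem_fourthRoots_iff] at *
    rw [mul_pow, inv_pow, hx, hy, inv_one, one_mul]
  refine (IsZetaCombination.add (.sum fun j hj => .const_mul (hgR j) (.const_mul
    (mul_mem (pow_mem (neg_mem (one_mem _)) (p - j)) (natCast_mem _ _)) ?_))
    (.sum fun j hj => .const_mul (hgR j) (.const_mul
    (mul_mem (pow_mem (neg_mem (one_mem _)) p) (natCast_mem _ _)) ?_))).congr fun s hs =>
    doubleT_eq_sum_rootSum hp hq hx hy hg (one_lt_re_add_natCast hs d)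
  · rw [Finset.mem_range] at hj
    simp only [add_assoc, ← Nat.cast_add]
    exact .rootSum hy (by omega) (by omega)
  · rw [Finset.mem_range] at hj
    simp only [add_assoc, ← Nat.cast_add]
    exact .rootSum hxy (by omega) (by omega)

theorem IsZetaCombination.const_mul_sum_sum {N : ℕ} {k : ℂ} (hk : k ∈ coefficientRing) {J : ℕ}
    {W : ℕ → ℕ} {f : ℕ → ℂ} (hf : ∀ j, f j ∈ coefficientRing) {e e' : ℕ → ℕ → ℕ}
    {Φ : ℕ → ℕ → ℂ → ℂ} (h : ∀ j < J, ∀ ω < W j, IsZetaCombination N (Φ j ω)) :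
    IsZetaCombination N (fun z => k * ∑ j ∈ Finset.range J, f j *
      ∑ ω ∈ Finset.range (W j), (e j ω : ℂ) * (e' j ω : ℂ) * Φ j ω z) :=
  .const_mul hk <| .sum fun j hj => .const_mul (hf j) <| .sum fun ω hω =>
    .const_mul (mul_mem (natCast_mem _ _) (natCast_mem _ _)) <|
      h j (Finset.mem_range.1 hj) ω (Finset.mem_range.1 hω)

theorem IsZetaCombination.fullRHS {p q a b c : ℕ} (hp : 0 < p) (hq : 0 < q) (ha : 0 < a)
    (hb : 0 < b) (hc : 0 < c) {x₁ y₁ x₂ y₂ x₃ y₃ : ℂ} (hx₁ : x₁ ∈ fourthRoots)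
    (hy₁ : y₁ ∈ fourthRoots) (hx₂ : x₂ ∈ fourthRoots) (hy₂ : y₂ ∈ fourthRoots)
    (hx₃ : x₃ ∈ fourthRoots) (hy₃ : y₃ ∈ fourthRoots) {f : ℕ → ℂ}
    (hf : ∀ j, f j ∈ coefficientRing) :
    IsZetaCombination (p + q + a + b + c) (fullRHS f x₁ y₁ x₂ y₂ x₃ y₃ p q a b c) := by
  have h1 : ∀ n : ℕ, (-1 : ℂ) ^ n ∈ coefficientRing := fun n => pow_mem (neg_mem (one_mem _)) n
  have hf' : ∀ j, f j * (-1) ^ j ∈ coefficientRing := fun j => mul_mem (hf j) (h1 j)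
  refine IsZetaCombination.add (.add (.add
    (.const_mul_sum_sum (h1 p) hf' fun j hj ω hω => ?_)
    (.const_mul_sum_sum (h1 (p + a)) hf fun j hj ω hω => ?_))
    (.const_mul_sum_sum (h1 p) hf fun j hj ω hω => ?_))
    (.const_mul_sum_sum (h1 (p + a)) hf' fun j hj ω hω => ?_)
  · refine (IsZetaCombination.doubleT (d := 0) (p := q + a + ω) (q := p + b + c - j - ω) ?_ ?_ hx₁
      hy₁ ?_ ?_ ?_).congr fun s _ => by rw [Nat.cast_zero, add_zero]
    all_goals omega
  · refine (IsZetaCombination.doubleT (d := a + ω) (p := q) (q := p + b + c - j - ω) ?_ ?_ hx₂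
      hy₂ ?_ ?_ ?_).congr fun s _ => by rw [Nat.cast_add, add_assoc]
    all_goals omega
  · refine (IsZetaCombination.doubleT (d := 0) (p := q + (a - j) + ω + 1)
      (q := p + b + c - 1 - ω) ?_ ?_ hx₃ hy₃ ?_ ?_ ?_).congr fun s _ => by
        rw [Nat.cast_zero, add_zero]
    all_goals omega
  · refine (IsZetaCombination.doubleT (d := a - j + ω + 1) (p := q)
      (q := p + b + c - 1 - ω) ?_ ?_ hx₃ hy₃ ?_ ?_ ?_).congr fun s _ => by
        rw [Nat.cast_add, Nat.cast_add, Nat.cast_one, add_assoc s, add_assoc s]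
    all_goals omega

theorem isZetaCombination_PU4SignedSum {p q a b c : ℕ} (hp : 0 < p) (hq : 0 < q) (ha : 0 < a)
    (hb : 0 < b) (hc : 0 < c) :
    IsZetaCombination (p + q + a + b + c) (PU4SignedSum p q a b c) := by
  have h1 : (1 : ℂ) ∈ fourthRoots := .inl rfl
  have h2 : (-1 : ℂ) ∈ fourthRoots := .inr (.inl rfl)
  have h3 : Complex.I ∈ fourthRoots := .inr (.inr (.inl rfl))
  have h4 : -Complex.I ∈ fourthRoots := .inr (.inr (.inr rfl))
  have hJ0 := IsZetaCombination.fullRHS hp hq ha hb hc h1 h1 h1 h1 h1 h1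
    (evenWeight_mem_coefficientRing fun n => riemannZeta_even_mem_coefficientRing)
  have hJ1 := IsZetaCombination.fullRHS hp hq ha hb hc h2 h3 h4 h2 h4 h3
    (bigLambda_mem_coefficientRing (neg_mem (one_mem _)))
  have hJ2 := IsZetaCombination.fullRHS hp hq ha hb hc h1 h2 h2 h1 h2 h2
    (evenWeight_mem_coefficientRing fun n => phi_even_mem_coefficientRing)
  have hJ3 := IsZetaCombination.fullRHS hp hq ha hb hc h2 h4 h3 h2 h3 h4
    (bigLambda_mem_coefficientRing (one_mem _))
  have h : (2 : ℂ) ^ (-2 : ℤ) ∈ coefficientRing := two_zpow_mem_coefficientRing _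
  refine (((((hJ0.sub hJ1).add hJ2).sub hJ3).const_mul h)).congr fun s hs => ?_
  rw [PU4SignedSum_eq_of_one_lt_re hp hq ha hb hc hs, fullRHS_evenWeight, fullRHS_evenWeight,
    J0, J1, J2, J3]
  norm_num
  ring

/-! ### Continuation of the right-hand side -/

theorem meromorphicAt_riemannZeta (z : ℂ) : MeromorphicAt riemannZeta z := by
  have hdiff : ∀ w : ℂ, w ≠ 1 → DifferentiableAt ℂ riemannZeta w := fun w hw =>
    differentiableAt_riemannZeta hw
  have han : ∀ w : ℂ, w ≠ 1 → AnalyticAt ℂ riemannZeta w := fun w hw =>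
    (DifferentiableOn.analyticAt (s := {1}ᶜ)
      (fun u hu => (hdiff u hu).differentiableWithinAt) (isOpen_compl_singleton.mem_nhds hw))
  rcases eq_or_ne z 1 with rfl | hz
  · -- the factor `(w - 1)²` instead of `w - 1` also gives the right value at `w = 1`
    refine ⟨2, Complex.analyticAt_of_differentiable_on_punctured_nhds_of_continuousAt ?_ ?_⟩
    · filter_upwards [self_mem_nhdsWithin] with w hw
      exact ((differentiableAt_id.sub_const 1).pow 2).smul (hdiff w hw)
    · rw [continuousAt_iff_punctured_nhds]
      have h1 : Filter.Tendsto (fun w : ℂ => w - 1) (nhdsWithin 1 {1}ᶜ) (nhds 0) := by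
        have : ContinuousAt (fun w : ℂ => w - 1) 1 := by fun_prop
        simpa using this.tendsto.mono_left nhdsWithin_le_nhds
      have h2 := h1.mul riemannZeta_residue_one
      simp only [sub_self, zero_pow two_ne_zero, zero_smul]
      rw [zero_mul] at h2
      exact h2.congr fun w => by rw [smul_eq_mul]; ring
  · exact (han z hz).meromorphicAt

theorem isContinuedAt_riemannZeta {s : ℂ} (hs : s ≠ 1) : IsContinuedAt riemannZeta s :=
  .of_meromorphic meromorphicAt_riemannZeta <|
    DifferentiableOn.analyticAt (s := {1}ᶜ)
      (fun _ hu => (differentiableAt_riemannZeta hu).differentiableWithinAt)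
      (isOpen_compl_singleton.mem_nhds hs)

theorem isContinuedAt_cpow_neg {n : ℂ} (hn : n ≠ 0) (s : ℂ) :
    IsContinuedAt (fun z => n ^ (-z)) s :=
  .of_differentiable fun _ => differentiableAt_id.neg.const_cpow (.inl hn)

theorem mainTheorem4 (p q a b c : ℕ) (hp : 0 < p) (hq : 0 < q) (ha : 0 < a) (hb : 0 < b)
    (hc : 0 < c) :
    (∀ s : ℂ, 1 < s.re → PU4Regular p q a b c s ∧ JRegular p q a b c s) ∧
    (∀ s : ℂ, PU4Regular p q a b c s → JRegular p q a b c s →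
      PU4SignedSum p q a b c s =
        (J0 p q a b c s - J1 p q a b c s + J2 p q a b c s - J3 p q a b c s) / 4) ∧
    (∃ A B C D : ℕ → coefficientRing,
      ∀ s : ℂ, PU4Regular p q a b c s →
        (∀ k ∈ Finset.Icc 2 (p + q + a + b + c), s + k ≠ 1) →
        PU4SignedSum p q a b c s =
          ∑ k ∈ Finset.Icc 2 (p + q + a + b + c),
            (((A k : ℂ) + B k * 2 ^ (-s) + C k * 4 ^ (-s)) * riemannZeta (s + k) +
              D k * Lchi4 (s + k))) := by
  refine ⟨fun s hs => ⟨pu4Regular_of_one_lt_re hp hq ha hb hc hs,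
    jRegular_of_one_lt_re hp hq ha hb hc hs⟩, fun s => PU4SignedSum_eq hp hq ha hb hc, ?_⟩
  obtain ⟨A, B, C, D, h⟩ := isZetaCombination_PU4SignedSum hp hq ha hb hc
  refine ⟨A, B, C, D, fun s hs hk => (hs.isContinuedAt hp hq ha hb hc).eq_of_eq_right ?_ h⟩
  have hconst : ∀ r : ℂ, IsContinuedAt (fun _ => r) s := fun r =>
    .of_differentiable (differentiable_const r)
  exact .sum fun k hkN => .add (.mul
    (((hconst _).add ((isContinuedAt_cpow_neg (n := 2) (by norm_num) s).const_mul _)).add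
      ((isContinuedAt_cpow_neg (n := 4) (by norm_num) s).const_mul _))
    (.comp_add_const _ (isContinuedAt_riemannZeta (hk k hkN))))
    (.const_mul _ (.comp_add_const _ (.of_differentiable Lchi4_differentiable)))
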